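/- \textbf{Setting.} A labeled transition system (LTS) $(S,\Lambda,\to)$ has transitions $\to\ \subseteq S\times\Lambda\times S$. A relation $R\subseteq S\times S$ is a bisimulation if for all $(p,q)\in R$: for each $p\xrightarrow{\alpha}p'$ there is $q\xrightarrow{\alpha}q'$ with $(p',q')\in R$, and for each $q\xrightarrow{\alpha}q'$ there is $p\xrightarrow{\alpha}p'$ with $(p',q')\in R$. Let $f(R)$ be the set of those $(p,q)\in R$ that satisfy these two conditions relative to $R$. For a decreasing isotone map $f$ on a finite lattice $(L,\preceq)$, let $f^*(y)$ be the eventual value of $y,f(y),f(f(y)),\dots$, and let $\sqsubseteq$ be a total order on $L$. \emph{Algorithm 1} with upper bound $s\in L$ calls $\mathrm{search}(f^*(s),\emptyset,\emptyset)$, where $\mathrm{search}(x,P,D)$ outputs $x$, sets $E:=\emptyset$, and then, for each lower cover $y\lessdot x$ in the order $\sqsubseteq$, computes $z:=f^*(y)$; calls $\mathrm{search}(z,P\cup\{x\},D\cup E)$ if $z\not\preceq w$ for all $(u,v)\in D\cup E$ and all $w\lessdot u$ with $w\sqsubseteq v$; and sets $E:=\{(x,y)\}$. \textbf{Theorem.}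 For every LTS, $f$ is an isotone and decreasing map on the lattice of binary relations on $S$ ordered by inclusion, and its fixed points are exactly the bisimulations. Moreover there is a random access machine program such that for every constant $K$ there is a constant $C$ with the following property. Let $(S,\Lambda,\to)$ be a finite LTS with $n=|S|\ge 1$ states and $m=|{\to}|\le Kn^2$ transitions, given by an arbitrary numbering of the states, a list of the transitions in arbitrary order, and an injective numbering of the occurring labels by numbers below $m$. Then Algorithm 1, applied to $f$ with $s=S\times S$ and the lexicographic order of $0/1$ adjacency matrices read row by row, terminates and outputs every bisimulation exactly once. The program executes it: it terminates, and it reports on a write-only log, in order, exactly the limit queries (with argument and answer) and the outputs of Algorithm 1. The program has delay at most $Cn^8$, that is, at most $Cn^8$ unit-cost steps pass before the first output, between consecutive outputs, and between the last output and termination. It uses space at most $Cn^4$: a memory of at most $Cn^4$ cells, including the input, besides finitely many registers, where all numbers computed or stored are at most $Cn^4$, so that each fits into a word of $O(\log n)$ bits. -/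

import Mathlib

universe u v

open Classical in
/-- The characteristic word of a binary relation on a numbered set of `n` elements: the `n * n`
entries of its 0/1 adjacency matrix, row by row. -/
noncomputable def relWord {S : Type*} {n : ℕ} (num : S ≃ Fin n) (R : Set (S × S)) : List ℕ :=
  (List.finRange n).flatMap fun i =>
    (List.finRange n).map fun j => if (num.symm i, num.symm j) ∈ R then 1 else 0

/-! ### Labeled transition systems and bisimulations -/

/-- A labeled transition system with states `S` and labels `Λ`; `trans p a q` is the transition
from `p` to `q` labeled `a`. -/
structure LTS (S Λ : Type*) where
  trans : S → Λ → S → Prop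

namespace LTS

variable {S Λ : Type*}

/-- Bisimulations of a labeled transition system. -/
def IsBisimulation (A : LTS S Λ) (R : Set (S × S)) : Prop :=
  ∀ p q, (p, q) ∈ R →
    (∀ a p', A.trans p a p' → ∃ q', A.trans q a q' ∧ (p', q') ∈ R) ∧
    (∀ a q', A.trans q a q' → ∃ p', A.trans p a p' ∧ (p', q') ∈ R)

/-- The map on the lattice of binary relations that keeps those pairs of `R` that satisfy the two
transfer conditions relative to `R`. -/
def bisimMap (A : LTS S Λ) (R : Set (S × S)) : Set (S × S) :=
  {x | x ∈ R ∧
    (∀ a p', A.trans x.1 a p' → ∃ q', A.trans x.2 a q' ∧ (p', q') ∈ R) ∧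
    (∀ a q', A.trans x.2 a q' → ∃ p', A.trans x.1 a p' ∧ (p', q') ∈ R)}

/-- A presentation of a finite labeled transition system with `n` states as input of a machine:
the states are numbered by `0, …, n - 1`, the transitions are listed once each in some order, and
the labels that occur are numbered injectively by numbers below the number of transitions. -/
structure Presentation (A : LTS S Λ) (n : ℕ) where
  num : S ≃ Fin n
  lab : Λ → ℕ
  list : List (S × Λ × S)
  nodup_list : list.Nodup
  mem_list : ∀ p a q, (p, a, q) ∈ list ↔ A.trans p a q
  lab_inj : ∀ s ∈ list, ∀ t ∈ list, lab s.2.1 = lab t.2.1 → s.2.1 = t.2.1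
  lab_lt : ∀ t ∈ list, lab t.2.1 < list.length

namespace Presentation

variable {A : LTS S Λ} {n : ℕ}

/-- The input word: three numbers (source, label, target) for each transition. -/
def inputWord (E : A.Presentation n) : List ℕ :=
  E.list.flatMap fun t => [(E.num t.1 : ℕ), E.lab t.2.1, (E.num t.2.2 : ℕ)]

/-- The lexicographic order on binary relations, compared through their characteristic words. -/
def lex (E : A.Presentation n) (R R' : Set (S × S)) : Prop :=
  relWord E.num R ≤ relWord E.num R'

end Presentation

end LTS

/-! ### The enumeration algorithm on a finite lattice

The algorithm, for a decreasing isotone map `f : L → L` and an upper bound `s : L`, is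

    start by calling search(f*(s), ∅, ∅)
    function search(fixed point x, active path P, previously searched regions D)
      output x
      E ← ∅
      for y ⋖ x in lexicographic order
        z ← f*(y)
        if for all (u, v) ∈ D ∪ E and all w ⋖ u with w ⊑ v we have not z ≤ w
          search(z, P ∪ {x}, D ∪ E)
        E ← {(x, y)}
-/

namespace FixEnum

variable {L : Type*}

/-- `z` is the limit `f*(y)` of the sequence `y, f y, f (f y), …`. -/
def IsLimit (f : L → L) (y z : L) : Prop :=
  ∃ N, ∀ t, N ≤ t → f^[t] y = z

/-- The observable actions of the algorithm: a query for the limit of `y`, with its answer `z`,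
and the output of a fixed point `x`. -/
inductive Event (L : Type*) where
  | query (y z : L) : Event L
  | output (x : L) : Event L

/-- The outputs among a list of events, in order. -/
def outputs (tr : List (Event L)) : List L :=
  tr.filterMap fun
    | .query _ _ => none
    | .output x => some x

/-- Control points of the algorithm: a call of the function `search`, and its for-loop with the
lower covers `ys` still to be processed. -/
inductive Call (L : Type*) where
  | search (x : L) (P : Set L) (D : Set (L × L)) : Call L
  | forLoop (x : L) (P : Set L) (D E : Set (L × L)) (ys : List L) : Call L

variable [PartialOrder L]

/-- `ys` lists the lower covers of `x`, once each, in the order `lex`. -/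
def ListsLowerCovers (lex : L → L → Prop) (x : L) (ys : List L) : Prop :=
  ys.Nodup ∧ ys.Pairwise lex ∧ ∀ y, y ∈ ys ↔ y ⋖ x

/-- The test of the algorithm: `z` is in none of the searched regions described by `D`. -/
def Unsearched (lex : L → L → Prop) (D : Set (L × L)) (z : L) : Prop :=
  ∀ u v, (u, v) ∈ D → ∀ w, w ⋖ u → lex w v → ¬ z ≤ w

/-- `Runs f lex c tr`: execution from the control point `c` terminates, after exactly the events
`tr` in this order. -/
inductive Runs (f : L → L) (lex : L → L → Prop) : Call L → List (Event L) → Prop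
  | search {x P D ys tr} (hys : ListsLowerCovers lex x ys)
      (h : Runs f lex (.forLoop x P D ∅ ys) tr) :
      Runs f lex (.search x P D) (.output x :: tr)
  | done {x P D E} :
      Runs f lex (.forLoop x P D E []) []
  | skip {x P D E y ys z tr} (hz : IsLimit f y z) (ht : ¬ Unsearched lex (D ∪ E) z)
      (h : Runs f lex (.forLoop x P D {(x, y)} ys) tr) :
      Runs f lex (.forLoop x P D E (y :: ys)) (.query y z :: tr)
  | recurse {x P D E y ys z tr₁ tr₂} (hz : IsLimit f y z) (ht : Unsearched lex (D ∪ E) z)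
      (h₁ : Runs f lex (.search z (P ∪ {x}) (D ∪ E)) tr₁)
      (h₂ : Runs f lex (.forLoop x P D {(x, y)} ys) tr₂) :
      Runs f lex (.forLoop x P D E (y :: ys)) (.query y z :: (tr₁ ++ tr₂))

/-- The whole algorithm, with upper bound `s`, terminates with the events `tr`. -/
inductive AlgorithmRuns (f : L → L) (lex : L → L → Prop) (s : L) : List (Event L) → Prop
  | start {z tr} (hz : IsLimit f s z) (h : Runs f lex (.search z ∅ ∅) tr) :
      AlgorithmRuns f lex s (.query s z :: tr)

end FixEnum

/-! ### Random access machines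

Programs over finitely many registers and a random access memory of `M` cells, where every register
and every cell holds a number of at most `W`. Every elementary instruction and every evaluation of
a branching condition takes one unit of time. There is a write-only log, to which records are
written number by number. -/

namespace RAM

/-- Arithmetic operations on words. -/
inductive Op where
  | add | sub | mul | div | mod

/-- The value of an operation: subtraction is truncated at zero. -/
def Op.eval : Op → ℕ → ℕ → ℕ
  | .add, x, y => x + y
  | .sub, x, y => x - y
  | .mul, x, y => x * y
  | .div, x, y => x / y
  | .mod, x, y => x % y

/-- Kinds of records in the log: a solution that is output, or a protocol entry. -/
inductive Kind where
  | output | query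

/-- Programs; registers are named by natural numbers. -/
inductive Prog where
  /-- `r := k` -/
  | const (r k : ℕ) : Prog
  /-- `r := op a b` -/
  | arith (o : Op) (r a b : ℕ) : Prog
  /-- `r := memory[a]` -/
  | load (r a : ℕ) : Prog
  /-- `memory[a] := r` -/
  | store (a r : ℕ) : Prog
  /-- append the content of `r` to the current record -/
  | write (r : ℕ) : Prog
  /-- finish the current record and declare its kind -/
  | finish (k : Kind) : Prog
  | seq (c d : Prog) : Prog
  /-- if `r ≠ 0` then `c` else `d` -/
  | cond (r : ℕ) (c d : Prog) : Prog
  /-- while `r ≠ 0` do `c` -/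
  | loop (r : ℕ) (c : Prog) : Prog

/-- A finished record, with the time at which it was finished. -/
structure Record where
  kind : Kind
  word : List ℕ
  time : ℕ

structure State where
  reg : ℕ → ℕ
  mem : ℕ → ℕ
  /-- the number of elementary steps so far -/
  time : ℕ
  /-- the numbers written to the record that is not yet finished -/
  buffer : List ℕ
  /-- the finished records in chronological order -/
  log : List Record

/-- One unit of time passes. -/
def State.tick (σ : State) : State := { σ with time := σ.time + 1 }

/-- Write `v` into register `r`, in one unit of time. -/
def State.setReg (σ : State) (r v : ℕ) : State :=
  { σ with reg := Function.update σ.reg r v, time := σ.time + 1 }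

/-- Write `v` into cell `i`, in one unit of time. -/
def State.setMem (σ : State) (i v : ℕ) : State :=
  { σ with mem := Function.update σ.mem i v, time := σ.time + 1 }

/-- Append `v` to the current record, in one unit of time. -/
def State.push (σ : State) (v : ℕ) : State :=
  { σ with buffer := σ.buffer ++ [v], time := σ.time + 1 }

/-- Finish the current record, in one unit of time. -/
def State.close (σ : State) (k : Kind) : State :=
  { σ with
    buffer := []
    time := σ.time + 1
    log := σ.log ++ [⟨k, σ.buffer, σ.time + 1⟩] }

/-- `Exec M W c σ τ`: on a machine with `M` memory cells and numbers of at most `W`, the program `c`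
started in `σ` terminates in `τ`. An execution that addresses a cell outside of the memory or
computes a number above `W` is stuck, so that it does not terminate in this sense. -/
inductive Exec (M W : ℕ) : Prog → State → State → Prop
  | const {r k σ} (hW : k ≤ W) : Exec M W (.const r k) σ (σ.setReg r k)
  | arith {o r a b σ} (hW : Op.eval o (σ.reg a) (σ.reg b) ≤ W) :
      Exec M W (.arith o r a b) σ (σ.setReg r (Op.eval o (σ.reg a) (σ.reg b)))
  | load {r a σ} (hM : σ.reg a < M) (hW : σ.mem (σ.reg a) ≤ W) :
      Exec M W (.load r a) σ (σ.setReg r (σ.mem (σ.reg a)))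
  | store {a r σ} (hM : σ.reg a < M) (hW : σ.reg r ≤ W) :
      Exec M W (.store a r) σ (σ.setMem (σ.reg a) (σ.reg r))
  | write {r σ} : Exec M W (.write r) σ (σ.push (σ.reg r))
  | finish {k σ} : Exec M W (.finish k) σ (σ.close k)
  | seq {c d σ σ' τ} (h₁ : Exec M W c σ σ') (h₂ : Exec M W d σ' τ) : Exec M W (.seq c d) σ τ
  | condTrue {r c d σ τ} (hr : σ.reg r ≠ 0) (h : Exec M W c σ.tick τ) :
      Exec M W (.cond r c d) σ τ
  | condFalse {r c d σ τ} (hr : σ.reg r = 0) (h : Exec M W d σ.tick τ) :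
      Exec M W (.cond r c d) σ τ
  | loopTrue {r c σ σ' τ} (hr : σ.reg r ≠ 0) (h₁ : Exec M W c σ.tick σ')
      (h₂ : Exec M W (.loop r c) σ' τ) : Exec M W (.loop r c) σ τ
  | loopFalse {r c σ} (hr : σ.reg r = 0) : Exec M W (.loop r c) σ σ.tick

/-- The times at which solutions were output. -/
def outputTimes (log : List Record) : List ℕ :=
  log.filterMap fun ρ => match ρ.kind with
    | .output => some ρ.time
    | .query => none

/-- A finished run (started at time 0) has delay at most `d`: at most `d` steps pass before the
first output, between consecutive outputs, and between the last output and termination. -/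
def DelayAtMost (d : ℕ) (τ : State) : Prop :=
  List.IsChain (fun t t' => t' ≤ t + d) (0 :: (outputTimes τ.log ++ [τ.time]))

end RAM

/-- The initial state of a machine on a presented labeled transition system: the number of states
is in register 0, the number of transitions in register 1, the transitions are in the memory from
cell 0 on, and everything else is zero. -/
def LTS.Presentation.initState {S Λ : Type*} {A : LTS S Λ} {n : ℕ} (E : A.Presentation n) :
    RAM.State where
  reg := fun r => if r = 0 then n else if r = 1 then E.list.length else 0
  mem := fun i => E.inputWord.getD i 0
  time := 0
  buffer := []
  log := []

/-- The kind and the word of the record by which a machine has to report an event: the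
characteristic word of the relation that is output, or the characteristic words of the argument
and of the answer of a limit query. -/
noncomputable def LTS.Presentation.encodeEvent {S Λ : Type*} {A : LTS S Λ} {n : ℕ}
    (E : A.Presentation n) : FixEnum.Event (Set (S × S)) → RAM.Kind × List ℕ
  | .query y z => (.query, relWord E.num y ++ relWord E.num z)
  | .output x => (.output, relWord E.num x)

/-- `Implements E τ tr`: the records in the log at the end `τ` of a machine run are exactly the
events `tr` of the enumeration algorithm, in the same order. -/
def LTS.Presentation.Implements {S Λ : Type*} {A : LTS S Λ} {n : ℕ} (E : A.Presentation n)
    (τ : RAM.State) (tr : List (FixEnum.Event (Set (S × S)))) : Prop :=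
  τ.log.map (fun ρ => (ρ.kind, ρ.word)) = tr.map E.encodeEvent

/-!
The first part of the theorem is immediate from the definitions. For the second part, relations on
the `n` numbered states are encoded as sets of positions below `N = n * n`, read row by row.

*The algorithm.* The lower covers of a relation `X` are the sets `X.erase b` with `b ∈ X`, and
their lexicographic order is the order of `b`. For `Z ⊆ X`, the condition that `Z` is contained in
no lower cover of `X` up to `X.erase b` therefore means that `Z` contains all elements of `X` up to
`b`. Along a path of the search, all these conditions collapse into one (`FixEnum.Fresh`): if `X`
was reached by erasing `β`, then the limit `Z` of `X.erase b` has to be searched if and only if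
`β ≤ b` and `Z` agrees with `X` below `b`. `FixEnum.Trace` is the algorithm with this test, and
`LTS.Presentation.runs_of_trace` shows that it is an execution of the given algorithm. Its outputs
are determined in `FixEnum.Trace.outputs`: a bisimulation that is properly contained in `X` is
found exactly in the branch of the first position in which it differs from `X`.

*Limits.* The limit of a relation is the largest bisimulation that it contains. The transfer
conditions are a system of `2 * m * n` obligations, one for each transition, each state that may
have to match it, and each side; a pair of transitions with the same label gives two edges, each of
which meets an obligation as long as the pair of the targets is present
(`TransitionTable.obligations`). The machine counts for each obligation the edges that still meet
it. When a pair is removed, a linked list of the edges into it tells which counters decrease, and a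
counter that becomes zero marks another pair for removal. Each edge is handled once and each
removal costs at most one scan over the `N` pairs, so that a limit takes time of order
`m ^ 2 + N ^ 2`, which is of order `n ^ 4` (`RAM.wp_limitQuery`).

*Space and delay.* The relations on a path of the search are strictly decreasing, so a stack of
`N + 1` relations with `N` entries each suffices. Between two outputs the machine visits at most
`N + 1` positions on each of at most `N + 1` levels, and a visit costs one limit. This is accounted
for by a potential that increases with each step of the search (`RAM.potential`). The simulation
theorem is `RAM.wp_searchLoop_of_trace`.

The machine program is written in a small structured language, with expressions and interleaved
arrays that are compiled to the instructions of the machine. Its correctness proofs use a predicate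
for total correctness (`RAM.Wp`) in which running times and the bounds on addresses and numbers are
explicit. The program uses the following variables (machine registers) and arrays.

* Variables 0 to 5: `n`, `m`, the base address of the arrays, and the numbers `N` of pairs,
  `2 * m * n` of obligations and `2 * m ^ 2` of edges. Variable 6 is the level of the stack, 7 the
  current position, 8 the index in array 7 from which on the answer of a limit query is stored, and
  9 is nonzero as long as the search runs. The variables from 10 on are local.
* Arrays 0 to 4 represent the system of obligations (`Obligations.Stored`) and never change once
  they are built. Arrays 5 and 6 hold the counters of the obligations and the marks for removal.
  Array 7 is the stack of relations, array 8 holds the positions that were erased to reach them,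
  array 9 the argument of a limit query, and array 10 the result of the test.
-/

/-! ### Compiling expressions and arrays to the random access machine -/

namespace RAM

/-- Arithmetic expressions over the registers below 64, over sixteen arrays, and over a read-only
input word. -/
inductive Expr where
  | lit (k : ℕ) : Expr
  | var (x : ℕ) : Expr
  | bin (o : Op) (e e' : Expr) : Expr
  /-- entry number `i` of array number `a` -/
  | get (a : ℕ) (i : Expr) : Expr
  /-- entry number `i` of the input word -/
  | inp (i : Expr) : Expr

namespace Expr

instance : Add Expr := ⟨bin .add⟩
instance : Sub Expr := ⟨bin .sub⟩
instance : Mul Expr := ⟨bin .mul⟩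
instance : Div Expr := ⟨bin .div⟩
instance : Mod Expr := ⟨bin .mod⟩
instance (k : ℕ) : OfNat Expr k := ⟨lit k⟩

/-- Code that turns an index in register `t` into the address of that entry of array `a`: the
arrays are interleaved, so entry `i` lies at `base + 16 * i + a`, where register 2 holds `base`. -/
def address (a t : ℕ) : Prog :=
  .seq (.const (t + 1) 16) <| .seq (.arith .mul t t (t + 1)) <|
  .seq (.const (t + 1) a) <| .seq (.arith .add t t (t + 1)) (.arith .add t t 2)

/-- Code that leaves the value of an expression in register `t`, and uses no register below `t`
except for reading. -/
def compile : Expr → ℕ → Prog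
  | lit k, t => .const t k
  | var x, t => .seq (.const t 0) (.arith .add t x t)
  | bin o e e', t => .seq (e.compile t) (.seq (e'.compile (t + 1)) (.arith o t t (t + 1)))
  | get a i, t => .seq (i.compile t) (.seq (address a t) (.load t t))
  | inp i, t => .seq (i.compile t) (.load t t)

/-- The running time of the compiled expression. -/
def cost : Expr → ℕ
  | lit _ => 1
  | var _ => 2
  | bin _ e e' => e.cost + e'.cost + 1
  | get _ i => i.cost + 6
  | inp i => i.cost + 1

end Expr

/-- What structured programs see of a machine state: the registers below 64 that hold variables, and
the arrays. -/
structure View where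
  v : ℕ → ℕ
  arr : ℕ → ℕ → ℕ
  time : ℕ
  buffer : List ℕ
  log : List Record

/-- The use of the memory: a read-only input word in the cells below `base`, followed by sixteen
interleaved arrays of `size` entries each. All numbers and addresses are at most `bound`. -/
structure Layout where
  bound : ℕ
  base : ℕ
  size : ℕ
  input : ℕ → ℕ
  fits : base + 16 * size ≤ bound
  size_pos : 0 < size

namespace Expr

/-- The value of an expression. -/
def eval (V : Layout) (s : View) : Expr → ℕ
  | lit k => k
  | var x => s.v x
  | bin o e e' => o.eval (e.eval V s) (e'.eval V s)
  | get a i => s.arr a (i.eval V s)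
  | inp i => V.input (i.eval V s)

/-- The conditions under which the compiled expression is executed without a fault. -/
def Ok (V : Layout) (s : View) : Expr → Prop
  | lit k => k ≤ 16
  | var x => x < 64
  | bin .add e e' => e.Ok V s ∧ e'.Ok V s ∧ e.eval V s + e'.eval V s ≤ V.bound
  | bin .mul e e' => e.Ok V s ∧ e'.Ok V s ∧ e.eval V s * e'.eval V s ≤ V.bound
  | bin .sub e e' => e.Ok V s ∧ e'.Ok V s
  | bin .div e e' => e.Ok V s ∧ e'.Ok V s
  | bin .mod e e' => e.Ok V s ∧ e'.Ok V s
  | get a i => a < 16 ∧ i.Ok V s ∧ i.eval V s < V.size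
  | inp i => i.Ok V s ∧ i.eval V s < V.base

section
variable (V : Layout) (s : View)

@[simp] theorem eval_ofNat (k : ℕ) : (no_index (OfNat.ofNat k) : Expr).eval V s = k := rfl
@[simp] theorem eval_var (x : ℕ) : (var x).eval V s = s.v x := rfl
@[simp] theorem eval_add (e e' : Expr) : (e + e').eval V s = e.eval V s + e'.eval V s := rfl
@[simp] theorem eval_sub (e e' : Expr) : (e - e').eval V s = e.eval V s - e'.eval V s := rfl
@[simp] theorem eval_mul (e e' : Expr) : (e * e').eval V s = e.eval V s * e'.eval V s := rfl
@[simp] theorem eval_div (e e' : Expr) : (e / e').eval V s = e.eval V s / e'.eval V s := rfl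
@[simp] theorem eval_mod (e e' : Expr) : (e % e').eval V s = e.eval V s % e'.eval V s := rfl
@[simp] theorem eval_get (a : ℕ) (i : Expr) : (get a i).eval V s = s.arr a (i.eval V s) := rfl
@[simp] theorem eval_inp (i : Expr) : (inp i).eval V s = V.input (i.eval V s) := rfl

@[simp] theorem ok_ofNat (k : ℕ) : (no_index (OfNat.ofNat k) : Expr).Ok V s ↔ k ≤ 16 :=
  Iff.rfl
@[simp] theorem ok_var (x : ℕ) : (var x).Ok V s ↔ x < 64 := Iff.rfl
@[simp] theorem ok_add (e e' : Expr) : (e + e').Ok V s ↔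
    e.Ok V s ∧ e'.Ok V s ∧ e.eval V s + e'.eval V s ≤ V.bound := Iff.rfl
@[simp] theorem ok_mul (e e' : Expr) : (e * e').Ok V s ↔
    e.Ok V s ∧ e'.Ok V s ∧ e.eval V s * e'.eval V s ≤ V.bound := Iff.rfl
@[simp] theorem ok_sub (e e' : Expr) : (e - e').Ok V s ↔ e.Ok V s ∧ e'.Ok V s := Iff.rfl
@[simp] theorem ok_div (e e' : Expr) : (e / e').Ok V s ↔ e.Ok V s ∧ e'.Ok V s := Iff.rfl
@[simp] theorem ok_mod (e e' : Expr) : (e % e').Ok V s ↔ e.Ok V s ∧ e'.Ok V s := Iff.rfl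
@[simp] theorem ok_get (a : ℕ) (i : Expr) : (get a i).Ok V s ↔
    a < 16 ∧ i.Ok V s ∧ i.eval V s < V.size := Iff.rfl
@[simp] theorem ok_inp (i : Expr) : (inp i).Ok V s ↔
    i.Ok V s ∧ i.eval V s < V.base := Iff.rfl

@[simp] theorem cost_ofNat (k : ℕ) : (no_index (OfNat.ofNat k) : Expr).cost = 1 := rfl
@[simp] theorem cost_var (x : ℕ) : (var x).cost = 2 := rfl
@[simp] theorem cost_add (e e' : Expr) : (e + e').cost = e.cost + e'.cost + 1 := rfl
@[simp] theorem cost_sub (e e' : Expr) : (e - e').cost = e.cost + e'.cost + 1 := rfl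
@[simp] theorem cost_mul (e e' : Expr) : (e * e').cost = e.cost + e'.cost + 1 := rfl
@[simp] theorem cost_div (e e' : Expr) : (e / e').cost = e.cost + e'.cost + 1 := rfl
@[simp] theorem cost_mod (e e' : Expr) : (e % e').cost = e.cost + e'.cost + 1 := rfl
@[simp] theorem cost_get (a : ℕ) (i : Expr) : (get a i).cost = i.cost + 6 := rfl
@[simp] theorem cost_inp (i : Expr) : (inp i).cost = i.cost + 1 := rfl
end

end Expr

/-- The machine state `σ` represents the view `s`, up to time and log. -/
structure Holds (V : Layout) (σ : State) (s : View) : Prop where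
  reg : ∀ x < 64, σ.reg x = s.v x
  arr : ∀ a < 16, ∀ i < V.size, σ.mem (V.base + 16 * i + a) = s.arr a i
  inp : ∀ i < V.base, σ.mem i = V.input i
  base : s.v 2 = V.base
  reg_le : ∀ x < 64, s.v x ≤ V.bound
  mem_le : ∀ i, σ.mem i ≤ V.bound

/-- The machine state `σ` represents the view `s`. -/
structure Rel (V : Layout) (σ : State) (s : View) : Prop extends Holds V σ s where
  time : σ.time = s.time
  buffer : σ.buffer = s.buffer
  log : σ.log = s.log

/-- The machine state `τ` differs from `σ` only in registers from `t` on and in the time, which is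
`c` steps later. -/
structure Scratch (t c : ℕ) (σ τ : State) : Prop where
  reg : ∀ x < t, τ.reg x = σ.reg x
  mem : τ.mem = σ.mem
  time : τ.time = σ.time + c
  buffer : τ.buffer = σ.buffer
  log : τ.log = σ.log

theorem Scratch.trans {t c t' c' : ℕ} {σ τ υ : State} (h : Scratch t c σ τ)
    (h' : Scratch t' c' τ υ) (ht : t ≤ t') : Scratch t (c + c') σ υ where
  reg x hx := (h'.reg x (by omega)).trans (h.reg x hx)
  mem := h'.mem.trans h.mem
  time := by rw [h'.time, h.time]; omega
  buffer := h'.buffer.trans h.buffer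
  log := h'.log.trans h.log

theorem Scratch.setReg (t : ℕ) (σ : State) (x : ℕ) : Scratch t 1 σ (σ.setReg t x) where
  reg y hy := by simp [State.setReg, Function.update_of_ne (show y ≠ t by omega)]
  mem := rfl
  time := rfl
  buffer := rfl
  log := rfl

theorem Scratch.weaken {t t' c : ℕ} {σ τ : State} (h : Scratch t' c σ τ) (ht : t ≤ t') :
    Scratch t c σ τ where
  reg x hx := h.reg x (by omega)
  mem := h.mem
  time := h.time
  buffer := h.buffer
  log := h.log

theorem Scratch.holds {V : Layout} {t c : ℕ} {σ τ : State} {s : View} (h : Scratch t c σ τ)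
    (ht : 64 ≤ t) (hσ : Holds V σ s) : Holds V τ s where
  reg x hx := (h.reg x (by omega)).trans (hσ.reg x hx)
  arr a ha i hi := by rw [h.mem]; exact hσ.arr a ha i hi
  inp i hi := by rw [h.mem]; exact hσ.inp i hi
  base := hσ.base
  reg_le := hσ.reg_le
  mem_le i := by rw [h.mem]; exact hσ.mem_le i

@[simp] theorem State.setReg_reg_self (σ : State) (r x : ℕ) : (σ.setReg r x).reg r = x := by
  simp [State.setReg]

theorem State.setReg_reg_of_ne (σ : State) {r r' : ℕ} (x : ℕ) (h : r' ≠ r) :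
    (σ.setReg r x).reg r' = σ.reg r' := by
  simp [State.setReg, h]

theorem exec_address {V : Layout} {s : View} {σ : State} {a t i : ℕ} (hσ : Holds V σ s)
    (ht : 64 ≤ t) (ha : a < 16) (hi : i < V.size) (hr : σ.reg t = i) :
    ∃ τ, Exec V.bound V.bound (Expr.address a t) σ τ ∧ τ.reg t = V.base + 16 * i + a ∧
      Scratch t 5 σ τ := by
  have hf := V.fits
  have hp := V.size_pos
  have h2 : σ.reg 2 = V.base := by rw [hσ.reg 2 (by omega), hσ.base]
  set σ₁ := σ.setReg (t + 1) 16 with e₁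
  have s₁ : Scratch (t + 1) 1 σ σ₁ := .setReg _ _ _
  set σ₂ := σ₁.setReg t (Op.eval .mul (σ₁.reg t) (σ₁.reg (t + 1))) with e₂
  have s₂ : Scratch t 1 σ₁ σ₂ := .setReg _ _ _
  set σ₃ := σ₂.setReg (t + 1) a with e₃
  have s₃ : Scratch (t + 1) 1 σ₂ σ₃ := .setReg _ _ _
  set σ₄ := σ₃.setReg t (Op.eval .add (σ₃.reg t) (σ₃.reg (t + 1))) with e₄
  have s₄ : Scratch t 1 σ₃ σ₄ := .setReg _ _ _
  set σ₅ := σ₄.setReg t (Op.eval .add (σ₄.reg t) (σ₄.reg 2)) with e₅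
  have s₅ : Scratch t 1 σ₄ σ₅ := .setReg _ _ _
  have v₁ : σ₁.reg t = i := by rw [s₁.reg t (by omega), hr]
  have v₁' : σ₁.reg (t + 1) = 16 := by simp [e₁]
  have v₂ : σ₂.reg t = 16 * i := by simp [e₂, v₁, v₁', Op.eval, mul_comm]
  have v₃ : σ₃.reg t = 16 * i := by rw [s₃.reg t (by omega), v₂]
  have v₃' : σ₃.reg (t + 1) = a := by simp [e₃]
  have v₄ : σ₄.reg t = 16 * i + a := by simp [e₄, v₃, v₃', Op.eval]
  have v₄' : σ₄.reg 2 = V.base := by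
    rw [s₄.reg 2 (by omega), s₃.reg 2 (by omega), s₂.reg 2 (by omega), s₁.reg 2 (by omega), h2]
  have v₅ : σ₅.reg t = V.base + 16 * i + a := by simp [e₅, v₄, v₄', Op.eval]; omega
  refine ⟨σ₅, .seq (.const (by omega)) <| .seq (.arith ?_) <| .seq (.const (by omega)) <|
    .seq (.arith ?_) (.arith ?_), v₅, ?_⟩
  · rw [v₁, v₁']; simp only [Op.eval]; omega
  · rw [v₃, v₃']; simp only [Op.eval]; omega
  · rw [v₄, v₄']; simp only [Op.eval]; omega
  · exact ((((s₁.weaken (by omega)).trans s₂ le_rfl).trans (s₃.weaken (t := t) (by omega))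
      le_rfl).trans s₄ le_rfl).trans s₅ le_rfl

/-- The compiled expression computes the value, which is at most the bound. -/
theorem exec_compile {V : Layout} {s : View} (e : Expr) : ∀ {σ : State} {t : ℕ}, Holds V σ s →
    64 ≤ t → e.Ok V s → e.eval V s ≤ V.bound ∧
    ∃ τ, Exec V.bound V.bound (e.compile t) σ τ ∧ τ.reg t = e.eval V s ∧
      Scratch t e.cost σ τ := by
  have hf := V.fits
  have hp := V.size_pos
  induction e with
  | lit k =>
    intro σ t hσ ht ok
    have hk : k ≤ V.bound := le_trans ok (by omega)
    exact ⟨hk, _, .const hk, State.setReg_reg_self _ _ _, .setReg _ _ _⟩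
  | var x =>
    intro σ t hσ ht ok
    have hx : x < 64 := ok
    have hv : Op.eval .add ((σ.setReg t 0).reg x) ((σ.setReg t 0).reg t) = s.v x := by
      rw [State.setReg_reg_of_ne _ _ (by omega)]; simp [Op.eval, hσ.reg x hx]
    refine ⟨hσ.reg_le x hx, _, .seq (.const (by omega)) (.arith ?_), ?_,
      (Scratch.setReg t σ 0).trans (.setReg _ _ _) le_rfl⟩
    · rw [hv]; exact hσ.reg_le x hx
    · simpa using hv
  | bin o e e' ih ih' =>
    intro σ t hσ ht ok
    have ok₁ : e.Ok V s := by cases o <;> exact ok.1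
    have ok₂ : e'.Ok V s := by cases o <;> first | exact ok.2.1 | exact ok.2
    obtain ⟨b₁, σ₁, x₁, r₁, s₁⟩ := ih hσ ht ok₁
    obtain ⟨b₂, σ₂, x₂, r₂, s₂⟩ := ih' (t := t + 1) (s₁.holds ht hσ) (by omega) ok₂
    have hr : σ₂.reg t = e.eval V s := by rw [s₂.reg t (by omega), r₁]
    have hb : o.eval (e.eval V s) (e'.eval V s) ≤ V.bound := by
      cases o
      · exact ok.2.2
      · exact le_trans (Nat.sub_le _ _) b₁
      · exact ok.2.2
      · exact le_trans (Nat.div_le_self _ _) b₁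
      · exact le_trans (Nat.mod_le _ _) b₁
    refine ⟨hb, _, .seq x₁ (.seq x₂ (.arith ?_)), ?_,
      (s₁.trans s₂ (by omega)).trans (.setReg _ _ _) le_rfl⟩
    · rw [hr, r₂]; exact hb
    · simp [hr, r₂, Expr.eval]
  | get a i ih =>
    intro σ t hσ ht ok
    obtain ⟨ha, ok₁, hi⟩ := ok
    obtain ⟨b₁, σ₁, x₁, r₁, s₁⟩ := ih hσ ht ok₁
    obtain ⟨σ₂, x₂, r₂, s₂⟩ := exec_address (s₁.holds ht hσ) ht ha hi r₁
    have h₂ := s₂.holds ht (s₁.holds ht hσ)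
    have hm := h₂.arr a ha _ hi
    refine ⟨?_, _, .seq x₁ (.seq x₂ (.load ?_ (h₂.mem_le _))), ?_,
      (s₁.trans s₂ le_rfl).trans (.setReg _ _ _) le_rfl⟩
    · simp only [Expr.eval]; rw [← hm]; exact h₂.mem_le _
    · rw [r₂]; omega
    · simp [r₂, hm, Expr.eval]
  | inp i ih =>
    intro σ t hσ ht ok
    obtain ⟨ok₁, hi⟩ := ok
    obtain ⟨b₁, σ₁, x₁, r₁, s₁⟩ := ih hσ ht ok₁
    have h₁ := s₁.holds ht hσ
    have hm := h₁.inp _ hi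
    refine ⟨?_, _, .seq x₁ (.load ?_ (h₁.mem_le _)), ?_, s₁.trans (.setReg _ _ _) le_rfl⟩
    · simp only [Expr.eval]; rw [← hm]; exact h₁.mem_le _
    · rw [r₁]; omega
    · simp [r₁, hm, Expr.eval]

/-! ### Structured programs and their total correctness -/

/-- `x := e` -/
def assign (x : ℕ) (e : Expr) : Prog :=
  .seq (e.compile 64) (.seq (.const 65 0) (.arith .add x 64 65))

/-- `a[i] := e` -/
def put (a : ℕ) (i e : Expr) : Prog :=
  .seq (i.compile 64) (.seq (Expr.address a 64) (.seq (e.compile 65) (.store 64 65)))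

/-- append `e` to the current record -/
def emit (e : Expr) : Prog := .seq (e.compile 64) (.write 64)

/-- if `e ≠ 0` then `c` else `d` -/
def branch (e : Expr) (c d : Prog) : Prog := .seq (e.compile 64) (.cond 64 c d)

/-- while `e ≠ 0` do `c` -/
def while_ (e : Expr) (c : Prog) : Prog :=
  .seq (e.compile 64) (.loop 64 (.seq c (e.compile 64)))

/-- for `x` from `0` to `y - 1` do `c` -/
def forUp (x y : ℕ) (c : Prog) : Prog :=
  .seq (assign x 0) (while_ (.var y - .var x) (.seq c (assign x (.var x + 1))))

namespace View

/-- `c` units of time pass. -/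
def tick (s : View) (c : ℕ) : View := { s with time := s.time + c }

/-- The value `w` is assigned to the variable `x`, in `c` units of time. -/
def setVar (s : View) (x w c : ℕ) : View :=
  { s with v := Function.update s.v x w, time := s.time + c }

/-- The value `w` is assigned to entry `i` of array `a`, in `c` units of time. -/
def setArr (s : View) (a i w c : ℕ) : View :=
  { s with arr := Function.update s.arr a (Function.update (s.arr a) i w), time := s.time + c }

/-- The value `w` is appended to the current record, in `c` units of time. -/
def push (s : View) (w c : ℕ) : View :=
  { s with buffer := s.buffer ++ [w], time := s.time + c }

/-- The current record is finished, in one unit of time. -/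
def close (s : View) (k : Kind) : View :=
  { s with buffer := [], time := s.time + 1, log := s.log ++ [⟨k, s.buffer, s.time + 1⟩] }

section
variable (s : View) (a i x w c : ℕ) (k : Kind)

@[simp] theorem tick_v : (s.tick c).v = s.v := rfl
@[simp] theorem tick_arr : (s.tick c).arr = s.arr := rfl
@[simp] theorem tick_time : (s.tick c).time = s.time + c := rfl
@[simp] theorem tick_buffer : (s.tick c).buffer = s.buffer := rfl
@[simp] theorem tick_log : (s.tick c).log = s.log := rfl
@[simp] theorem setVar_v : (s.setVar x w c).v = Function.update s.v x w := rfl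
@[simp] theorem setVar_arr : (s.setVar x w c).arr = s.arr := rfl
@[simp] theorem setVar_time : (s.setVar x w c).time = s.time + c := rfl
@[simp] theorem setVar_buffer : (s.setVar x w c).buffer = s.buffer := rfl
@[simp] theorem setVar_log : (s.setVar x w c).log = s.log := rfl
@[simp] theorem setArr_v : (s.setArr a i w c).v = s.v := rfl
@[simp] theorem setArr_arr : (s.setArr a i w c).arr =
    Function.update s.arr a (Function.update (s.arr a) i w) := rfl
@[simp] theorem setArr_time : (s.setArr a i w c).time = s.time + c := rfl
@[simp] theorem setArr_buffer : (s.setArr a i w c).buffer = s.buffer := rfl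
@[simp] theorem setArr_log : (s.setArr a i w c).log = s.log := rfl
@[simp] theorem push_v : (s.push w c).v = s.v := rfl
@[simp] theorem push_arr : (s.push w c).arr = s.arr := rfl
@[simp] theorem push_time : (s.push w c).time = s.time + c := rfl
@[simp] theorem push_buffer : (s.push w c).buffer = s.buffer ++ [w] := rfl
@[simp] theorem push_log : (s.push w c).log = s.log := rfl
@[simp] theorem close_v : (s.close k).v = s.v := rfl
@[simp] theorem close_arr : (s.close k).arr = s.arr := rfl
@[simp] theorem close_time : (s.close k).time = s.time + 1 := rfl
@[simp] theorem close_buffer : (s.close k).buffer = [] := rfl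
@[simp] theorem close_log :
    (s.close k).log = s.log ++ [⟨k, s.buffer, s.time + 1⟩] := rfl
end

end View

/-- Total correctness: started in a state with view `s`, the program `c` terminates in a state with
a view that satisfies `Q`. -/
def Wp (V : Layout) (c : Prog) (s : View) (Q : View → Prop) : Prop :=
  ∀ σ, Rel V σ s → ∃ σ' s', Exec V.bound V.bound c σ σ' ∧ Rel V σ' s' ∧ Q s'

variable {V : Layout} {s : View} {Q : View → Prop}

theorem Wp.mono {c : Prog} {Q' : View → Prop} (h : Wp V c s Q') (hQ : ∀ s', Q' s' → Q s') :
    Wp V c s Q := fun σ hσ =>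
  let ⟨σ', s', hx, hr, hq⟩ := h σ hσ
  ⟨σ', s', hx, hr, hQ _ hq⟩

theorem Wp.seq {c d : Prog} (h : Wp V c s fun s' => Wp V d s' Q) : Wp V (.seq c d) s Q :=
  fun σ hσ =>
  let ⟨_, _, hx, hr, hq⟩ := h σ hσ
  let ⟨σ'', s'', hx', hr', hq'⟩ := hq _ hr
  ⟨σ'', s'', .seq hx hx', hr', hq'⟩

theorem Scratch.rel {c : ℕ} {σ τ : State} (h : Scratch 64 c σ τ) (hσ : Rel V σ s) :
    Rel V τ (s.tick c) where
  toHolds := ⟨(h.holds le_rfl hσ.toHolds).reg, (h.holds le_rfl hσ.toHolds).arr,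
    (h.holds le_rfl hσ.toHolds).inp, hσ.base, hσ.reg_le, (h.holds le_rfl hσ.toHolds).mem_le⟩
  time := by rw [h.time, hσ.time]; rfl
  buffer := by rw [h.buffer, hσ.buffer]; rfl
  log := by rw [h.log, hσ.log]; rfl

theorem Rel.setReg {σ : State} (hσ : Rel V σ s) {x w : ℕ} (hx : x < 64) (h2 : x ≠ 2)
    (hw : w ≤ V.bound) : Rel V (σ.setReg x w) (s.setVar x w 1) where
  reg y hy := by
    by_cases h : y = x
    · subst h; simp
    · rw [State.setReg_reg_of_ne _ _ h]; simp [h, hσ.reg y hy]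
  arr := hσ.arr
  inp := hσ.inp
  base := by simp [Function.update_of_ne h2.symm, hσ.base]
  reg_le y hy := by
    by_cases h : y = x
    · subst h; simpa using hw
    · simpa [h] using hσ.reg_le y hy
  mem_le := hσ.mem_le
  time := congrArg (· + 1) hσ.time
  buffer := hσ.buffer
  log := hσ.log

theorem Wp.assign {x : ℕ} {e : Expr} (hx : x < 64) (h2 : x ≠ 2) (ok : e.Ok V s)
    (h : Q (s.setVar x (e.eval V s) (e.cost + 2))) : Wp V (assign x e) s Q := by
  intro σ hσ
  obtain ⟨hb, σ₁, x₁, r₁, s₁⟩ := exec_compile e hσ.toHolds le_rfl ok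
  have s₂ := s₁.trans ((Scratch.setReg 65 σ₁ 0).weaken (t := 64) (by omega)) le_rfl
  have hv : Op.eval .add ((σ₁.setReg 65 0).reg 64) ((σ₁.setReg 65 0).reg 65) = e.eval V s := by
    rw [State.setReg_reg_of_ne _ _ (by omega)]; simp [Op.eval, r₁]
  refine ⟨_, _, .seq x₁ (.seq (.const (by omega)) (.arith ?_)), ?_, h⟩
  · rw [hv]; exact hb
  · rw [hv]
    have := (s₂.rel hσ).setReg hx h2 hb
    simpa [View.setVar, View.tick, add_assoc] using this

theorem Rel.setMem {σ : State} (hσ : Rel V σ s) {a i w : ℕ} (ha : a < 16)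
    (hw : w ≤ V.bound) :
    Rel V (σ.setMem (V.base + 16 * i + a) w) (s.setArr a i w 1) where
  reg := hσ.reg
  arr b hb j hj := by
    have := hσ.arr b hb j hj
    simp only [State.setMem, View.setArr, Function.update_apply]
    by_cases hab : b = a
    · subst hab
      by_cases hij : j = i
      · subst hij; simp
      · rw [if_neg (by omega)]; simp [Function.update_of_ne hij, this]
    · rw [if_neg (by omega), if_neg hab, this]
  inp j hj := by
    simp only [State.setMem, Function.update_apply]
    rw [if_neg (by omega), hσ.inp j hj]
  base := hσ.base
  reg_le := hσ.reg_le
  mem_le j := by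
    simp only [State.setMem, Function.update_apply]
    split_ifs
    · exact hw
    · exact hσ.mem_le j
  time := congrArg (· + 1) hσ.time
  buffer := hσ.buffer
  log := hσ.log

theorem Wp.put {a : ℕ} {i e : Expr} (ha : a < 16) (oki : i.Ok V s) (hi : i.eval V s < V.size)
    (oke : e.Ok V s) (h : Q (s.setArr a (i.eval V s) (e.eval V s) (i.cost + e.cost + 6))) :
    Wp V (put a i e) s Q := by
  intro σ hσ
  have hf := V.fits
  obtain ⟨-, σ₁, x₁, r₁, s₁⟩ := exec_compile i hσ.toHolds le_rfl oki
  have h₁ := s₁.holds le_rfl hσ.toHolds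
  obtain ⟨σ₂, x₂, r₂, s₂⟩ := exec_address h₁ le_rfl ha hi r₁
  have h₂ := s₂.holds le_rfl h₁
  obtain ⟨hb, σ₃, x₃, r₃, s₃⟩ := exec_compile e (t := 65) h₂ (by omega) oke
  have r₄ : σ₃.reg 64 = V.base + 16 * i.eval V s + a := by rw [s₃.reg 64 (by omega), r₂]
  have sc := (s₁.trans s₂ le_rfl).trans (s₃.weaken (t := 64) (by omega)) le_rfl
  refine ⟨_, _, .seq x₁ (.seq x₂ (.seq x₃ (.store ?_ ?_))), ?_, h⟩
  · rw [r₄]; omega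
  · rw [r₃]; exact hb
  · rw [r₃, r₄]
    have := (sc.rel hσ).setMem (i := i.eval V s) ha hb
    convert this using 1
    simp only [View.setArr, View.tick, View.mk.injEq, true_and, and_true]
    omega

theorem Wp.emit {e : Expr} (ok : e.Ok V s) (h : Q (s.push (e.eval V s) (e.cost + 1))) :
    Wp V (emit e) s Q := by
  intro σ hσ
  obtain ⟨-, σ₁, x₁, r₁, s₁⟩ := exec_compile e hσ.toHolds le_rfl ok
  have h₁ := s₁.rel hσ
  refine ⟨_, _, .seq x₁ .write, ?_, h⟩
  rw [r₁]
  exact ⟨⟨h₁.reg, h₁.arr, h₁.inp, h₁.base, h₁.reg_le, h₁.mem_le⟩, congrArg (· + 1) h₁.time,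
    congrArg (· ++ _) h₁.buffer, h₁.log⟩

theorem Wp.finish {k : Kind} (h : Q (s.close k)) : Wp V (.finish k) s Q := by
  intro σ hσ
  refine ⟨_, _, .finish, ?_, h⟩
  refine ⟨⟨hσ.reg, hσ.arr, hσ.inp, hσ.base, hσ.reg_le, hσ.mem_le⟩, congrArg (· + 1) hσ.time,
    rfl, ?_⟩
  simp [State.close, View.close, hσ.time, hσ.buffer, hσ.log]

theorem Rel.tick {σ : State} (hσ : Rel V σ s) : Rel V σ.tick (s.tick 1) :=
  ⟨⟨hσ.reg, hσ.arr, hσ.inp, hσ.base, hσ.reg_le, hσ.mem_le⟩, congrArg (· + 1) hσ.time,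
    hσ.buffer, hσ.log⟩

theorem Wp.branch {e : Expr} {c d : Prog} (ok : e.Ok V s)
    (hc : e.eval V s ≠ 0 → Wp V c (s.tick (e.cost + 1)) Q)
    (hd : e.eval V s = 0 → Wp V d (s.tick (e.cost + 1)) Q) : Wp V (branch e c d) s Q := by
  intro σ hσ
  obtain ⟨-, σ₁, x₁, r₁, s₁⟩ := exec_compile e hσ.toHolds le_rfl ok
  have h₁ : Rel V σ₁.tick (s.tick (e.cost + 1)) := (s₁.rel hσ).tick
  by_cases h : e.eval V s = 0
  · obtain ⟨τ, s', hx, hr, hq⟩ := hd h _ h₁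
    exact ⟨τ, s', .seq x₁ (.condFalse (r₁.trans h) hx), hr, hq⟩
  · obtain ⟨τ, s', hx, hr, hq⟩ := hc h _ h₁
    exact ⟨τ, s', .seq x₁ (.condTrue (by rwa [r₁]) hx), hr, hq⟩

/-- The loop is unfolded once. -/
theorem Wp.while_ {e : Expr} {c : Prog} (ok : e.Ok V s)
    (hc : e.eval V s ≠ 0 → Wp V c (s.tick (e.cost + 1)) fun s' => Wp V (while_ e c) s' Q)
    (hd : e.eval V s = 0 → Q (s.tick (e.cost + 1))) : Wp V (while_ e c) s Q := by
  intro σ hσ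
  obtain ⟨-, σ₁, x₁, r₁, s₁⟩ := exec_compile e hσ.toHolds le_rfl ok
  have h₁ : Rel V σ₁.tick (s.tick (e.cost + 1)) := (s₁.rel hσ).tick
  by_cases h : e.eval V s = 0
  · exact ⟨_, _, .seq x₁ (.loopFalse (r₁.trans h)), h₁, hd h⟩
  · obtain ⟨τ, s', hx, hr, hq⟩ := hc h _ h₁
    obtain ⟨υ, s'', hx', hr', hq'⟩ := hq τ hr
    cases hx' with
    | seq y₁ y₂ => exact ⟨υ, s'', .seq x₁ (.loopTrue (by rwa [r₁]) (.seq hx y₁) y₂), hr', hq'⟩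

/-- The variables below `x` and the log are unchanged. -/
structure Frame (x : ℕ) (s s' : View) : Prop where
  v : ∀ y < x, s'.v y = s.v y
  log : s'.log = s.log

theorem Frame.trans {x : ℕ} {s s' s'' : View} (h : Frame x s s') (h' : Frame x s' s'') :
    Frame x s s'' := ⟨fun y hy => (h'.v y hy).trans (h.v y hy), h'.log.trans h.log⟩

/-- Rule for counting loops: an invariant `I k` on arrays and record buffer that the body carries
from `k` to `k + 1` in time `T`, while it changes only variables after the loop variable `x`. -/
theorem Wp.forUp {x y : ℕ} {c : Prog} (hy : y < x) (hx : x < 64) (h2 : x ≠ 2)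
    (I : ℕ → (ℕ → ℕ → ℕ) → List ℕ → Prop) (T : ℕ)
    (h0 : I 0 s.arr s.buffer)
    (hstep : ∀ k < s.v y, ∀ s₁, Frame x s s₁ → s₁.v x = k → I k s₁.arr s₁.buffer →
      Wp V c s₁ fun s₂ => Frame (x + 1) s₁ s₂ ∧ I (k + 1) s₂.arr s₂.buffer ∧
        s₂.time ≤ s₁.time + T)
    (hQ : ∀ s', Frame x s s' → I (s.v y) s'.arr s'.buffer →
      s'.time ≤ s.time + s.v y * (T + 20) + 20 → Q s') : Wp V (forUp x y c) s Q := by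
  have key : ∀ j k, k + j = s.v y → ∀ s₁, Frame x s s₁ → s₁.v x = k → I k s₁.arr s₁.buffer →
      s₁.time + 14 + j * (T + 20) ≤ s.time + s.v y * (T + 20) + 20 →
      Wp V (RAM.while_ (.var y - .var x) (.seq c (RAM.assign x (.var x + 1)))) s₁ Q := by
    intro j
    induction j with
    | zero =>
      intro k hk s₁ fr hv hI ht
      refine .while_ (by simp; omega) (fun h => ?_) (fun _ => ?_)
      · simp [hv, fr.v y hy] at h; omega
      · refine hQ _ ⟨fr.v, fr.log⟩ ?_ ?_
        · rw [← hk]; exact hI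
        · simp at ht ⊢; omega
    | succ j ih =>
      intro k hk s₁ fr hv hI ht
      rw [Nat.succ_mul] at ht
      refine .while_ (by simp; omega) (fun _ => ?_) (fun h => ?_)
      · refine .seq ((hstep k (by omega) (s₁.tick _) ⟨fr.v, fr.log⟩ hv hI).mono ?_)
        rintro s₂ ⟨fr₂, hI₂, ht₂⟩
        have hv₂ : s₂.v x = k := by rw [fr₂.v x (by omega)]; exact hv
        intro σ hσ
        have hyb := hσ.reg_le y (by omega)
        have hyv : s₂.v y = s.v y := (fr₂.v y (by omega)).trans (fr.v y hy)
        refine Wp.assign hx h2 (by simp; omega) ?_ σ hσ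
        refine ih (k + 1) (by omega) _ ⟨fun z hz => ?_, ?_⟩ (by simp [hv₂]) hI₂ ?_
        · simp [Function.update_of_ne (show z ≠ x by omega)]
          exact (fr₂.v z (by omega)).trans (fr.v z hz)
        · exact fr₂.log.trans fr.log
        · simp at ht₂ ⊢; omega
      · simp [hv, fr.v y hy] at h; omega
  refine .seq (.assign hx h2 (by simp) ?_)
  refine key (s.v y) 0 (by omega) _ ⟨fun z hz => ?_, rfl⟩ (by simp) h0 ?_
  · simp [Function.update_of_ne (show z ≠ x by omega)]
  · simp; omega

end RAM

namespace RAM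

/-- A program that leaves variables and arrays unchanged. -/
def skip : Prog := .const 64 0

theorem Wp.skip {V : Layout} {s : View} {Q : View → Prop} (h : Q (s.tick 1)) :
    Wp V skip s Q := fun σ hσ =>
  ⟨_, _, .const (Nat.zero_le _), (Scratch.setReg 64 σ 0).rel hσ, h⟩

end RAM

/-! ### Systems of obligations -/

open Classical in
/-- The indicator function of a finite set, with values `0` and `1`. -/
noncomputable def ind (Z : Finset ℕ) (a : ℕ) : ℕ := if a ∈ Z then 1 else 0

theorem ind_of_mem {Z : Finset ℕ} {a : ℕ} (h : a ∈ Z) : ind Z a = 1 := if_pos h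
theorem ind_of_notMem {Z : Finset ℕ} {a : ℕ} (h : a ∉ Z) : ind Z a = 0 := if_neg h
theorem ind_le_one (Z : Finset ℕ) (a : ℕ) : ind Z a ≤ 1 := by unfold ind; split_ifs <;> omega
theorem ind_eq_zero {Z : Finset ℕ} {a : ℕ} : ind Z a = 0 ↔ a ∉ Z := by simp [ind]

/-- The characteristic word of a set of numbers below `N`. -/
noncomputable def indWord (N : ℕ) (Z : Finset ℕ) : List ℕ := (List.range N).map (ind Z)

/-- A system of obligations on the numbers below `size`, the nodes: obligation `o < obls` belongs to
the node `node o`, and is met by a set of nodes that contains `key h` for some edge `h < edges` with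
`ob h = o`. Edges `h` for which `key h` is not a node play no role. -/
structure Obligations where
  size : ℕ
  obls : ℕ
  edges : ℕ
  node : ℕ → ℕ
  ob : ℕ → ℕ
  key : ℕ → ℕ
  node_lt : ∀ o < obls, node o < size
  ob_lt : ∀ h < edges, key h < size → ob h < obls

open Classical in
/-- The successor of the largest `h < c` with `p h`, or zero if there is none. -/
noncomputable def lastBelow (p : ℕ → Prop) : ℕ → ℕ
  | 0 => 0
  | c + 1 => if p c then c + 1 else lastBelow p c

namespace Obligations

variable (G : Obligations)

/-- Sets of nodes that meet all obligations of their elements. -/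
def Closed (Z : Finset ℕ) : Prop :=
  ∀ a ∈ Z, ∀ o < G.obls, G.node o = a → ∃ h < G.edges, G.ob h = o ∧ G.key h ∈ Z

open Classical in
/-- The number of ways in which the set `Z` meets the obligation `o`. -/
noncomputable def count (o : ℕ) (Z : Finset ℕ) : ℕ :=
  Nat.count (fun h => G.ob h = o ∧ G.key h ∈ Z) G.edges

open Classical in
/-- The number of edges below `c` that contribute to the obligation `o` through the node `x`. -/
noncomputable def countAt (o x c : ℕ) : ℕ := Nat.count (fun h => G.ob h = o ∧ G.key h = x) c

open Classical in
/-- The number of edges below `c` whose key is `x`. -/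
noncomputable def inDegree (x c : ℕ) : ℕ := Nat.count (fun h => G.key h = x) c

open Classical in
/-- The number of edges with keys in `Z`. -/
noncomputable def inEdges (Z : Finset ℕ) : ℕ := Nat.count (fun h => G.key h ∈ Z) G.edges

theorem inEdges_le (Z : Finset ℕ) : G.inEdges Z ≤ G.edges := Nat.count_le _

theorem count_erase {Z : Finset ℕ} {x : ℕ} (hx : x ∈ Z) (o : ℕ) :
    G.count o Z = G.count o (Z.erase x) + G.countAt o x G.edges := by
  classical
  unfold count countAt
  induction G.edges with
  | zero => simp
  | succ c ih =>
    simp only [Nat.count_succ, ih]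
    by_cases h1 : G.ob c = o <;> by_cases h2 : G.key c = x <;> by_cases h3 : G.key c ∈ Z <;>
      simp_all <;> omega

theorem inEdges_erase {Z : Finset ℕ} {x : ℕ} (hx : x ∈ Z) :
    G.inEdges Z = G.inEdges (Z.erase x) + G.inDegree x G.edges := by
  classical
  unfold inEdges inDegree
  induction G.edges with
  | zero => simp
  | succ c ih =>
    simp only [Nat.count_succ, ih]
    by_cases h2 : G.key c = x <;> by_cases h3 : G.key c ∈ Z <;>
      simp_all <;> omega

theorem count_eq_zero {o : ℕ} {Z : Finset ℕ} :
    G.count o Z = 0 ↔ ∀ h < G.edges, G.ob h = o → G.key h ∉ Z := by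
  classical
  unfold count
  induction G.edges with
  | zero => simp
  | succ c ih =>
    rw [Nat.count_succ]
    simp only [Nat.add_eq_zero_iff, ih]
    constructor
    · rintro ⟨h1, h2⟩ h hh ho
      rcases Nat.lt_succ_iff_lt_or_eq.1 hh with h' | rfl
      · exact h1 h h' ho
      · intro hk; simp [ho, hk] at h2
    · intro H
      refine ⟨fun h hh => H h (by omega), ?_⟩
      rw [if_neg]
      rintro ⟨h1, h2⟩
      exact H c (by omega) h1 h2

/-- The node `a` cannot be in a closed subset of `y` that is contained in `Z`. -/
def Bad (y : Finset ℕ) (cnt : ℕ → ℕ) (a : ℕ) : Prop :=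
  a ∉ y ∨ ∃ o < G.obls, G.node o = a ∧ cnt o = 0

theorem isGreatest_of_no_bad {y Z : Finset ℕ}
    (hmax : ∀ R, R ⊆ y → G.Closed R → R ⊆ Z)
    (hbad : ∀ a ∈ Z, ¬ G.Bad y (fun o => G.count o Z) a) :
    IsGreatest {R | R ⊆ y ∧ G.Closed R} Z := by
  refine ⟨⟨fun a ha => ?_, fun a ha o ho hn => ?_⟩, fun R hR => hmax R hR.1 hR.2⟩
  · by_contra h; exact hbad a ha (.inl h)
  · by_contra h
    push Not at h
    exact hbad a ha (.inr ⟨o, ho, hn, G.count_eq_zero.2 h⟩)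

theorem subset_erase_of_bad {y Z R : Finset ℕ} {x : ℕ}
    (hR : R ⊆ y) (hc : G.Closed R) (hRZ : R ⊆ Z) (hx : G.Bad y (fun o => G.count o Z) x) :
    R ⊆ Z.erase x := by
  intro a ha
  refine Finset.mem_erase.2 ⟨?_, hRZ ha⟩
  rintro rfl
  rcases hx with h | ⟨o, ho, hn, h0⟩
  · exact h (hR ha)
  · obtain ⟨h, hh, h1, h2⟩ := hc a ha o ho hn
    exact G.count_eq_zero.1 h0 h hh h1 (hRZ h2)

/-- The arrays that represent a system of obligations: the edges with a common key form a linked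
list, which starts at entry `key` of array 2 and continues through array 0 (pointers are shifted by
one); array 1 holds the obligations of the edges, array 4 the nodes of the obligations, and array 3
the number of ways in which the set of all nodes meets an obligation. -/
structure Stored (arr : ℕ → ℕ → ℕ) : Prop where
  next : ∀ h < G.edges, G.key h < G.size → arr 0 h = lastBelow (fun e => G.key e = G.key h) h
  ob : ∀ h < G.edges, G.key h < G.size → arr 1 h = G.ob h
  head : ∀ k < G.size, arr 2 k = lastBelow (fun e => G.key e = k) G.edges
  count : ∀ o < G.obls, arr 3 o = G.count o (Finset.range G.size)
  node : ∀ o < G.obls, arr 4 o = G.node o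

variable {G}

theorem Stored.congr {arr arr' : ℕ → ℕ → ℕ} (h : G.Stored arr) (e : ∀ a < 5, arr' a = arr a) :
    G.Stored arr' := by
  obtain ⟨h0, h1, h2, h3, h4⟩ := h
  constructor
  · rwa [e 0 (by omega)]
  · rwa [e 1 (by omega)]
  · rwa [e 2 (by omega)]
  · rwa [e 3 (by omega)]
  · rwa [e 4 (by omega)]

end Obligations

/-! ### Limit queries on the machine -/

namespace RAM

/-- Sequential composition. -/
local infixr:60 " ;; " => Prog.seq

/-- Only arrays 5, 6 and the part of array 7 from index `q` on may have changed. -/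
structure Outside (q : ℕ) (arr arr' : ℕ → ℕ → ℕ) : Prop where
  eq : ∀ a, a ≠ 5 → a ≠ 6 → a ≠ 7 → arr' a = arr a
  below : ∀ i < q, arr' 7 i = arr 7 i

theorem Outside.refl (q : ℕ) (arr : ℕ → ℕ → ℕ) : Outside q arr arr :=
  ⟨fun _ _ _ _ => rfl, fun _ _ => rfl⟩

theorem Outside.trans {q : ℕ} {arr arr' arr'' : ℕ → ℕ → ℕ} (h : Outside q arr arr')
    (h' : Outside q arr' arr'') : Outside q arr arr'' :=
  ⟨fun a h5 h6 h7 => (h'.eq a h5 h6 h7).trans (h.eq a h5 h6 h7),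
    fun i hi => (h'.below i hi).trans (h.below i hi)⟩

theorem Outside.update5 {q : ℕ} (arr : ℕ → ℕ → ℕ) (f : ℕ → ℕ) :
    Outside q arr (Function.update arr 5 f) :=
  ⟨fun a h5 _ _ => by simp [h5], fun i _ => by simp⟩

theorem Outside.update6 {q : ℕ} (arr : ℕ → ℕ → ℕ) (f : ℕ → ℕ) :
    Outside q arr (Function.update arr 6 f) :=
  ⟨fun a _ h6 _ => by simp [h6], fun i _ => by simp⟩

theorem Outside.update7 {q i : ℕ} (arr : ℕ → ℕ → ℕ) (w : ℕ) (hi : q ≤ i) :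
    Outside q arr (Function.update arr 7 (Function.update (arr 7) i w)) :=
  ⟨fun a _ _ h7 => by simp [h7], fun j hj => by
    simp [Function.update_of_ne (show j ≠ i by omega)]⟩

theorem Outside.stored {q : ℕ} {arr arr' : ℕ → ℕ → ℕ} {G : Obligations} (h : Outside q arr arr')
    (hG : G.Stored arr) : G.Stored arr' :=
  hG.congr fun a ha => h.eq a (by omega) (by omega) (by omega)

/-- The body of the loop over the edges into a removed node: edge number `v 11 - 1` is discounted
from its obligation, and if nothing is left of it, then its node is marked as bad. -/
def discount : Prog :=
  assign 12 (.get 1 (.var 11 - 1)) ;;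
  put 5 (.var 12) (.get 5 (.var 12) - 1) ;;
  branch (.get 5 (.var 12)) skip (put 6 (.get 4 (.var 12)) 1) ;;
  assign 11 (.get 0 (.var 11 - 1))

/-- Removal of the node `v 10` from the set stored from index `v 8` on in array 7. -/
def remove : Prog :=
  put 7 (.var 8 + .var 10) 0 ;;
  assign 11 (.get 2 (.var 10)) ;;
  while_ (.var 11) discount ;;
  assign 10 0

/-- Nodes that are marked as bad are removed; after each removal the search for such nodes starts
anew. -/
def scan : Prog :=
  while_ (.var 3 - .var 10)
    (branch (.get 7 (.var 8 + .var 10) * .get 6 (.var 10)) remove (assign 10 (.var 10 + 1)))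

/-- The set in array 9 is written to the record, the set in array 7 is initialized by the set of all
nodes, and the nodes outside of the set in array 9 are marked as bad. -/
def prepareNodes : Prog :=
  forUp 10 3 (put 7 (.var 8 + .var 10) 1 ;; put 6 (.var 10) (1 - .get 9 (.var 10)) ;;
    emit (.get 9 (.var 10)))

/-- The counters of the obligations are initialized, and the nodes with obligations that cannot be
met at all are marked as bad. -/
def prepareCounters : Prog :=
  forUp 10 4 (put 5 (.var 10) (.get 3 (.var 10)) ;;
    branch (.get 3 (.var 10)) skip (put 6 (.get 4 (.var 10)) 1))

/-- The set that is stored from index `v 8` on in array 7 is written to the record. -/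
def emitSet : Prog := forUp 10 3 (emit (.get 7 (.var 8 + .var 10)))

/-- The largest closed subset of the set in array 9 is computed and stored from index `v 8` on in
array 7, and this limit query is reported. -/
def limitQuery : Prog :=
  prepareNodes ;; prepareCounters ;; assign 10 0 ;; scan ;; emitSet ;; .finish .query

variable {V : Layout} {G : Obligations} {Q : View → Prop}

/-- The memory provides for the arrays of a system of obligations, and for a set stored from index
`q` on in array 7. -/
structure Room (V : Layout) (G : Obligations) (q : ℕ) : Prop where
  set : q + G.size ≤ V.size
  obls : G.obls ≤ V.size
  edges : G.edges ≤ V.size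

open Classical in
/-- The state of the computation of the largest closed subset of `y`, where `Z` is the set of the
nodes that are left, and `cnt` gives the values of the counters. -/
structure Pruning (G : Obligations) (q : ℕ) (y Z : Finset ℕ) (cnt : ℕ → ℕ)
    (arr : ℕ → ℕ → ℕ) : Prop where
  stored : G.Stored arr
  set : ∀ a < G.size, arr 7 (q + a) = ind Z a
  counter : ∀ o < G.obls, arr 5 o = cnt o
  bad : ∀ a < G.size, arr 6 a = if G.Bad y cnt a then 1 else 0

theorem Pruning.congr {q : ℕ} {y Z : Finset ℕ} {cnt cnt' : ℕ → ℕ} {arr : ℕ → ℕ → ℕ}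
    (h : Pruning G q y Z cnt arr) (e : ∀ o, cnt' o = cnt o) : Pruning G q y Z cnt' arr := by
  obtain rfl : cnt' = cnt := funext e
  exact h

/-- The removed node is `x`. Before the step the counters still include the edges into `x` below
`c + 1`, after it those below `c`. -/
theorem wp_discount {s : View} {q x c : ℕ} {y Z : Finset ℕ} {cnt : ℕ → ℕ} (hV : Room V G q)
    (hc : c < G.edges) (hk : G.key c = x) (hx : x < G.size)
    (h11 : s.v 11 = c + 1)
    (hp : Pruning G q y Z (fun o => cnt o + G.countAt o x (c + 1)) s.arr)
    (hQ : ∀ s', Frame 11 s s' → s'.v 11 = lastBelow (fun e => G.key e = x) c →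
      Outside q s.arr s'.arr → s'.buffer = s.buffer →
      Pruning G q y Z (fun o => cnt o + G.countAt o x c) s'.arr → s'.time ≤ s.time + 100 → Q s') :
    Wp V discount s Q := by
  classical
  obtain ⟨hV1, hV2, hV3⟩ := hV
  have hob : s.arr 1 c = G.ob c := hp.stored.ob c hc (by omega)
  have hnx : s.arr 0 c = lastBelow (fun e => G.key e = x) c := by
    rw [hp.stored.next c hc (by omega), hk]
  have holt := G.ob_lt c hc (by omega)
  have hnode := hp.stored.node _ holt
  have hnlt := G.node_lt _ holt
  have hcnt := hp.counter _ holt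
  have hcount : ∀ o, G.countAt o x (c + 1) = G.countAt o x c + if G.ob c = o then 1 else 0 := by
    intro o; simp [Obligations.countAt, Nat.count_succ, hk]
  simp only [hcount, if_true] at hcnt
  refine .seq (.assign (by norm_num) (by norm_num) (by simp [h11]; omega) ?_)
  refine .seq (.put (by norm_num) (by simp) (by simp [h11, hob]; omega)
    (by simp [h11, hob]; omega) ?_)
  refine .seq (.branch (by simp [h11, hob]; omega) (fun h0 => .skip ?_)
    (fun h0 => .put (by norm_num) (by simp [h11, hob]; omega)
      (by simp [h11, hob, hnode]; omega) (by simp) ?_))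
  · simp [h11, hob] at h0
    refine .assign (by norm_num) (by norm_num) (by simp [h11]; omega)
      (hQ _ ⟨?_, rfl⟩ ?_ ?_ rfl ?_ ?_)
    · intro z hz
      simp [Function.update_of_ne (show z ≠ 11 by omega),
        Function.update_of_ne (show z ≠ 12 by omega)]
    · simp [h11, hnx]
    · exact .update5 _ _
    · refine ⟨(Outside.update5 (q := 0) _ _).stored hp.stored, ?_, ?_, ?_⟩
      · simpa using hp.set
      · intro o ho
        by_cases e : o = G.ob c
        · subst e; simp [h11, hob, hcnt]
        · have := hp.counter o ho
          rw [hcount, if_neg (Ne.symm e)] at this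
          simp [h11, hob, e, this]
      · intro a ha
        simp only [View.setVar_arr, View.tick_arr, View.setArr_arr]
        rw [Function.update_of_ne (by norm_num), hp.bad a ha]
        congr 1
        apply propext
        refine or_congr Iff.rfl ⟨?_, ?_⟩
        · rintro ⟨o, ho, hn, h⟩
          refine ⟨o, ho, hn, ?_⟩
          simp only [hcount] at h ⊢; omega
        · rintro ⟨o, ho, hn, h⟩
          refine ⟨o, ho, hn, ?_⟩
          simp only [hcount]
          by_cases e : G.ob c = o
          · subst e; simp only at h; omega
          · rw [if_neg e]; exact h
    · simp
  · simp [h11, hob] at h0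
    refine .assign (by norm_num) (by norm_num) (by simp [h11]; omega)
      (hQ _ ⟨?_, rfl⟩ ?_ ?_ rfl ?_ ?_)
    · intro z hz
      simp [Function.update_of_ne (show z ≠ 11 by omega),
        Function.update_of_ne (show z ≠ 12 by omega)]
    · simp [h11, hnx]
    · exact (Outside.update5 _ _).trans (.update6 _ _)
    · refine ⟨((Outside.update5 (q := 0) _ _).trans (.update6 _ _)).stored hp.stored, ?_, ?_, ?_⟩
      · simpa using hp.set
      · intro o ho
        by_cases e : o = G.ob c
        · subst e; simp [h11, hob, hcnt]
        · have := hp.counter o ho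
          rw [hcount, if_neg (Ne.symm e)] at this
          simp [h11, hob, e, this]
      · intro a ha
        by_cases e : a = G.node (G.ob c)
        · subst e
          have hb : G.Bad y (fun o => cnt o + G.countAt o x c) (G.node (G.ob c)) :=
            .inr ⟨_, holt, rfl, by simp only; omega⟩
          rw [if_pos hb]
          simp [h11, hob, hnode]
        · simp [h11, hob, hnode, e]
          rw [hp.bad a ha]
          congr 1
          apply propext
          refine or_congr Iff.rfl ⟨?_, ?_⟩
          · rintro ⟨o, ho, hn, h⟩
            refine ⟨o, ho, hn, ?_⟩
            simp only [hcount] at h ⊢; omega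
          · rintro ⟨o, ho, hn, h⟩
            refine ⟨o, ho, hn, ?_⟩
            simp only
            rw [hcount, if_neg (by rintro rfl; exact e hn.symm)]
            exact h
    · simp

/-- By induction on `c`: an edge `c` into `x` is the next one in the linked list, and other edges
change neither the pointer into the list nor the counters. -/
theorem wp_discount_loop {q x : ℕ} {y Z : Finset ℕ} {cnt : ℕ → ℕ} (hV : Room V G q)
    (hx : x < G.size) : ∀ c ≤ G.edges, ∀ s : View,
    s.v 11 = lastBelow (fun e => G.key e = x) c →
    Pruning G q y Z (fun o => cnt o + G.countAt o x c) s.arr →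
    (∀ s', Frame 11 s s' → Outside q s.arr s'.arr → s'.buffer = s.buffer →
      Pruning G q y Z cnt s'.arr → s'.time ≤ s.time + 103 * G.inDegree x c + 3 → Q s') →
    Wp V (while_ (.var 11) discount) s Q := by
  classical
  intro c
  induction c with
  | zero =>
    intro _ s h11 hp hQ
    have h11 : s.v 11 = 0 := h11
    refine .while_ (by simp) (fun h => absurd h11 h) (fun _ => hQ _ ?_ ?_ rfl ?_ ?_)
    · exact ⟨fun _ _ => rfl, rfl⟩
    · exact .refl _ _
    · exact hp.congr fun o => by simp [Obligations.countAt]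
    · simp [Obligations.inDegree]
  | succ c ih =>
    intro hc s h11 hp hQ
    have hdeg : G.inDegree x (c + 1) = G.inDegree x c + if G.key c = x then 1 else 0 := by
      simp [Obligations.inDegree, Nat.count_succ]
    by_cases hk : G.key c = x
    · rw [lastBelow, if_pos hk] at h11
      rw [if_pos hk] at hdeg
      refine .while_ (by simp) (fun _ => ?_) (fun h => by simp [h11] at h)
      refine wp_discount hV hc hk hx h11 hp fun s' fr hl ho hb hp' ht => ?_
      refine ih (by omega) s' hl hp' fun s'' fr' ho' hb' hp'' ht' => ?_
      refine hQ s'' (Frame.trans ⟨fr.v, fr.log⟩ fr') (ho.trans ho') (hb'.trans hb) hp'' ?_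
      simp at ht; omega
    · rw [lastBelow, if_neg hk] at h11
      rw [if_neg hk] at hdeg
      refine ih (by omega) s h11 (hp.congr fun o => ?_) fun s' fr ho hb hp' ht => ?_
      · simp [Obligations.countAt, Nat.count_succ, hk]
      · exact hQ s' fr ho hb hp' (by omega)

theorem wp_remove {s : View} {q x : ℕ} {y Z : Finset ℕ} (hV : Room V G q)
    (hx : x ∈ Z) (hxs : x < G.size) (h8 : s.v 8 = q) (h10 : s.v 10 = x)
    (hp : Pruning G q y Z (fun o => G.count o Z) s.arr)
    (hQ : ∀ s', Frame 10 s s' → s'.v 10 = 0 → Outside q s.arr s'.arr → s'.buffer = s.buffer →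
      Pruning G q y (Z.erase x) (fun o => G.count o (Z.erase x)) s'.arr →
      s'.time ≤ s.time + 103 * G.inDegree x G.edges + 40 → Q s') : Wp V remove s Q := by
  have hf := V.fits
  obtain ⟨hV1, hV2, hV3⟩ := id hV
  refine .seq (.put (by norm_num) (by simp [h8, h10]; omega) (by simp [h8, h10]; omega)
    (by simp) ?_)
  refine .seq (.assign (by norm_num) (by norm_num) (by simp [h10]; omega) ?_)
  refine .seq (wp_discount_loop (q := q) (y := y) (Z := Z.erase x)
    (cnt := fun o => G.count o (Z.erase x)) hV hxs G.edges le_rfl _ ?_ ?_ ?_)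
  · simp [h10, hp.stored.head x hxs]
  · have ho : Outside q s.arr ((s.setArr 7 (q + x) 0 0).arr) := .update7 _ _ (by omega)
    refine ⟨?_, ?_, ?_, ?_⟩
    · simpa [h8, h10] using ho.stored hp.stored
    · intro a ha
      by_cases e : a = x
      · subst e; simp [h8, h10, ind]
      · simp [h8, h10, e, hp.set a ha, ind]
    · intro o ho
      simp [hp.counter o ho, G.count_erase hx o]
    · intro a ha
      have : (fun o => G.count o Z) = fun o => G.count o (Z.erase x) + G.countAt o x G.edges :=
        funext fun o => G.count_erase hx o
      simp only [View.setVar_arr, View.setArr_arr]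
      rw [Function.update_of_ne (by norm_num), hp.bad a ha, this]
  · intro s' fr ho hb hp' ht
    refine .assign (by norm_num) (by norm_num) (by simp) (hQ _ ⟨?_, ?_⟩ ?_ ?_ ?_ ?_ ?_)
    · intro z hz
      rw [View.setVar_v, Function.update_of_ne (by omega), fr.v z (by omega)]
      simp [Function.update_of_ne (show z ≠ 11 by omega)]
    · exact fr.log
    · simp
    · refine Outside.trans ?_ ho
      simpa [h8, h10] using Outside.update7 s.arr 0 (show q ≤ q + x by omega)
    · exact hb
    · exact hp'
    · simp at ht ⊢; omega

/-- The time for scanning is bounded with the potential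
`60 * (|Z| * (N + 1) + (N - x)) + 103 * e`, where `e` edges have keys in the set `Z` of the
remaining nodes. -/
theorem wp_scan {q : ℕ} {y : Finset ℕ} (hV : Room V G q) :
    ∀ (μ : ℕ) (Z : Finset ℕ) (x : ℕ) (s : View), Z.card * (G.size + 1) + (G.size - x) = μ →
    x ≤ G.size → Z ⊆ Finset.range G.size → s.v 3 = G.size → s.v 8 = q → s.v 10 = x →
    Pruning G q y Z (fun o => G.count o Z) s.arr →
    (∀ R, R ⊆ y → G.Closed R → R ⊆ Z) →
    (∀ a < x, a ∈ Z → ¬ G.Bad y (fun o => G.count o Z) a) →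
    (∀ s' Z', Frame 10 s s' → Outside q s.arr s'.arr → s'.buffer = s.buffer →
      G.Stored s'.arr → (∀ a < G.size, s'.arr 7 (q + a) = ind Z' a) →
      Z' ⊆ Finset.range G.size → IsGreatest {R | R ⊆ y ∧ G.Closed R} Z' →
      s'.time ≤ s.time + 103 * G.inEdges Z + 70 * μ + 6 → Q s') →
    Wp V scan s Q := by
  classical
  have hf := V.fits
  intro μ
  induction μ using Nat.strong_induction_on with
  | _ μ ih =>
    intro Z x s hμ hxs hZ h3 h8 h10 hp hmax hlt hQ
    obtain ⟨hV1, hV2, hV3⟩ := id hV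
    refine .while_ (by simp) (fun h => ?_) (fun h => ?_)
    · simp [h3, h10] at h
      have hset := hp.set x (by omega)
      have hbad := hp.bad x (by omega)
      have hle := ind_le_one Z x
      refine .branch ?_ (fun h' => ?_) (fun h' => ?_)
      · simp [h8, h10, hset, hbad]
        refine ⟨⟨by omega, by omega⟩, by omega, ?_⟩
        split_ifs <;> omega
      · simp [h8, h10, hset, hbad, ind_eq_zero] at h'
        obtain ⟨hxB, hxZ⟩ := h'
        have hcard : (Z.erase x).card + 1 = Z.card := Finset.card_erase_add_one hxZ
        have hμ' : ((Z.erase x).card * (G.size + 1) + (G.size - 0)) + 1 ≤ μ := by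
          rw [← hμ, ← hcard, Nat.succ_mul]; omega
        refine wp_remove hV hxZ (by omega) h8 h10 hp fun s' fr h10' ho hb hp' ht => ?_
        refine ih _ (by omega) (Z.erase x) 0 s' rfl (by omega)
          ((Finset.erase_subset _ _).trans hZ)
          ((fr.v 3 (by norm_num)).trans h3) ((fr.v 8 (by norm_num)).trans h8) h10' hp'
          (fun R hR hc => G.subset_erase_of_bad hR hc (hmax R hR hc) hxB)
          (fun a ha => by omega) fun s'' Z' fr' ho' hb' hs hset' hZ' hg ht' => ?_
        refine hQ s'' Z' (Frame.trans ⟨fr.v, fr.log⟩ fr') (ho.trans ho') (hb'.trans hb) hs hset'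
          hZ' hg ?_
        have := G.inEdges_erase hxZ
        simp at ht; omega
      · simp [h8, h10, hset, hbad, ind_eq_zero] at h'
        refine .assign (by norm_num) (by norm_num) (by simp [h10]; omega) ?_
        refine ih (μ - 1) (by omega) Z (x + 1) _ (by omega) (by omega) hZ
          (by simp [h3]) (by simp [h8]) (by simp [h10]) hp hmax ?_ ?_
        · intro a ha haZ
          rcases Nat.lt_succ_iff_lt_or_eq.1 ha with h'' | rfl
          · exact hlt a h'' haZ
          · exact fun hB => h' hB haZ
        · intro s' Z' fr ho hb hs hset' hZ' hg ht
          refine hQ s' Z' ⟨fun z hz => ?_, fr.log⟩ ho hb hs hset' hZ' hg ?_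
          · rw [fr.v z hz, View.setVar_v, Function.update_of_ne (by omega)]; rfl
          · simp at ht; omega
    · simp [h3, h10] at h
      obtain rfl : x = G.size := by omega
      refine hQ _ Z ⟨fun _ _ => rfl, rfl⟩ (.refl _ _) rfl hp.stored hp.set hZ ?_ ?_
      · exact G.isGreatest_of_no_bad hmax fun a ha => hlt a (Finset.mem_range.1 (hZ ha)) ha
      · simp; omega

theorem wp_emitSet {s : View} {q N : ℕ} {Z : Finset ℕ} (hV : q + N ≤ V.size) (h3 : s.v 3 = N)
    (h8 : s.v 8 = q) (hset : ∀ a < N, s.arr 7 (q + a) = ind Z a)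
    (hQ : ∀ s', Frame 10 s s' → s'.arr = s.arr → s'.buffer = s.buffer ++ indWord N Z →
      s'.time ≤ s.time + 40 * N + 20 → Q s') : Wp V emitSet s Q := by
  have hf := V.fits
  refine .forUp (by norm_num) (by norm_num) (by norm_num)
    (fun k arr buf => arr = s.arr ∧ buf = s.buffer ++ (List.range k).map (ind Z)) 20
    (by simp) ?_ ?_
  · intro k hk s₁ fr h10 ⟨ha, hb⟩
    have h8' : s₁.v 8 = q := (fr.v 8 (by norm_num)).trans h8
    refine .emit (by simp [h8', h10]; omega) ⟨⟨fun _ _ => rfl, rfl⟩, ⟨ha, ?_⟩, by simp⟩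
    simp [h8', h10, ha, hset k (by omega), hb, List.range_succ]
  · rintro s' fr ⟨ha, hb⟩ ht
    refine hQ s' fr ha (by rw [hb, h3]; rfl) ?_
    rw [h3] at ht; omega

theorem wp_prepareNodes {s : View} {q N : ℕ} {y : Finset ℕ} (hV : q + N ≤ V.size)
    (h3 : s.v 3 = N) (h8 : s.v 8 = q) (hy : ∀ a < N, s.arr 9 a = ind y a)
    (hQ : ∀ s', Frame 10 s s' → Outside q s.arr s'.arr → s'.buffer = s.buffer ++ indWord N y →
      (∀ a < N, s'.arr 7 (q + a) = 1) → (∀ a < N, s'.arr 6 a = 1 - ind y a) →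
      s'.time ≤ s.time + 80 * N + 20 → Q s') : Wp V prepareNodes s Q := by
  have hf := V.fits
  refine .forUp (by norm_num) (by norm_num) (by norm_num)
    (fun k arr buf => Outside q s.arr arr ∧ buf = s.buffer ++ (List.range k).map (ind y) ∧
      (∀ a < k, arr 7 (q + a) = 1) ∧ (∀ a < k, arr 6 a = 1 - ind y a)) 60
    ⟨.refl _ _, by simp⟩ ?_ ?_
  · rintro k hk s₁ fr h10 ⟨ho, hb, h7, h6⟩
    have h8' : s₁.v 8 = q := (fr.v 8 (by norm_num)).trans h8
    have hyk : s₁.arr 9 k = ind y k := by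
      rw [ho.eq 9 (by norm_num) (by norm_num) (by norm_num), hy k (by omega)]
    refine .seq (.put (by norm_num) (by simp [h8', h10]; omega) (by simp [h8', h10]; omega)
      (by simp) ?_)
    refine .seq (.put (by norm_num) (by simp) (by simp [h10]; omega) (by simp [h10]; omega) ?_)
    refine .emit (by simp [h10]; omega) ⟨⟨fun _ _ => rfl, rfl⟩, ⟨?_, ?_, ?_, ?_⟩, ?_⟩
    · exact ho.trans ((Outside.update7 _ _ (by simp [h8'])).trans (.update6 _ _))
    · simp [h10, hyk, hb, List.range_succ]
    · intro a ha
      rcases Nat.lt_succ_iff_lt_or_eq.1 ha with h | rfl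
      · simp [h8', h10, h.ne, h7 a h]
      · simp [h8', h10]
    · intro a ha
      rcases Nat.lt_succ_iff_lt_or_eq.1 ha with h | rfl
      · simp [h10, h.ne, h6 a h]
      · simp [h10, hyk]
    · simp
  · rintro s' fr ⟨ho, hb, h7, h6⟩ ht
    rw [h3] at ht hb h7 h6
    exact hQ s' fr ho hb h7 h6 (by omega)

theorem wp_prepareCounters {s : View} {q : ℕ} {y : Finset ℕ} (hV : Room V G q)
    (h4 : s.v 4 = G.obls) (hs : G.Stored s.arr)
    (h7 : ∀ a < G.size, s.arr 7 (q + a) = 1) (h6 : ∀ a < G.size, s.arr 6 a = 1 - ind y a)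
    (hQ : ∀ s', Frame 10 s s' → Outside q s.arr s'.arr → s'.buffer = s.buffer →
      Pruning G q y (Finset.range G.size) (fun o => G.count o (Finset.range G.size)) s'.arr →
      s'.time ≤ s.time + 80 * G.obls + 20 → Q s') : Wp V prepareCounters s Q := by
  classical
  have hf := V.fits
  obtain ⟨hV1, hV2, hV3⟩ := hV
  set N := Finset.range G.size
  refine .forUp (by norm_num) (by norm_num) (by norm_num)
    (fun k arr buf => Outside q s.arr arr ∧ buf = s.buffer ∧ arr 7 = s.arr 7 ∧
      (∀ o < k, arr 5 o = G.count o N) ∧ (∀ a < G.size, arr 6 a =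
        if a ∉ y ∨ ∃ o < k, G.node o = a ∧ G.count o N = 0 then 1 else 0)) 60
    ⟨.refl _ _, rfl, rfl, by simp, fun a ha => ?_⟩ ?_ ?_
  · rw [h6 a ha]
    by_cases h : a ∈ y <;> simp [ind, h]
  · rintro k hk s₁ fr h10 ⟨ho, hb, h7', h5, h6'⟩
    have hst := ho.stored hs
    have hc := hst.count k (by omega)
    have hn := hst.node k (by omega)
    have hnl := G.node_lt k (by omega)
    refine .seq (.put (by norm_num) (by simp) (by simp [h10]; omega) (by simp [h10]; omega) ?_)
    refine .branch (by simp [h10]; omega) (fun h => .skip ?_)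
      (fun h => .put (by norm_num) (by simp [h10]; omega) (by simp [h10, hn]; omega) (by simp) ?_)
    · simp [h10, hc] at h
      refine ⟨⟨fun _ _ => rfl, rfl⟩, ⟨ho.trans (.update5 _ _), hb, ?_, ?_, ?_⟩, by simp⟩
      · simp [h7']
      · intro o ho
        rcases Nat.lt_succ_iff_lt_or_eq.1 ho with h' | rfl
        · simp [h10, h'.ne, h5 o h']
        · simp [h10, hc]; rfl
      · intro a ha
        simp [h6' a ha]
        congr 1
        apply propext
        refine or_congr Iff.rfl ⟨?_, ?_⟩
        · rintro ⟨o, ho, h'⟩; exact ⟨o, by omega, h'⟩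
        · rintro ⟨o, ho, h'⟩
          rcases Nat.lt_succ_iff_lt_or_eq.1 (Nat.lt_succ_of_le ho) with h'' | rfl
          · exact ⟨o, h'', h'⟩
          · exact absurd h'.2 h
    · simp [h10, hc] at h
      refine ⟨⟨fun _ _ => rfl, rfl⟩,
        ⟨ho.trans ((Outside.update5 _ _).trans (.update6 _ _)), hb, ?_, ?_, ?_⟩, by simp⟩
      · simp [h7']
      · intro o ho
        rcases Nat.lt_succ_iff_lt_or_eq.1 ho with h' | rfl
        · simp [h10, h'.ne, h5 o h']
        · simp [h10, hc]; rfl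
      · intro a ha
        by_cases e : a = G.node k
        · subst e
          rw [if_pos (.inr ⟨k, by omega, rfl, h⟩)]
          simp [h10, hn]
        · simp [h10, hn, e, h6' a ha]
          congr 1
          apply propext
          refine or_congr Iff.rfl ⟨?_, ?_⟩
          · rintro ⟨o, ho, h'⟩; exact ⟨o, by omega, h'⟩
          · rintro ⟨o, ho, h'⟩
            rcases Nat.lt_succ_iff_lt_or_eq.1 (Nat.lt_succ_of_le ho) with h'' | rfl
            · exact ⟨o, h'', h'⟩
            · exact absurd h'.1.symm e
  · rintro s' fr ⟨ho, hb, h7', h5, h6'⟩ ht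
    rw [h4] at h5 h6' ht
    refine hQ s' fr ho hb ⟨ho.stored hs, ?_, h5, ?_⟩ (by omega)
    · intro a ha
      rw [h7', h7 a ha, ind_of_mem (by simpa [N] using ha)]
    · intro a ha
      rw [h6' a ha]
      congr 1

/-- A limit query takes time linear in the size of the memory. -/
theorem wp_limitQuery {s : View} {q : ℕ} {y : Finset ℕ} (hV : Room V G q)
    (hsq : (G.size + 1) * (G.size + 1) ≤ V.size)
    (h3 : s.v 3 = G.size) (h4 : s.v 4 = G.obls) (h8 : s.v 8 = q) (hs : G.Stored s.arr)
    (hy : ∀ a < G.size, s.arr 9 a = ind y a) (hys : y ⊆ Finset.range G.size)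
    (hbuf : s.buffer = [])
    (hQ : ∀ s' Z, (∀ r < 10, s'.v r = s.v r) → Outside q s.arr s'.arr → s'.buffer = [] →
      (∀ a < G.size, s'.arr 7 (q + a) = ind Z a) →
      IsGreatest {R | R ⊆ y ∧ G.Closed R} Z →
      s'.log = s.log ++ [⟨.query, indWord G.size y ++ indWord G.size Z, s'.time⟩] →
      s'.time ≤ s.time + 1000 * V.size → Q s') : Wp V limitQuery s Q := by
  have hp := V.size_pos
  have hVs := hV.set
  refine .seq (wp_prepareNodes hVs h3 h8 hy fun s₁ f₁ o₁ b₁ h7 h6 t₁ => ?_)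
  refine .seq (wp_prepareCounters hV ((f₁.v 4 (by norm_num)).trans h4) (o₁.stored hs) h7 h6
    fun s₂ f₂ o₂ b₂ p₂ t₂ => ?_)
  refine .seq (.assign (by norm_num) (by norm_num) (by simp) ?_)
  have f := f₁.trans f₂
  refine .seq (wp_scan hV _ (Finset.range G.size) 0 _ rfl (by omega) subset_rfl
    (by simp [f.v 3, h3]) (by simp [f.v 8, h8]) (by simp) p₂
    (fun R hR _ => hR.trans hys) (by simp) fun s₃ Z f₃ o₃ b₃ _ h7₃ _ hg t₃ => ?_)
  have f₃' : ∀ z < 10, s₃.v z = s.v z := fun z hz => by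
    rw [f₃.v z hz, View.setVar_v, Function.update_of_ne (by omega), f.v z hz]
  refine .seq (wp_emitSet hVs ((f₃' 3 (by norm_num)).trans h3) ((f₃' 8 (by norm_num)).trans h8)
    h7₃ fun s₄ f₄ a₄ b₄ t₄ => ?_)
  refine .finish (hQ _ Z (fun z hz => (f₄.v z hz).trans (f₃' z hz)) ?_ rfl ?_ hg ?_ ?_)
  · simp only [View.close_arr, a₄]
    exact (o₁.trans o₂).trans o₃
  · simpa [a₄] using h7₃
  · simp only [View.setVar_buffer] at b₃
    simp only [View.close_log, View.close_time, f₄.log, f₃.log, View.setVar_log, f₂.log, f₁.log,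
      b₄, b₃, b₂, b₁, hbuf, List.nil_append]
  · have he := (G.inEdges_le (Finset.range G.size)).trans hV.edges
    have ho := hV.obls
    simp only [Finset.card_range, View.setVar_time, Expr.cost_ofNat, Nat.sub_zero] at t₃
    have e1 : (G.size + 1) * (G.size + 1) = G.size * (G.size + 1) + G.size + 1 := by ring
    simp only [View.close_time]
    omega

end RAM

/-! ### The obligations of the transfer conditions, and their construction on the machine -/

theorem mul_add_lt_mul_of_lt {m n t x : ℕ} (ht : t < m) (hx : x < n) : t * n + x < m * n :=
  calc t * n + x < t * n + n := by omega
    _ = (t + 1) * n := by ring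
    _ ≤ m * n := Nat.mul_le_mul_right n ht

/-- A finite labeled transition system in numbers: transition number `t < trans` leads from the
state `src t` to the state `tgt t` with label `lab t`. -/
structure TransitionTable where
  states : ℕ
  trans : ℕ
  src : ℕ → ℕ
  lab : ℕ → ℕ
  tgt : ℕ → ℕ
  src_lt : ∀ t < trans, src t < states
  tgt_lt : ∀ t < trans, tgt t < states

namespace TransitionTable

variable (A : TransitionTable)

/-- The nodes are the pairs of states. Each transition `t` and each state `q` give the obligation
`t * n + q` of the pair `(src t, q)`, that `q` can match `t`, and the obligation `m * n + t * n + q`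
of the pair `(q, src t)`. Each pair of transitions with the same label gives two edges, by which
either of the two is matched by the other. -/
def obligations : Obligations where
  size := A.states * A.states
  obls := 2 * (A.trans * A.states)
  edges := 2 * (A.trans * A.trans)
  node o := if o < A.trans * A.states then A.src (o / A.states) * A.states + o % A.states
    else (o - A.trans * A.states) % A.states * A.states +
      A.src ((o - A.trans * A.states) / A.states)
  ob h := if h % 2 = 0 then h / 2 / A.trans * A.states + A.src (h / 2 % A.trans)
    else A.trans * A.states + (h / 2 % A.trans * A.states + A.src (h / 2 / A.trans))
  key h := if A.lab (h / 2 / A.trans) = A.lab (h / 2 % A.trans)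
    then A.tgt (h / 2 / A.trans) * A.states + A.tgt (h / 2 % A.trans) else A.states * A.states
  node_lt o ho := by
    have hn : 0 < A.states := by
      rcases Nat.eq_zero_or_pos A.states with h | h
      · simp [h] at ho
      · exact h
    split_ifs with h
    · exact mul_add_lt_mul_of_lt (A.src_lt _ ((Nat.div_lt_iff_lt_mul hn).2 h)) (Nat.mod_lt _ hn)
    · exact mul_add_lt_mul_of_lt (Nat.mod_lt _ hn)
        (A.src_lt _ ((Nat.div_lt_iff_lt_mul hn).2 (by omega)))
  ob_lt h hh _ := by
    have hm : 0 < A.trans := by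
      rcases Nat.eq_zero_or_pos A.trans with h | h
      · simp [h] at hh
      · exact h
    have h1 : h / 2 / A.trans < A.trans := (Nat.div_lt_iff_lt_mul hm).2 (by omega)
    have h2 : h / 2 % A.trans < A.trans := Nat.mod_lt _ hm
    have h3 := mul_add_lt_mul_of_lt h1 (A.src_lt _ h2)
    have h4 := mul_add_lt_mul_of_lt h2 (A.src_lt _ h1)
    split_ifs <;> omega

end TransitionTable

namespace RAM

/-- Sequential composition. -/
local infixr:60 " ;; " => Prog.seq

/-- The first and the second transition of edge number `v 10` are determined, and `v 13` is nonzero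
if their labels differ. -/
def decodeEdge : Prog :=
  assign 11 (.var 10 / 2 / .var 1) ;;
  assign 12 (.var 10 / 2 % .var 1) ;;
  assign 13 (.inp (3 * .var 11 + 1) - .inp (3 * .var 12 + 1) +
    (.inp (3 * .var 12 + 1) - .inp (3 * .var 11 + 1)))

/-- The obligation of edge number `v 10` is determined. -/
def decodeObligation : Prog :=
  branch (.var 10 % 2)
    (assign 15 (.var 1 * .var 0 + (.var 12 * .var 0 + .inp (3 * .var 11))))
    (assign 15 (.var 11 * .var 0 + .inp (3 * .var 12)))

/-- Edge number `v 10` is entered into the linked lists and counters. -/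
def addEdge : Prog :=
  decodeEdge ;;
  branch (.var 13) skip
    (assign 14 (.inp (3 * .var 11 + 2) * .var 0 + .inp (3 * .var 12 + 2)) ;;
      decodeObligation ;;
      put 0 (.var 10) (.get 2 (.var 14)) ;;
      put 2 (.var 14) (.var 10 + 1) ;;
      put 1 (.var 10) (.var 15) ;;
      put 3 (.var 15) (.get 3 (.var 15) + 1))

/-- The node of obligation number `v 10` is determined. -/
def addNode : Prog :=
  assign 11 (.var 1 * .var 0) ;;
  branch (.var 11 - .var 10)
    (put 4 (.var 10) (.inp (3 * (.var 10 / .var 0)) * .var 0 + .var 10 % .var 0))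
    (put 4 (.var 10) ((.var 10 - .var 11) % .var 0 * .var 0 +
      .inp (3 * ((.var 10 - .var 11) / .var 0))))

/-- The system of obligations is constructed from the input. -/
def buildObligations : Prog :=
  assign 3 (.var 0 * .var 0) ;;
  assign 4 (2 * (.var 1 * .var 0)) ;;
  assign 5 (2 * (.var 1 * .var 1)) ;;
  forUp 10 5 addEdge ;;
  forUp 10 4 addNode

variable {V : Layout} {A : TransitionTable} {Q : View → Prop}

/-- The input word of the machine represents the transition table, and the memory suffices for the
system of obligations. -/
structure Reads (V : Layout) (A : TransitionTable) : Prop where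
  base : V.base = 3 * A.trans
  src : ∀ t < A.trans, V.input (3 * t) = A.src t
  lab : ∀ t < A.trans, V.input (3 * t + 1) = A.lab t
  tgt : ∀ t < A.trans, V.input (3 * t + 2) = A.tgt t
  size : A.states * A.states ≤ V.size
  obls : 2 * (A.trans * A.states) ≤ V.size
  edges : 2 * (A.trans * A.trans) ≤ V.size

/-- The arrays after the first `k` edges have been processed. -/
structure PartlyStored (G : Obligations) (k : ℕ) (arr : ℕ → ℕ → ℕ) : Prop where
  next : ∀ h < k, G.key h < G.size → arr 0 h = lastBelow (fun e => G.key e = G.key h) h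
  ob : ∀ h < k, G.key h < G.size → arr 1 h = G.ob h
  head : ∀ c < G.size, arr 2 c = lastBelow (fun e => G.key e = c) k
  count : ∀ o < G.obls, arr 3 o =
    Nat.count (fun h => G.ob h = o ∧ G.key h ∈ Finset.range G.size) k

theorem PartlyStored.succ_of_not {G : Obligations} {k : ℕ} {arr : ℕ → ℕ → ℕ}
    (h : PartlyStored G k arr) (hk : G.size ≤ G.key k) : PartlyStored G (k + 1) arr where
  next e he hs := by
    rcases Nat.lt_succ_iff_lt_or_eq.1 he with h' | rfl
    · exact h.next e h' hs
    · omega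
  ob e he hs := by
    rcases Nat.lt_succ_iff_lt_or_eq.1 he with h' | rfl
    · exact h.ob e h' hs
    · omega
  head c hc := by rw [lastBelow, if_neg (by omega), h.head c hc]
  count o ho := by
    rw [Nat.count_succ, if_neg (by simp; omega), h.count o ho, add_zero]

theorem wp_addEdge {s : View} {k : ℕ} (hV : Reads V A) (hk : k < A.obligations.edges)
    (h0 : s.v 0 = A.states) (h1 : s.v 1 = A.trans) (h10 : s.v 10 = k)
    (hp : PartlyStored A.obligations k s.arr)
    (hQ : ∀ s', Frame 11 s s' → (∀ a, 4 ≤ a → s'.arr a = s.arr a) → s'.buffer = s.buffer →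
      PartlyStored A.obligations (k + 1) s'.arr → s'.time ≤ s.time + 300 → Q s') :
    Wp V addEdge s Q := by
  classical
  have hf := V.fits
  have hp0 := V.size_pos
  obtain ⟨hb, hsrc, hlab, htgt, hs, hob, hed⟩ := hV
  have hk' : k < 2 * (A.trans * A.trans) := hk
  have hm : 0 < A.trans := by
    rcases Nat.eq_zero_or_pos A.trans with h | h
    · simp [h] at hk'
    · exact h
  obtain ⟨t₁, ht₁⟩ : ∃ t, k / 2 / A.trans = t := ⟨_, rfl⟩
  obtain ⟨t₂, ht₂⟩ : ∃ t, k / 2 % A.trans = t := ⟨_, rfl⟩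
  have l₁ : t₁ < A.trans := by rw [← ht₁]; exact (Nat.div_lt_iff_lt_mul hm).2 (by omega)
  have l₂ : t₂ < A.trans := by rw [← ht₂]; exact Nat.mod_lt _ hm
  have hobk : A.obligations.ob k = if k % 2 = 0 then t₁ * A.states + A.src t₂
      else A.trans * A.states + (t₂ * A.states + A.src t₁) := by
    simp only [TransitionTable.obligations, ht₁, ht₂]
  have hkey : A.obligations.key k = if A.lab t₁ = A.lab t₂
      then A.tgt t₁ * A.states + A.tgt t₂ else A.states * A.states := by
    simp only [TransitionTable.obligations, ht₁, ht₂]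
  have b₁ := mul_add_lt_mul_of_lt l₁ (A.src_lt t₂ l₂)
  have b₂ := mul_add_lt_mul_of_lt l₂ (A.src_lt t₁ l₁)
  have b₃ := mul_add_lt_mul_of_lt (A.tgt_lt t₁ l₁) (A.tgt_lt t₂ l₂)
  have hsz : A.obligations.size = A.states * A.states := rfl
  have hobl : A.obligations.obls = 2 * (A.trans * A.states) := rfl
  have L₁ := hlab t₁ l₁
  have L₂ := hlab t₂ l₂
  have S₁ := hsrc t₁ l₁
  have S₂ := hsrc t₂ l₂
  have T₁ := htgt t₁ l₁
  have T₂ := htgt t₂ l₂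
  have hI : ∀ i < V.base, ∀ σ, Rel V σ s → V.input i ≤ V.bound := fun i hi σ hσ => by
    rw [← hσ.inp i hi]; exact hσ.mem_le i
  -- the labels are bounded because they are stored in the memory
  intro σ hσ
  have B₁ := hI (3 * t₁ + 1) (by omega) σ hσ
  have B₂ := hI (3 * t₂ + 1) (by omega) σ hσ
  rw [L₁] at B₁
  rw [L₂] at B₂
  suffices Wp V addEdge s Q from this σ hσ
  clear hσ σ
  refine .seq (.seq (.assign (by norm_num) (by norm_num) (by simp) ?_))
  refine .seq (.assign (by norm_num) (by norm_num) (by simp) ?_)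
  refine .assign (by norm_num) (by norm_num) ?_ ?_
  · simp [h10, h1, ht₁, ht₂, L₁, L₂]; omega
  refine .branch (by simp) (fun h => .skip ?_) (fun h => ?_)
  · simp [h10, h1, ht₁, ht₂, L₁, L₂] at h
    refine hQ _ ⟨fun z hz => ?_, rfl⟩ (fun _ _ => rfl) rfl ?_ ?_
    · simp [Function.update_of_ne (show z ≠ 11 by omega),
        Function.update_of_ne (show z ≠ 12 by omega), Function.update_of_ne (show z ≠ 13 by omega)]
    · refine hp.succ_of_not ?_
      rw [hkey, if_neg (by omega)]; exact le_rfl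
    · simp
  · simp [h10, h1, ht₁, ht₂, L₁, L₂] at h
    have hll : A.lab t₁ = A.lab t₂ := by omega
    rw [if_pos hll] at hkey
    have hoblt := A.obligations.ob_lt k hk (by omega)
    refine .seq (.assign (by norm_num) (by norm_num) ?_ ?_)
    · simp [h10, h1, h0, ht₁, ht₂, T₁, T₂]; omega
    refine .seq (Wp.mono (Q' := fun s' => s'.v 15 = A.obligations.ob k ∧ s'.v 14 =
      A.obligations.key k ∧ Frame 11 s s' ∧ s'.arr = s.arr ∧ s'.buffer = s.buffer ∧
      s'.time ≤ s.time + 200) ?_ ?_)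
    · refine .branch (by simp) (fun h => .assign (by norm_num) (by norm_num) ?_ ?_)
        (fun h => .assign (by norm_num) (by norm_num) ?_ ?_)
      · simp [h10, h1, h0, ht₁, ht₂, S₁]; omega
      · simp [h10] at h
        refine ⟨?_, ?_, ⟨fun z hz => ?_, rfl⟩, rfl, rfl, ?_⟩
        · simp [h10, h1, h0, ht₁, ht₂, S₁, hobk, h]
        · simp [h10, h1, h0, ht₁, ht₂, T₁, T₂, hkey]
        · simp [Function.update_of_ne (show z ≠ 11 by omega),
            Function.update_of_ne (show z ≠ 12 by omega),
            Function.update_of_ne (show z ≠ 13 by omega),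
            Function.update_of_ne (show z ≠ 14 by omega),
            Function.update_of_ne (show z ≠ 15 by omega)]
        · simp
      · simp [h10, h1, h0, ht₁, ht₂, S₂]; omega
      · simp [h10] at h
        refine ⟨?_, ?_, ⟨fun z hz => ?_, rfl⟩, rfl, rfl, ?_⟩
        · simp [h10, h1, h0, ht₁, ht₂, S₂, hobk, h]
        · simp [h10, h1, h0, ht₁, ht₂, T₁, T₂, hkey]
        · simp [Function.update_of_ne (show z ≠ 11 by omega),
            Function.update_of_ne (show z ≠ 12 by omega),
            Function.update_of_ne (show z ≠ 13 by omega),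
            Function.update_of_ne (show z ≠ 14 by omega),
            Function.update_of_ne (show z ≠ 15 by omega)]
        · simp
    · clear h
      rintro s' ⟨h15, h14, fr, harr, hbuf, ht⟩
      have h10' : s'.v 10 = k := (fr.v 10 (by norm_num)).trans h10
      have hcnt := hp.count _ hoblt
      have hcle : Nat.count (fun h => A.obligations.ob h = A.obligations.ob k ∧
        A.obligations.key h ∈ Finset.range A.obligations.size) k ≤ k := Nat.count_le _
      rw [← harr] at hp hcnt
      rw [← hcnt] at hcle
      have hklt : A.obligations.key k < A.obligations.size := by omega
      refine .seq (.put (by norm_num) (by simp) (by simp [h10']; omega) (by simp [h14]; omega) ?_)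
      refine .seq (.put (by norm_num) (by simp) (by simp [h14]; omega) (by simp [h10']; omega) ?_)
      refine .seq (.put (by norm_num) (by simp) (by simp [h10']; omega) (by simp) ?_)
      refine .put (by norm_num) (by simp) (by simp [h15]; omega)
        (by simp [h15]; omega) ?_
      refine hQ _ ⟨fr.v, fr.log⟩ (fun a ha => ?_) hbuf ⟨?_, ?_, ?_, ?_⟩ ?_
      · simp [Function.update_of_ne (show a ≠ 0 by omega),
          Function.update_of_ne (show a ≠ 1 by omega),
          Function.update_of_ne (show a ≠ 2 by omega),
          Function.update_of_ne (show a ≠ 3 by omega), harr]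
      · intro e he hsz
        rcases Nat.lt_succ_iff_lt_or_eq.1 he with h' | rfl
        · simp [h10', h'.ne, hp.next e h' hsz]
        · simp [h10', h14, hp.head _ hsz]
      · intro e he hsz
        rcases Nat.lt_succ_iff_lt_or_eq.1 he with h' | rfl
        · simp [h10', h'.ne, hp.ob e h' hsz]
        · simp [h10', h15]
      · intro c hc
        rw [lastBelow]
        by_cases e : A.obligations.key k = c
        · subst e; simp [h10', h14]
        · simp [h14, e, Ne.symm e, hp.head c hc]
      · intro o ho
        rw [Nat.count_succ]
        by_cases e : A.obligations.ob k = o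
        · subst e
          rw [if_pos ⟨rfl, Finset.mem_range.2 hklt⟩]
          simp [h15, hcnt]
        · rw [if_neg (by simp [e])]
          simp [h15, Ne.symm e, hp.count o ho]
      · simp; omega

theorem wp_addNode {s : View} {k : ℕ} (hV : Reads V A) (hk : k < A.obligations.obls)
    (h0 : s.v 0 = A.states) (h1 : s.v 1 = A.trans) (h10 : s.v 10 = k)
    (hQ : ∀ s', Frame 11 s s' → s'.buffer = s.buffer →
      s'.arr = Function.update s.arr 4 (Function.update (s.arr 4) k (A.obligations.node k)) →
      s'.time ≤ s.time + 100 → Q s') :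
    Wp V addNode s Q := by
  have hf := V.fits
  have hp0 := V.size_pos
  obtain ⟨hb, hsrc, hlab, htgt, hs, hob, hed⟩ := hV
  have hk' : k < 2 * (A.trans * A.states) := hk
  have hn : 0 < A.states := by
    rcases Nat.eq_zero_or_pos A.states with h | h
    · simp [h] at hk'
    · exact h
  have hnode : A.obligations.node k =
    if k < A.trans * A.states then A.src (k / A.states) * A.states + k % A.states
    else (k - A.trans * A.states) % A.states * A.states +
      A.src ((k - A.trans * A.states) / A.states) := rfl
  have hlt : A.obligations.node k < A.states * A.states := A.obligations.node_lt k hk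
  refine .seq (.assign (by norm_num) (by norm_num) (by simp [h1, h0]; omega) ?_)
  refine .branch (by simp) (fun h => ?_) (fun h => ?_)
  · simp [h10, h1, h0] at h
    rw [if_pos (by omega)] at hnode
    have l₁ : k / A.states < A.trans := (Nat.div_lt_iff_lt_mul hn).2 (by omega)
    have S₁ := hsrc _ l₁
    refine .put (by norm_num) (by simp) (by simp [h10]; omega)
      (by simp [h10, h0, S₁]; omega) (hQ _ ⟨fun z hz => ?_, rfl⟩ rfl ?_ ?_)
    · simp [Function.update_of_ne (show z ≠ 11 by omega)]
    · simp [h10, h0, S₁, hnode]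
    · simp
  · simp [h10, h1, h0] at h
    rw [if_neg (by omega)] at hnode
    have l₁ : (k - A.trans * A.states) / A.states < A.trans :=
      (Nat.div_lt_iff_lt_mul hn).2 (by omega)
    have S₁ := hsrc _ l₁
    refine .put (by norm_num) (by simp) (by simp [h10]; omega)
      (by simp [h10, h0, h1, S₁]; omega) (hQ _ ⟨fun z hz => ?_, rfl⟩ rfl ?_ ?_)
    · simp [Function.update_of_ne (show z ≠ 11 by omega)]
    · simp [h10, h0, h1, S₁, hnode]
    · simp

theorem wp_buildObligations {s : View} (hV : Reads V A) (h0 : s.v 0 = A.states)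
    (h1 : s.v 1 = A.trans) (hz : ∀ a i, s.arr a i = 0)
    (hQ : ∀ s', s'.log = s.log → s'.buffer = s.buffer → s'.v 3 = A.obligations.size →
      s'.v 4 = A.obligations.obls → A.obligations.Stored s'.arr → s'.arr 8 0 = 0 →
      s'.time ≤ s.time + 500 * V.size → Q s') : Wp V buildObligations s Q := by
  have hf := V.fits
  have hp0 := V.size_pos
  obtain ⟨hb, hsrc, hlab, htgt, hs, hob, hed⟩ := id hV
  refine .seq (.assign (by norm_num) (by norm_num) (by simp [h0]; omega) ?_)
  refine .seq (.assign (by norm_num) (by norm_num) (by simp [h0, h1]; omega) ?_)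
  refine .seq (.assign (by norm_num) (by norm_num) (by simp [h1]; omega) ?_)
  refine .seq (.forUp (by norm_num) (by norm_num) (by norm_num)
    (fun k arr buf => PartlyStored A.obligations k arr ∧ arr 8 0 = 0 ∧ buf = s.buffer) 300
    ⟨⟨by simp, by simp, by simp [hz, lastBelow], by simp [hz]⟩, hz 8 0, rfl⟩ ?_ ?_)
  · rintro k hk s₁ fr h10 ⟨hp, h8, hbuf⟩
    simp [h0, h1] at hk
    refine wp_addEdge hV hk (by simp [fr.v 0, h0]) (by simp [fr.v 1, h1]) h10 hp ?_
    intro s' fr' ha hbuf' hp' ht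
    exact ⟨fr', ⟨hp', by rw [ha 8 (by norm_num), h8], hbuf'.trans hbuf⟩, ht⟩
  · rintro s₁ f₁ ⟨hp, h8, hbuf⟩ t₁
    have g3 : s₁.v 3 = A.states * A.states := by simp [f₁.v 3, h0]
    have g4 : s₁.v 4 = 2 * (A.trans * A.states) := by simp [f₁.v 4, h0, h1]
    refine .forUp (by norm_num) (by norm_num) (by norm_num)
      (fun k arr buf => (∀ a, a ≠ 4 → arr a = s₁.arr a) ∧
        (∀ o < k, arr 4 o = A.obligations.node o) ∧ buf = s.buffer) 100
      ⟨fun _ _ => rfl, by simp, hbuf⟩ ?_ ?_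
    · rintro k hk s₂ fr h10 ⟨ha, h4, hbuf⟩
      rw [g4] at hk
      refine wp_addNode hV hk (by simp [fr.v 0, f₁.v 0, h0]) (by simp [fr.v 1, f₁.v 1, h1]) h10 ?_
      intro s' fr' hbuf' ha' ht
      refine ⟨fr', ⟨fun a h => ?_, fun o ho => ?_, hbuf'.trans hbuf⟩, ht⟩
      · rw [ha', Function.update_of_ne h, ha a h]
      · rw [ha']
        rcases Nat.lt_succ_iff_lt_or_eq.1 ho with h' | rfl
        · simp [h'.ne, h4 o h']
        · simp
    · rintro s₂ f₂ ⟨ha, h4, hbuf⟩ t₂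
      simp only [View.setVar_v, View.setVar_time] at t₁ hp
      simp [h0, h1] at t₁ hp
      rw [g4] at t₂ h4
      refine hQ s₂ (f₂.log.trans f₁.log) hbuf ((f₂.v 3 (by norm_num)).trans g3)
        ((f₂.v 4 (by norm_num)).trans g4) ⟨?_, ?_, ?_, ?_, h4⟩ ?_ ?_
      · rw [ha 0 (by norm_num)]; exact hp.next
      · rw [ha 1 (by norm_num)]; exact hp.ob
      · rw [ha 2 (by norm_num)]; exact hp.head
      · rw [ha 3 (by norm_num)]; intro o ho
        rw [hp.count o ho, Obligations.count]; congr
      · rw [ha 8 (by norm_num), h8]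
      · omega

end RAM

/-! ### The enumeration with sets of numbers -/

namespace FixEnum

/-- The test of the algorithm in terms of positions: the limit `Z` of `X.erase b` is in none of the
searched regions if `b` is not below the position `β` that was erased to reach `X`, and if `Z`
agrees with `X` below `b`. -/
def Fresh (X Z : Finset ℕ) (β b : ℕ) : Prop := β ≤ b ∧ ∀ a ∈ X, a < b → a ∈ Z

/-- `Trace N P X β b tr`: the events of the for-loop for a set `X` of numbers below `N`, from
position `b` on, are `tr`, where the limit of a set is its largest subset with property `P`, and `β`
is the position that was erased to reach `X`, or `0` if the search starts with `X`. -/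
inductive Trace (N : ℕ) (P : Finset ℕ → Prop) :
    Finset ℕ → ℕ → ℕ → List (Event (Finset ℕ)) → Prop
  | done {X β} : Trace N P X β N []
  | absent {X β b tr} (hb : b < N) (hX : b ∉ X) (h : Trace N P X β (b + 1) tr) :
      Trace N P X β b tr
  | skip {X β b Z tr} (hb : b < N) (hX : b ∈ X)
      (hZ : IsGreatest {R | R ⊆ X.erase b ∧ P R} Z) (ht : ¬ Fresh X Z β b)
      (h : Trace N P X β (b + 1) tr) : Trace N P X β b (.query (X.erase b) Z :: tr)
  | recurse {X β b Z tr₁ tr₂} (hb : b < N) (hX : b ∈ X)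
      (hZ : IsGreatest {R | R ⊆ X.erase b ∧ P R} Z) (ht : Fresh X Z β b)
      (h₁ : Trace N P Z b 0 tr₁) (h₂ : Trace N P X β (b + 1) tr₂) :
      Trace N P X β b (.query (X.erase b) Z :: .output Z :: (tr₁ ++ tr₂))

/-- The algorithm terminates, since sets become smaller with each call. -/
theorem exists_trace {N : ℕ} {P : Finset ℕ → Prop}
    (hP : ∀ y, ∃ Z, IsGreatest {R | R ⊆ y ∧ P R} Z) :
    ∀ (c : ℕ) (X : Finset ℕ), X.card = c → ∀ j b β, b + j = N → ∃ tr, Trace N P X β b tr := by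
  classical
  intro c
  induction c using Nat.strong_induction_on with
  | _ c ih =>
    intro X hX j
    induction j with
    | zero => rintro b β rfl; exact ⟨[], .done⟩
    | succ j ihj =>
      intro b β hb
      obtain ⟨tr, htr⟩ := ihj (b + 1) β (by omega)
      by_cases hbX : b ∈ X
      · obtain ⟨Z, hZ⟩ := hP (X.erase b)
        by_cases ht : Fresh X Z β b
        · have hlt : Z.card < c := by
            rw [← hX]
            exact (Finset.card_le_card hZ.1.1).trans_lt (Finset.card_erase_lt_of_mem hbX)
          obtain ⟨tr₁, h₁⟩ := ih _ hlt Z rfl N 0 b (by omega)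
          exact ⟨_, .recurse (by omega) hbX hZ ht h₁ htr⟩
        · exact ⟨_, .skip (by omega) hbX hZ ht htr⟩
      · exact ⟨_, .absent (by omega) hbX htr⟩

@[simp] theorem outputs_nil {L : Type*} : outputs ([] : List (Event L)) = [] := rfl
@[simp] theorem outputs_query {L : Type*} (y z : L) (tr : List (Event L)) :
    outputs (.query y z :: tr) = outputs tr := rfl
@[simp] theorem outputs_output {L : Type*} (x : L) (tr : List (Event L)) :
    outputs (.output x :: tr) = x :: outputs tr := rfl
@[simp] theorem outputs_append {L : Type*} (tr tr' : List (Event L)) :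
    outputs (tr ++ tr') = outputs tr ++ outputs tr' := List.filterMap_append

/-- The for-loop outputs those proper subsets with property `P` that agree with `X` on all positions
below `β` and below `b`: such a set `R` is found in the branch of the first position in which it
differs from `X`. -/
theorem Trace.outputs {N : ℕ} {P : Finset ℕ → Prop} {X : Finset ℕ} {β b : ℕ}
    {tr : List (Event (Finset ℕ))} (h : Trace N P X β b tr) (hXN : X ⊆ Finset.range N) :
    (outputs tr).Nodup ∧ ∀ R, R ∈ outputs tr ↔
      P R ∧ R ⊆ X ∧ R ≠ X ∧ ∀ a ∈ X, a < β ∨ a < b → a ∈ R := by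
  classical
  induction h with
  | @done X β =>
    refine ⟨List.nodup_nil, fun R => ⟨fun h => by simp at h, ?_⟩⟩
    rintro ⟨_, h2, h3, h4⟩
    exact absurd (h2.antisymm fun a ha => h4 a ha (.inr (Finset.mem_range.1 (hXN ha)))) h3
  | @absent X β b tr hb hX h ih =>
    obtain ⟨i1, i2⟩ := ih hXN
    refine ⟨i1, fun R => (i2 R).trans ?_⟩
    refine and_congr_right fun _ => and_congr_right fun _ => and_congr_right fun _ => ?_
    refine forall₂_congr fun a ha => ?_
    have : a ≠ b := by rintro rfl; exact hX ha
    rw [show a < b + 1 ↔ a < b by omega]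
  | @skip X β b Z tr hb hX hZ ht h ih =>
    obtain ⟨i1, i2⟩ := ih hXN
    refine ⟨i1, fun R => ?_⟩
    rw [outputs_query, i2 R]
    refine and_congr_right fun h1 => and_congr_right fun h2 => and_congr_right fun _ => ?_
    refine ⟨fun h a ha hab => h a ha (hab.imp id (by omega)), fun h => ?_⟩
    have hbR : b ∈ R := by
      by_contra hbR
      refine ht ⟨?_, fun a ha hab => ?_⟩
      · by_contra hβ; exact hbR (h b hX (.inl (by omega)))
      · refine hZ.2 ⟨fun c hc => Finset.mem_erase.2 ⟨?_, h2 hc⟩, h1⟩ (h a ha (.inr hab))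
        rintro rfl; exact hbR hc
    intro a ha hab
    rcases eq_or_ne a b with rfl | hne
    · exact hbR
    · exact h a ha (hab.imp id (by omega))
  | @recurse X β b Z tr₁ tr₂ hb hX hZ ht h₁ h₂ ih₁ ih₂ =>
    obtain ⟨j1, j2⟩ := ih₁ ((hZ.1.1.trans (Finset.erase_subset _ _)).trans hXN)
    obtain ⟨i1, i2⟩ := ih₂ hXN
    have hbZ : b ∉ Z := fun h => Finset.notMem_erase b X (hZ.1.1 h)
    have hnot : ∀ R, R ⊆ Z → R ∉ FixEnum.outputs tr₂ := fun R hR hm =>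
      hbZ (hR (((i2 R).1 hm).2.2.2 b hX (.inr (by omega))))
    simp only [outputs_query, outputs_output, outputs_append, List.nodup_cons, List.mem_append,
      List.mem_cons]
    refine ⟨⟨?_, List.nodup_append'.2 ⟨j1, i1, ?_⟩⟩, fun R => ⟨?_, ?_⟩⟩
    · rintro (h | h)
      · exact ((j2 Z).1 h).2.2.1 rfl
      · exact hnot Z subset_rfl h
    · intro R h1 h2
      exact hnot R ((j2 R).1 h1).2.1 h2
    · have key : ∀ R, P R → R ⊆ Z → (∀ a ∈ Z, a < b → a ∈ R) →
          P R ∧ R ⊆ X ∧ R ≠ X ∧ ∀ a ∈ X, a < β ∨ a < b → a ∈ R := by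
        intro R h1 h2 h3
        refine ⟨h1, h2.trans (hZ.1.1.trans (Finset.erase_subset _ _)), ?_, fun a ha hab => ?_⟩
        · rintro rfl; exact hbZ (h2 hX)
        · have hab' : a < b := hab.elim (fun h => h.trans_le ht.1) id
          exact h3 a (ht.2 a ha hab') hab'
      rintro (rfl | h | h)
      · exact key R hZ.1.2 subset_rfl fun a ha _ => ha
      · obtain ⟨h1, h2, _, h4⟩ := (j2 R).1 h
        exact key R h1 h2 fun a ha hab => h4 a ha (.inl hab)
      · obtain ⟨h1, h2, h3, h4⟩ := (i2 R).1 h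
        exact ⟨h1, h2, h3, fun a ha hab => h4 a ha (hab.imp id (by omega))⟩
    · rintro ⟨h1, h2, h3, h4⟩
      by_cases hbR : b ∈ R
      · refine .inr (.inr ((i2 R).2 ⟨h1, h2, h3, fun a ha hab => ?_⟩))
        rcases eq_or_ne a b with rfl | hne
        · exact hbR
        · exact h4 a ha (hab.imp id (by omega))
      · have hRZ : R ⊆ Z := hZ.2 ⟨fun c hc => Finset.mem_erase.2
          ⟨by rintro rfl; exact hbR hc, h2 hc⟩, h1⟩
        by_cases hR : R = Z
        · exact .inl hR
        · refine .inr (.inl ((j2 R).2 ⟨h1, hRZ, hR, fun a ha hab => ?_⟩))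
          exact h4 a (Finset.mem_of_mem_erase (hZ.1.1 ha)) (.inr (by omega))

end FixEnum

/-! ### The enumeration on the machine -/

namespace RAM

open FixEnum

/-- Sequential composition. -/
local infixr:60 " ;; " => Prog.seq

/-- The set at level `v 6` of the stack is copied to array 9, without the element `v 7`. -/
def copyArgument : Prog :=
  forUp 10 3 (put 9 (.var 10) (.get 7 (.var 6 * .var 3 + .var 10))) ;; put 9 (.var 7) 0

/-- The only entry of array 10 tells whether the set stored from index `v 8` on in array 7 has to be
searched. -/
def testFresh : Prog :=
  put 10 0 (1 - (.get 8 (.var 6) - .var 7)) ;;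
  forUp 10 7 (branch (.get 7 (.var 6 * .var 3 + .var 10) - .get 7 (.var 8 + .var 10))
    (put 10 0 0) skip)

/-- The limit of the current lower cover is computed and tested. -/
def visit : Prog :=
  copyArgument ;; assign 8 (.var 6 * .var 3 + .var 3) ;; limitQuery ;; testFresh

/-- The search is started at the next level of the stack. -/
def descend : Prog :=
  assign 6 (.var 6 + 1) ;; put 8 (.var 6) (.var 7) ;; emitSet ;; .finish .output ;; assign 7 0

/-- One step of the search: `v 6` is the level of the stack, the sets of the levels are stored in
array 7 and the positions that were erased to reach them in array 8, and `v 7` is the current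
position. -/
def searchStep : Prog :=
  branch (.var 3 - .var 7)
    (branch (.get 7 (.var 6 * .var 3 + .var 7))
      (visit ;; branch (.get 10 0) descend (assign 7 (.var 7 + 1)))
      (assign 7 (.var 7 + 1)))
    (branch (.var 6) (assign 7 (.get 8 (.var 6) + 1) ;; assign 6 (.var 6 - 1)) (assign 9 0))

/-- The search. -/
def searchLoop : Prog := while_ (.var 9) searchStep

/-- The kind and the word of the record for an event. -/
noncomputable def encode (N : ℕ) : Event (Finset ℕ) → Kind × List ℕ
  | .query y z => (.query, indWord N y ++ indWord N z)
  | .output x => (.output, indWord N x)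

/-- The kinds and words of the records in a log. -/
def entries (log : List Record) : List (Kind × List ℕ) := log.map fun ρ => (ρ.kind, ρ.word)

@[simp] theorem entries_append (l l' : List Record) : entries (l ++ l') = entries l ++ entries l' :=
  List.map_append

/-- The time of the last output, or zero. -/
def lastOutput (log : List Record) : ℕ := (outputTimes log).getLastD 0

/-- At most `D` steps pass before the first output and between consecutive outputs. -/
def Paced (D : ℕ) (log : List Record) : Prop :=
  List.IsChain (fun t t' => t' ≤ t + D) (0 :: outputTimes log)

theorem outputTimes_append_query (log : List Record) (w : List ℕ) (t : ℕ) :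
    outputTimes (log ++ [⟨.query, w, t⟩]) = outputTimes log := by
  simp [outputTimes]

theorem outputTimes_append_output (log : List Record) (w : List ℕ) (t : ℕ) :
    outputTimes (log ++ [⟨.output, w, t⟩]) = outputTimes log ++ [t] := by
  simp [outputTimes]

theorem isChain_concat {D : ℕ} (l : List ℕ) (t₀ t : ℕ) :
    List.IsChain (fun t t' => t' ≤ t + D) (t₀ :: (l ++ [t])) ↔
      List.IsChain (fun t t' => t' ≤ t + D) (t₀ :: l) ∧ t ≤ l.getLastD t₀ + D := by
  induction l generalizing t₀ with
  | nil => simp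
  | cons a l ih =>
    rw [List.cons_append, List.isChain_cons_cons, ih, List.isChain_cons_cons, and_assoc,
      List.getLastD_cons]

theorem Paced.output {D : ℕ} {log : List Record} (h : Paced D log) (w : List ℕ) {t : ℕ}
    (ht : t ≤ lastOutput log + D) : Paced D (log ++ [⟨.output, w, t⟩]) := by
  unfold Paced
  rw [outputTimes_append_output]
  exact (isChain_concat _ _ _).2 ⟨h, ht⟩

/-- The number of steps of the search since the last output is at most this potential at level `d`
and position `b`, up to a constant factor: going on to the next position and going back to the
previous level both increase it. -/
def potential (N d b : ℕ) : ℕ := (N + 1 - d) * (N + 2) + b + 1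

theorem potential_le {N d b : ℕ} (hb : b ≤ N) : potential N d b ≤ (N + 2) * (N + 2) := by
  unfold potential
  have : (N + 1 - d) * (N + 2) ≤ (N + 1) * (N + 2) := Nat.mul_le_mul_right _ (by omega)
  nlinarith

theorem potential_pop {N d b : ℕ} (hd : d < N) :
    potential N (d + 1) N + 1 ≤ potential N d (b + 1) := by
  unfold potential
  have : N + 1 - d = (N + 1 - (d + 1)) + 1 := by omega
  rw [this, Nat.succ_mul]
  omega

theorem le_add_mul_of_step {t t' l T p p' : ℕ} (h : t ≤ l + T * p) (h' : t' ≤ t + T)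
    (hp : p + 1 ≤ p') : t' ≤ l + T * p' := by
  have := Nat.mul_le_mul_left T hp
  rw [Nat.mul_succ] at this
  omega

variable {V : Layout} {G : Obligations} {Q : View → Prop}

/-- The variables and arrays at level `d` and position `b` of the search. -/
structure OnLevel (G : Obligations) (d : ℕ) (X : Finset ℕ) (β b : ℕ) (s : View) : Prop where
  v3 : s.v 3 = G.size
  v4 : s.v 4 = G.obls
  v6 : s.v 6 = d
  v7 : s.v 7 = b
  v9 : s.v 9 = 1
  stored : G.Stored s.arr
  set : ∀ a < G.size, s.arr 7 (d * G.size + a) = ind X a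
  erased : s.arr 8 d = β
  buffer : s.buffer = []
  pos_le : b ≤ G.size
  subset : X ⊆ Finset.range G.size
  level : d + X.card ≤ G.size

theorem OnLevel.tick {d β b : ℕ} {X : Finset ℕ} {s : View} (h : OnLevel G d X β b s) (c : ℕ) :
    OnLevel G d X β b (s.tick c) :=
  ⟨h.v3, h.v4, h.v6, h.v7, h.v9, h.stored, h.set, h.erased, h.buffer, h.pos_le, h.subset, h.level⟩

/-- The state at the head of the loop, at level `d` and position `b`. -/
structure AtLoop (V : Layout) (G : Obligations) (d : ℕ) (X : Finset ℕ) (β b : ℕ) (s : View) :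
    Prop extends OnLevel G d X β b s where
  paced : Paced (3000 * V.size * ((G.size + 2) * (G.size + 2))) s.log
  time : s.time ≤ lastOutput s.log + 2000 * V.size * potential G.size d b

/-- The memory provides for the arrays of the search. -/
structure Fits (V : Layout) (G : Obligations) : Prop where
  stack : (G.size + 2) * (G.size + 2) ≤ V.size
  obls : G.obls ≤ V.size
  edges : G.edges ≤ V.size

theorem wp_copyArgument {s : View} {N d b : ℕ} {X : Finset ℕ} (hd : d * N + N ≤ V.size)
    (h3 : s.v 3 = N) (h6 : s.v 6 = d) (h7 : s.v 7 = b) (hb : b < N)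
    (hX : ∀ a < N, s.arr 7 (d * N + a) = ind X a)
    (hQ : ∀ s', Frame 10 s s' → s'.buffer = s.buffer → (∀ a ≠ 9, s'.arr a = s.arr a) →
      (∀ a < N, s'.arr 9 a = ind (X.erase b) a) → s'.time ≤ s.time + 60 * N + 40 → Q s') :
    Wp V copyArgument s Q := by
  have hf := V.fits
  refine .seq (.forUp (by norm_num) (by norm_num) (by norm_num)
    (fun k arr buf => buf = s.buffer ∧ (∀ a ≠ 9, arr a = s.arr a) ∧ ∀ a < k, arr 9 a = ind X a) 40
    ⟨rfl, fun _ _ => rfl, by simp⟩ ?_ ?_)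
  · rintro k hk s₁ fr h10 ⟨hbuf, ha, h9⟩
    have g6 : s₁.v 6 = d := (fr.v 6 (by norm_num)).trans h6
    have g3 : s₁.v 3 = N := (fr.v 3 (by norm_num)).trans h3
    refine .put (by norm_num) (by simp) (by simp [h10]; omega) (by simp [g6, g3, h10]; omega)
      ⟨⟨fun _ _ => rfl, rfl⟩, ⟨hbuf, fun a h => ?_, fun a h => ?_⟩, by simp⟩
    · simp [Function.update_of_ne h, ha a h]
    · rcases Nat.lt_succ_iff_lt_or_eq.1 h with h' | rfl
      · simp [h10, h'.ne, h9 a h']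
      · simp [h10, g6, g3, ha, hX a (by omega)]
  · rintro s₁ fr ⟨hbuf, ha, h9⟩ ht
    rw [h3] at h9 ht
    have g7 : s₁.v 7 = b := (fr.v 7 (by norm_num)).trans h7
    refine .put (by norm_num) (by simp) (by simp [g7]; omega) (by simp)
      (hQ _ ⟨fr.v, fr.log⟩ hbuf (fun a h => ?_) (fun a h => ?_) ?_)
    · simp [Function.update_of_ne h, ha a h]
    · by_cases e : a = b
      · subst e; simp [g7, ind]
      · simp [g7, e, h9 a h, ind]
    · simp; omega

open Classical in
theorem wp_testFresh {s : View} {N d b β q : ℕ} {X Z : Finset ℕ} (hq : q + N ≤ V.size)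
    (hd : d * N + N ≤ V.size) (hdV : d < V.size)
    (h3 : s.v 3 = N) (h6 : s.v 6 = d) (h7 : s.v 7 = b) (h8 : s.v 8 = q) (hb : b ≤ N)
    (hβ : s.arr 8 d = β)
    (hX : ∀ a < N, s.arr 7 (d * N + a) = ind X a) (hZ : ∀ a < N, s.arr 7 (q + a) = ind Z a)
    (hQ : ∀ s', Frame 10 s s' → s'.buffer = s.buffer → (∀ a ≠ 10, s'.arr a = s.arr a) →
      s'.arr 10 0 = (if Fresh X Z β b then 1 else 0) → s'.time ≤ s.time + 80 * N + 60 → Q s') :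
    Wp V testFresh s Q := by
  have hf := V.fits
  have hp := V.size_pos
  refine .seq (.put (by norm_num) (by simp) (by simp; omega)
    (by simp [h6]; omega) ?_)
  refine .forUp (by norm_num) (by norm_num) (by norm_num)
    (fun k arr buf => buf = s.buffer ∧ (∀ a ≠ 10, arr a = s.arr a) ∧
      arr 10 0 = if β ≤ b ∧ (∀ a ∈ X, a < k → a ∈ Z) then 1 else 0) 60
    ⟨rfl, fun a h => ?_, ?_⟩ ?_ ?_
  · simp [Function.update_of_ne h]
  · simp [h6, h7, hβ]
    split_ifs <;> omega
  · rintro k hk s₁ fr h10 ⟨hbuf, ha, h⟩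
    simp [h7] at hk
    have g6 : s₁.v 6 = d := by simp [fr.v 6, h6]
    have g3 : s₁.v 3 = N := by simp [fr.v 3, h3]
    have g8 : s₁.v 8 = q := by simp [fr.v 8, h8]
    have a7 := ha 7 (by norm_num)
    have hXk : s₁.arr 7 (d * N + k) = ind X k := by rw [a7, hX k (by omega)]
    have hZk : s₁.arr 7 (q + k) = ind Z k := by rw [a7, hZ k (by omega)]
    have succ_iff : (∀ a ∈ X, a < k + 1 → a ∈ Z) ↔
        (∀ a ∈ X, a < k → a ∈ Z) ∧ (k ∈ X → k ∈ Z) := by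
      constructor
      · intro H; exact ⟨fun a h1 h2 => H a h1 (by omega), fun h1 => H k h1 (by omega)⟩
      · rintro ⟨H1, H2⟩ a h1 h2
        rcases Nat.lt_succ_iff_lt_or_eq.1 h2 with h' | rfl
        · exact H1 a h1 h'
        · exact H2 h1
    refine .branch (by simp [g6, g3, g8, h10]; omega) (fun h' => .put (by norm_num) (by simp)
      (by simp; omega) (by simp) ?_) (fun h' => .skip ?_)
    · simp [g6, g3, g8, h10, hXk, hZk] at h'
      refine ⟨⟨fun _ _ => rfl, rfl⟩, ⟨hbuf, fun a h => ?_, ?_⟩, by simp⟩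
      · simp [Function.update_of_ne h, ha a h]
      · have h1 := ind_le_one X k
        have h2 : ind Z k = 0 := by omega
        have h3 : k ∈ X := by
          by_contra hc; rw [ind_of_notMem hc] at h'; omega
        rw [if_neg]
        · simp
        · rw [succ_iff]; rintro ⟨-, -, H⟩; exact ind_eq_zero.1 h2 (H h3)
    · simp [g6, g3, g8, h10, hXk, hZk] at h'
      refine ⟨⟨fun _ _ => rfl, rfl⟩, ⟨hbuf, ha, ?_⟩, by simp⟩
      have : k ∈ X → k ∈ Z := by
        intro h1
        by_contra h2
        rw [ind_of_mem h1, ind_of_notMem h2] at h'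
        omega
      simp only [View.tick_arr]
      rw [h]
      congr 1
      rw [succ_iff, and_iff_left this]
  · rintro s₁ fr ⟨hbuf, ha, h⟩ ht
    simp [h7] at h ht
    refine hQ s₁ ⟨fr.v, fr.log⟩ hbuf ha ?_ ?_
    · rw [h]; unfold Fresh; congr
    · have : b * 80 ≤ N * 80 := Nat.mul_le_mul_right _ hb
      omega

open Classical in
theorem wp_visit {s : View} {d b β : ℕ} {X : Finset ℕ} (hV : Fits V G)
    (hs : OnLevel G d X β b s) (hb : b < G.size) (hbX : b ∈ X)
    (hQ : ∀ s' Z, (∀ r < 10, r ≠ 8 → s'.v r = s.v r) → s'.v 8 = (d + 1) * G.size →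
      s'.buffer = [] → G.Stored s'.arr → s'.arr 8 = s.arr 8 →
      (∀ i < (d + 1) * G.size, s'.arr 7 i = s.arr 7 i) →
      (∀ a < G.size, s'.arr 7 ((d + 1) * G.size + a) = ind Z a) →
      IsGreatest {R | R ⊆ X.erase b ∧ G.Closed R} Z →
      s'.arr 10 0 = (if Fresh X Z β b then 1 else 0) →
      (∃ t, s'.log = s.log ++
        [⟨.query, indWord G.size (X.erase b) ++ indWord G.size Z, t⟩]) →
      s'.time ≤ s.time + 1300 * V.size → Q s') : Wp V visit s Q := by
  have hf := V.fits
  have hcard : 1 ≤ X.card := Finset.card_pos.2 ⟨b, hbX⟩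
  have hlev := hs.level
  have hmul : (d + 1) * G.size ≤ G.size * G.size := Nat.mul_le_mul_right _ (by omega)
  have e1 : (d + 1) * G.size = d * G.size + G.size := Nat.succ_mul _ _
  have e2 : (G.size + 2) * (G.size + 2) = G.size * G.size + 4 * G.size + 4 := by ring
  have e3 : (G.size + 1) * (G.size + 1) = G.size * G.size + 2 * G.size + 1 := by ring
  obtain ⟨k1, k2, k3⟩ := hV
  refine .seq (wp_copyArgument (by omega) hs.v3 hs.v6 hs.v7 hb hs.set fun s₁ f₁ b₁ a₁ h9 t₁ => ?_)
  have g3 : s₁.v 3 = G.size := (f₁.v 3 (by norm_num)).trans hs.v3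
  have g6 : s₁.v 6 = d := (f₁.v 6 (by norm_num)).trans hs.v6
  refine .seq (.assign (by norm_num) (by norm_num) (by simp [g3, g6]; omega) ?_)
  refine .seq (wp_limitQuery (G := G) (q := (d + 1) * G.size) (y := X.erase b)
    ⟨by omega, k2, k3⟩ (by omega) (by simp [g3]) (by simp [f₁.v 4, hs.v4])
    (by simp [g3, g6, e1]) (hs.stored.congr fun a ha => a₁ a (by omega)) h9
    ((Finset.erase_subset _ _).trans hs.subset) (b₁.trans hs.buffer) ?_)
  intro s₂ Z f₂ o₂ b₂ h7 hg l₂ t₂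
  have f₂' : ∀ r < 10, r ≠ 8 → s₂.v r = s.v r := fun r hr h8 => by
    rw [f₂ r hr, View.setVar_v, Function.update_of_ne h8, f₁.v r hr]
  have h8' : s₂.v 8 = (d + 1) * G.size := by rw [f₂ 8 (by norm_num)]; simp [g3, g6, e1]
  have hbelow : ∀ i < (d + 1) * G.size, s₂.arr 7 i = s.arr 7 i := fun i hi => by
    rw [o₂.below i hi, View.setVar_arr, a₁ 7 (by norm_num)]
  have h88 : s₂.arr 8 = s.arr 8 := by
    rw [o₂.eq 8 (by norm_num) (by norm_num) (by norm_num), View.setVar_arr, a₁ 8 (by norm_num)]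
  refine wp_testFresh (X := X) (Z := Z) (N := G.size) (d := d) (b := b) (β := β)
    (q := (d + 1) * G.size) (by omega) (by omega) (by omega)
    ((f₂' 3 (by norm_num) (by norm_num)).trans hs.v3)
    ((f₂' 6 (by norm_num) (by norm_num)).trans hs.v6)
    ((f₂' 7 (by norm_num) (by norm_num)).trans hs.v7) h8' hb.le
    (by rw [h88, hs.erased]) (fun a ha => by rw [hbelow _ (by omega), hs.set a ha]) h7 ?_
  intro s₃ f₃ b₃ a₃ h10 t₃
  refine hQ s₃ Z (fun r hr h8 => (f₃.v r hr).trans (f₂' r hr h8))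
    ((f₃.v 8 (by norm_num)).trans h8') (b₃.trans b₂) ?_ ?_ ?_ ?_ hg h10 ⟨s₂.time, ?_⟩ ?_
  · refine (o₂.stored ?_).congr fun a ha => a₃ a (by omega)
    exact hs.stored.congr fun a ha => by simp [a₁ a (by omega)]
  · rw [a₃ 8 (by norm_num), h88]
  · intro i hi; rw [a₃ 7 (by norm_num), hbelow i hi]
  · intro a ha; rw [a₃ 7 (by norm_num), h7 a ha]
  · rw [f₃.log, l₂, View.setVar_log, f₁.log]
  · simp only [View.setVar_time] at t₂
    simp at t₂
    omega

theorem wp_searchLoop_absent {s : View} {d b β : ℕ} {X : Finset ℕ} (hV : Fits V G)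
    (hs : AtLoop V G d X β b s) (hb : b < G.size) (hbX : b ∉ X)
    (hQ : ∀ s', AtLoop V G d X β (b + 1) s' → s'.arr = s.arr → s'.log = s.log →
      Wp V searchLoop s' Q) :
    Wp V searchLoop s Q := by
  have hf := V.fits
  have hlev := hs.level
  have hmul : d * G.size ≤ G.size * G.size := Nat.mul_le_mul_right _ (by omega)
  have e2 : (G.size + 2) * (G.size + 2) = G.size * G.size + 4 * G.size + 4 := by ring
  obtain ⟨k1, k2, k3⟩ := hV
  have hset := hs.set b hb
  rw [ind_of_notMem hbX] at hset
  refine .while_ (by simp) (fun _ => ?_) (fun h => by simp [hs.v9] at h)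
  refine .branch (by simp) (fun _ => ?_) (fun h => ?_)
  · refine .branch (by simp [hs.v3, hs.v6, hs.v7]; omega) (fun h => ?_) (fun _ => ?_)
    · simp [hs.v3, hs.v6, hs.v7, hset] at h
    · refine .assign (by norm_num) (by norm_num) (by simp [hs.v7]; omega) (hQ _ ?_ rfl rfl)
      exact {
        v3 := by simp [hs.v3]
        v4 := by simp [hs.v4]
        v6 := by simp [hs.v6]
        v7 := by simp [hs.v7]
        v9 := by simp [hs.v9]
        stored := hs.stored
        set := hs.set
        erased := hs.erased
        buffer := hs.buffer
        pos_le := hb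
        subset := hs.subset
        level := hs.level
        paced := hs.paced
        time := le_add_mul_of_step hs.time (by simp; omega) (by unfold potential; omega) }
  · simp [hs.v3, hs.v7] at h; omega

theorem wp_searchLoop_query {s : View} {d b β : ℕ} {X Z : Finset ℕ} (hV : Fits V G)
    (hs : AtLoop V G d X β b s) (hb : b < G.size) (hbX : b ∈ X)
    (hZ : IsGreatest {R | R ⊆ X.erase b ∧ G.Closed R} Z)
    (hskip : ∀ s', ¬ Fresh X Z β b → AtLoop V G d X β (b + 1) s' →
      (∀ i < d * G.size, s'.arr 7 i = s.arr 7 i) → s'.arr 8 = s.arr 8 →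
      entries s'.log = entries s.log ++ [encode G.size (.query (X.erase b) Z)] →
      Wp V searchLoop s' Q)
    (hrec : ∀ s', Fresh X Z β b → AtLoop V G (d + 1) Z b 0 s' →
      (∀ i < (d + 1) * G.size, s'.arr 7 i = s.arr 7 i) → (∀ i ≤ d, s'.arr 8 i = s.arr 8 i) →
      entries s'.log = entries s.log ++
        [encode G.size (.query (X.erase b) Z), encode G.size (.output Z)] → Wp V searchLoop s' Q) :
    Wp V searchLoop s Q := by
  classical
  have hf := V.fits
  have hlev := hs.level
  have hcard : 1 ≤ X.card := Finset.card_pos.2 ⟨b, hbX⟩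
  have hmul : (d + 1) * G.size ≤ G.size * G.size := Nat.mul_le_mul_right _ (by omega)
  have e1 : (d + 1) * G.size = d * G.size + G.size := Nat.succ_mul _ _
  have e2 : (G.size + 2) * (G.size + 2) = G.size * G.size + 4 * G.size + 4 := by ring
  have hset := hs.set b hb
  rw [ind_of_mem hbX] at hset
  obtain ⟨k1, k2, k3⟩ := id hV
  refine .while_ (by simp) (fun _ => ?_) (fun h => by simp [hs.v9] at h)
  refine .branch (by simp) (fun _ => ?_) (fun h => ?_)
  swap
  · simp [hs.v3, hs.v7] at h; omega
  refine .branch (by simp [hs.v3, hs.v6, hs.v7]; omega) (fun _ => ?_) (fun h => ?_)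
  swap
  · simp [hs.v3, hs.v6, hs.v7, hset] at h
  refine .seq (wp_visit hV (((hs.toOnLevel.tick _).tick _).tick _) hb hbX ?_)
  intro s₁ Z' f₁ h8 b₁ st₁ a8 below h7 hg h10 ⟨t, l₁⟩ t₁
  obtain rfl := hZ.unique hg
  simp only [View.tick_arr, View.tick_log, View.tick_v] at f₁ a8 below l₁
  simp at t₁
  have g3 : s₁.v 3 = G.size := (f₁ 3 (by norm_num) (by norm_num)).trans hs.v3
  have g4 : s₁.v 4 = G.obls := (f₁ 4 (by norm_num) (by norm_num)).trans hs.v4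
  have g6 : s₁.v 6 = d := (f₁ 6 (by norm_num) (by norm_num)).trans hs.v6
  have g7 : s₁.v 7 = b := (f₁ 7 (by norm_num) (by norm_num)).trans hs.v7
  have g9 : s₁.v 9 = 1 := (f₁ 9 (by norm_num) (by norm_num)).trans hs.v9
  have hlast : lastOutput s₁.log = lastOutput s.log := by
    rw [l₁, lastOutput, outputTimes_append_query, lastOutput]
  have hpaced : Paced (3000 * V.size * ((G.size + 2) * (G.size + 2))) s₁.log := by
    rw [l₁, Paced, outputTimes_append_query]; exact hs.paced
  have hent : entries s₁.log = entries s.log ++ [encode G.size (.query (X.erase b) Z)] := by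
    rw [l₁, entries_append]; rfl
  refine .branch (by simp; omega) (fun h => ?_) (fun h => ?_)
  · have hF : Fresh X Z β b := by
      by_contra hF
      rw [if_neg hF] at h10
      exact h h10
    have hZc : Z.card < X.card :=
      (Finset.card_le_card hZ.1.1).trans_lt (Finset.card_erase_lt_of_mem hbX)
    refine .seq (.assign (by norm_num) (by norm_num) (by simp [g6]; omega) ?_)
    refine .seq (.put (by norm_num) (by simp) (by simp [g6]; omega) (by simp) ?_)
    refine .seq (wp_emitSet (q := (d + 1) * G.size) (N := G.size) (Z := Z) (by omega)
      (by simp [g3]) (by simp [h8]) (fun a ha => by simp [h7 a ha]) ?_)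
    intro s₂ f₂ a₂ b₂ t₂
    refine .seq (.finish (.assign (by norm_num) (by norm_num) (by simp) (hrec _ hF ?_ ?_ ?_ ?_)))
    · have ht : s₂.time + 1 ≤
          lastOutput s.log + 3000 * V.size * ((G.size + 2) * (G.size + 2)) := by
        have p1 := Nat.mul_le_mul_left (2000 * V.size) (potential_le (N := G.size) (d := d) hb.le)
        have p2 : 1000 * V.size * 4 ≤ 1000 * V.size * ((G.size + 2) * (G.size + 2)) :=
          Nat.mul_le_mul_left _ (by omega)
        have p3 : 3000 * V.size * ((G.size + 2) * (G.size + 2)) =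
          2000 * V.size * ((G.size + 2) * (G.size + 2)) +
          1000 * V.size * ((G.size + 2) * (G.size + 2)) := by ring
        have p4 := hs.time
        simp at t₂
        omega
      refine { v3 := ?_, v4 := ?_, v6 := ?_, v7 := ?_, v9 := ?_, stored := ?_, set := ?_
               erased := ?_, buffer := ?_, pos_le := ?_, subset := ?_, level := ?_
               paced := ?_, time := ?_ }
      · simp [f₂.v 3, g3]
      · simp [f₂.v 4, g4]
      · simp [f₂.v 6, g6]
      · simp
      · simp [f₂.v 9, g9]
      · refine st₁.congr fun a ha => ?_
        simp [a₂, Function.update_of_ne (show a ≠ 8 by omega)]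
      · intro a ha; simp [a₂, h7 a ha]
      · simp [a₂, g6, g7]
      · rfl
      · omega
      · exact hZ.1.1.trans ((Finset.erase_subset _ _).trans hs.subset)
      · omega
      · simp only [View.setVar_log, View.close_log, f₂.log, View.setArr_log]
        exact hpaced.output _ (by rw [hlast]; exact ht)
      · have : lastOutput (((s₂.close .output).setVar 7 (Expr.eval V (s₂.close .output) 0)
            ((0 : Expr).cost + 2)).log) = s₂.time + 1 := by
          simp only [View.setVar_log, View.close_log, lastOutput, outputTimes_append_output]
          simp
        rw [this]
        have p2 : 2000 * V.size * 1 ≤ 2000 * V.size * potential G.size (d + 1) 0 :=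
          Nat.mul_le_mul_left _ (by unfold potential; omega)
        simp; omega
    · intro i hi; simp [a₂, below i hi]
    · intro i hi
      simp [a₂, g6, g7, Function.update_of_ne (show i ≠ d + 1 by omega), a8]
    · simp only [View.setVar_log, View.close_log, f₂.log, View.setArr_log, entries_append, hent, b₂,
        View.setVar_buffer, View.setArr_buffer, View.tick_buffer, View.tick_log, b₁]
      simp [entries, encode]
  · have hF : ¬ Fresh X Z β b := by
      intro hF
      rw [if_pos hF] at h10
      simp [h10] at h
    refine .assign (by norm_num) (by norm_num) (by simp [g7]; omega) (hskip _ hF ?_ ?_ ?_ hent)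
    · exact {
        v3 := by simp [g3]
        v4 := by simp [g4]
        v6 := by simp [g6]
        v7 := by simp [g7]
        v9 := by simp [g9]
        stored := st₁
        set := fun a ha => (below _ (by omega)).trans (hs.set a ha)
        erased := by simp [a8, hs.erased]
        buffer := b₁
        pos_le := hb
        subset := hs.subset
        level := hs.level
        paced := hpaced
        time := by
          simp only [View.setVar_log, View.tick_log, hlast]
          exact le_add_mul_of_step hs.time (by simp; omega) (by unfold potential; omega) }
    · intro i hi; simp [below i (by omega)]
    · simp [a8]

/-- At the end of the for-loop at level `d + 1`, the search goes on at the next position of level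
`d`. -/
theorem wp_searchLoop_pop {s : View} {d b β : ℕ} {X Z : Finset ℕ} (hV : Fits V G)
    (hs : AtLoop V G (d + 1) Z b G.size s) (hb : b < G.size)
    (hX : ∀ a < G.size, s.arr 7 (d * G.size + a) = ind X a) (hβ : s.arr 8 d = β)
    (hXN : X ⊆ Finset.range G.size) (hlev : d + X.card ≤ G.size)
    (hQ : ∀ s', AtLoop V G d X β (b + 1) s' → s'.arr = s.arr → s'.log = s.log →
      Wp V searchLoop s' Q) :
    Wp V searchLoop s Q := by
  have hf := V.fits
  have e2 : (G.size + 2) * (G.size + 2) = G.size * G.size + 4 * G.size + 4 := by ring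
  obtain ⟨k1, k2, k3⟩ := id hV
  have hd := hs.level
  refine .while_ (by simp) (fun _ => ?_) (fun h => by simp [hs.v9] at h)
  refine .branch (by simp) (fun h => ?_) (fun _ => ?_)
  · simp [hs.v3, hs.v7] at h
  refine .branch (by simp) (fun _ => ?_) (fun h => ?_)
  swap
  · simp [hs.v6] at h
  refine .seq (.assign (by norm_num) (by norm_num) (by simp [hs.v6, hs.erased]; omega) ?_)
  refine .assign (by norm_num) (by norm_num) (by simp) (hQ _ ?_ rfl rfl)
  exact {
    v3 := by simp [hs.v3]
    v4 := by simp [hs.v4]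
    v6 := by simp [hs.v6]
    v7 := by simp [hs.v6, hs.erased]
    v9 := by simp [hs.v9]
    stored := hs.stored
    set := hX
    erased := hβ
    buffer := hs.buffer
    pos_le := hb
    subset := hXN
    level := hlev
    paced := hs.paced
    time := le_add_mul_of_step hs.time (by simp; omega) (potential_pop (by omega)) }

/-- The loop executes the for-loop of the algorithm, whose frame is at level `d` of the stack. -/
theorem wp_searchLoop_of_trace (hV : Fits V G) {X : Finset ℕ} {β b : ℕ}
    {tr : List (Event (Finset ℕ))} (h : Trace G.size G.Closed X β b tr) :
    ∀ (d : ℕ) (s : View) (Q : View → Prop), AtLoop V G d X β b s →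
      (∀ s', AtLoop V G d X β G.size s' → (∀ i < d * G.size, s'.arr 7 i = s.arr 7 i) →
        (∀ i < d, s'.arr 8 i = s.arr 8 i) →
        entries s'.log = entries s.log ++ tr.map (encode G.size) → Wp V searchLoop s' Q) →
      Wp V searchLoop s Q := by
  induction h with
  | done =>
    intro d s Q hs hQ
    exact hQ s hs (fun _ _ => rfl) (fun _ _ => rfl) (by simp)
  | @absent X β b tr hb hX h ih =>
    intro d s Q hs hQ
    refine wp_searchLoop_absent hV hs hb hX fun s₁ hs₁ a₁ l₁ => ?_
    refine ih d s₁ Q hs₁ fun s₂ hs₂ a₂ b₂ l₂ => hQ s₂ hs₂ (fun i hi => ?_) (fun i hi => ?_) ?_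
    · rw [a₂ i hi, a₁]
    · rw [b₂ i hi, a₁]
    · rw [l₂, l₁]
  | @skip X β b Z tr hb hX hZ ht h ih =>
    intro d s Q hs hQ
    refine wp_searchLoop_query hV hs hb hX hZ (fun s₁ _ hs₁ a₁ b₁ l₁ => ?_)
      (fun s₁ hF => absurd hF ht)
    refine ih d s₁ Q hs₁ fun s₂ hs₂ a₂ b₂ l₂ => hQ s₂ hs₂ (fun i hi => ?_) (fun i hi => ?_) ?_
    · rw [a₂ i hi, a₁ i hi]
    · rw [b₂ i hi, b₁]
    · simp [l₂, l₁]
  | @recurse X β b Z tr₁ tr₂ hb hX hZ ht h₁ h₂ ih₁ ih₂ =>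
    intro d s Q hs hQ
    have e1 : (d + 1) * G.size = d * G.size + G.size := Nat.succ_mul _ _
    refine wp_searchLoop_query hV hs hb hX hZ (fun s₁ hF => absurd ht hF)
      (fun s₁ _ hs₁ a₁ b₁ l₁ => ?_)
    refine ih₁ (d + 1) s₁ Q hs₁ fun s₂ hs₂ a₂ b₂ l₂ => ?_
    have a₂' : ∀ i < (d + 1) * G.size, s₂.arr 7 i = s.arr 7 i := fun i hi => by
      rw [a₂ i hi, a₁ i hi]
    have b₂' : ∀ i ≤ d, s₂.arr 8 i = s.arr 8 i := fun i hi => by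
      rw [b₂ i (by omega), b₁ i hi]
    refine wp_searchLoop_pop (X := X) hV hs₂ hb
      (fun a ha => (a₂' _ (by omega)).trans (hs.set a ha))
      ((b₂' d le_rfl).trans hs.erased) hs.subset hs.level fun s₃ hs₃ a₃ l₃ => ?_
    refine ih₂ d s₃ Q hs₃ fun s₄ hs₄ a₄ b₄ l₄ => hQ s₄ hs₄ (fun i hi => ?_) (fun i hi => ?_) ?_
    · rw [a₄ i hi, a₃, a₂' i (by omega)]
    · rw [b₄ i hi, a₃, b₂' i hi.le]
    · simp [l₄, l₃, l₂, l₁]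

/-- The whole program, after the base address of the arrays has been determined. -/
def enumerate : Prog :=
  buildObligations ;;
  forUp 10 3 (put 9 (.var 10) 1) ;;
  assign 8 0 ;; limitQuery ;; emitSet ;; .finish .output ;;
  assign 6 0 ;; assign 7 0 ;; assign 9 1 ;;
  searchLoop

/-- The program reports the limit of the set of all nodes, and then the events of the search. -/
theorem wp_enumerate {A : TransitionTable} {s : View} {Z : Finset ℕ}
    {tr : List (Event (Finset ℕ))} (hV : Reads V A) (hF : Fits V A.obligations)
    (hZ : IsGreatest {R | R ⊆ Finset.range A.obligations.size ∧ A.obligations.Closed R} Z)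
    (h : Trace A.obligations.size A.obligations.Closed Z 0 0 tr)
    (h0 : s.v 0 = A.states) (h1 : s.v 1 = A.trans) (hz : ∀ a i, s.arr a i = 0)
    (hb : s.buffer = []) (hl : s.log = []) (ht : s.time ≤ 2) :
    Wp V enumerate s fun s' =>
      entries s'.log = (Event.query (Finset.range A.obligations.size) Z ::
        .output Z :: tr).map (encode A.obligations.size) ∧
      List.IsChain (fun t t' => t' ≤ t + 3000 * V.size *
        ((A.obligations.size + 2) * (A.obligations.size + 2)))
        (0 :: (outputTimes s'.log ++ [s'.time])) := by
  generalize hG : A.obligations = G at *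
  have hf := V.fits
  have e2 : (G.size + 2) * (G.size + 2) = G.size * G.size + 4 * G.size + 4 := by ring
  have e3 : (G.size + 1) * (G.size + 1) = G.size * G.size + 2 * G.size + 1 := by ring
  obtain ⟨k1, k2, k3⟩ := id hF
  have four : 1000 * V.size * 4 ≤ 1000 * V.size * ((G.size + 2) * (G.size + 2)) :=
    Nat.mul_le_mul_left _ (by omega)
  have three : 3000 * V.size * ((G.size + 2) * (G.size + 2)) =
    2000 * V.size * ((G.size + 2) * (G.size + 2)) +
    1000 * V.size * ((G.size + 2) * (G.size + 2)) := by ring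
  refine .seq (wp_buildObligations hV h0 h1 hz ?_)
  rw [hG]
  intro s₁ l₁ b₁ g3 g4 st₁ a₁ t₁
  refine .seq (.forUp (by norm_num) (by norm_num) (by norm_num)
    (fun k arr buf => buf = [] ∧ (∀ a ≠ 9, arr a = s₁.arr a) ∧ ∀ a < k, arr 9 a = 1) 40
    ⟨b₁.trans hb, fun _ _ => rfl, by simp⟩ ?_ ?_)
  · rintro k hk s₂ fr h10 ⟨hbuf, ha, h9⟩
    refine .put (by norm_num) (by simp) (by simp [h10]; omega) (by simp)
      ⟨⟨fun _ _ => rfl, rfl⟩, ⟨hbuf, fun a h => ?_, fun a h => ?_⟩, by simp⟩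
    · simp [Function.update_of_ne h, ha a h]
    · rcases Nat.lt_succ_iff_lt_or_eq.1 h with h' | rfl
      · simp [h10, h'.ne, h9 a h']
      · simp [h10]
  rintro s₂ f₂ ⟨b₂, a₂, h9⟩ t₂
  rw [g3] at h9 t₂
  refine .seq (.assign (by norm_num) (by norm_num) (by simp) ?_)
  refine .seq (wp_limitQuery (G := G) (q := 0) (y := Finset.range G.size)
    ⟨by omega, k2, k3⟩ (by omega) (by simp [f₂.v 3, g3]) (by simp [f₂.v 4, g4]) (by simp)
    (st₁.congr fun a ha => a₂ a (by omega))
    (fun a ha => by simp [h9 a ha, ind_of_mem (Finset.mem_range.2 ha)]) subset_rfl b₂ ?_)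
  intro s₃ Z' f₃ o₃ b₃ h7 hg l₃ t₃
  obtain rfl := hZ.unique hg
  have f₃' : ∀ r < 10, r ≠ 8 → s₃.v r = s₁.v r := fun r hr h8 => by
    rw [f₃ r hr, View.setVar_v, Function.update_of_ne h8, f₂.v r hr]
  have h3 : s₃.v 3 = G.size := (f₃' 3 (by norm_num) (by norm_num)).trans g3
  have h4 : s₃.v 4 = G.obls := (f₃' 4 (by norm_num) (by norm_num)).trans g4
  have h8 : s₃.v 8 = 0 := by rw [f₃ 8 (by norm_num)]; simp
  have hst : G.Stored s₃.arr := o₃.stored (st₁.congr fun a ha => a₂ a (by omega))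
  have h80 : s₃.arr 8 0 = 0 := by
    rw [o₃.eq 8 (by norm_num) (by norm_num) (by norm_num), View.setVar_arr, a₂ 8 (by norm_num), a₁]
  refine .seq (wp_emitSet (q := 0) (N := G.size) (Z := Z) (by omega) h3 h8 h7 ?_)
  intro s₄ f₄ a₄ b₄ t₄
  rw [View.setVar_log, f₂.log, l₁, hl] at l₃
  simp at t₂ t₃
  have hcard : Z.card ≤ G.size := by simpa using Finset.card_le_card hZ.1.1
  refine .seq (.finish ?_)
  refine .seq (.assign (by norm_num) (by norm_num) (by simp) ?_)
  refine .seq (.assign (by norm_num) (by norm_num) (by simp) ?_)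
  refine .seq (.assign (by norm_num) (by norm_num) (by simp) ?_)
  refine wp_searchLoop_of_trace hF h 0 _ _ ?_ ?_
  · refine { v3 := ?_, v4 := ?_, v6 := ?_, v7 := ?_, v9 := ?_, stored := ?_, set := ?_
             erased := ?_, buffer := ?_, pos_le := ?_, subset := ?_, level := ?_
             paced := ?_, time := ?_ }
    · simp [f₄.v 3, h3]
    · simp [f₄.v 4, h4]
    · simp
    · simp
    · simp
    · simpa [a₄] using hst
    · simpa [a₄] using h7
    · simpa [a₄] using h80
    · rfl
    · omega
    · exact hZ.1.1
    · omega
    · simp [f₄.log, l₃, Paced, outputTimes]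
      omega
    · have p2 : 2000 * V.size * 1 ≤ 2000 * V.size * potential G.size 0 0 :=
        Nat.mul_le_mul_left _ (by unfold potential; omega)
      simp [f₄.log, l₃, lastOutput, outputTimes]
      omega
  · intro s₅ hs₅ _ _ l₅
    refine .while_ (by simp) (fun _ => ?_) (fun h => by simp [hs₅.v9] at h)
    refine .branch (by simp) (fun h => ?_) (fun _ => ?_)
    · simp [hs₅.v3, hs₅.v7] at h
    refine .branch (by simp) (fun h => ?_) (fun _ => ?_)
    · simp [hs₅.v6] at h
    refine .assign (by norm_num) (by norm_num) (by simp) ?_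
    refine .while_ (by simp) (fun h => by simp at h) (fun _ => ⟨?_, ?_⟩)
    · simp only [View.tick_log, View.setVar_log, l₅]
      simp [f₄.log, l₃, b₄, b₃, entries, encode]
    · refine (isChain_concat _ _ _).2 ⟨hs₅.paced, ?_⟩
      have p1 := Nat.mul_le_mul_left (2000 * V.size)
        (potential_le (N := G.size) (d := 0) (le_refl G.size))
      have p4 := hs₅.time
      unfold lastOutput at p4
      simp
      simp at p4
      omega

end RAM

/-! ### Limits and largest fixed points -/

namespace Obligations

variable (G : Obligations)

theorem exists_isGreatest_closed (y : Finset ℕ) : ∃ Z, IsGreatest {R | R ⊆ y ∧ G.Closed R} Z := by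
  classical
  refine ⟨(y.powerset.filter G.Closed).sup id, ⟨?_, ?_⟩, ?_⟩
  · refine Finset.sup_le fun R hR => ?_
    exact Finset.mem_powerset.1 (Finset.mem_filter.1 hR).1
  · intro a ha o ho hn
    obtain ⟨R, hR, haR⟩ := Finset.mem_sup.1 ha
    obtain ⟨h, hh, h1, h2⟩ := (Finset.mem_filter.1 hR).2 a haR o ho hn
    exact ⟨h, hh, h1, Finset.mem_sup.2 ⟨R, hR, h2⟩⟩
  · rintro R ⟨h1, h2⟩
    exact Finset.le_sup (f := id) (Finset.mem_filter.2 ⟨Finset.mem_powerset.2 h1, h2⟩)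

end Obligations

namespace FixEnum

/-- On a finite order, the iterates of a decreasing isotone map on `y` reach the largest fixed point
below `y`. -/
theorem isLimit_of_isGreatest {L : Type*} [PartialOrder L] [Finite L] {f : L → L}
    (hf : Monotone f) (hd : ∀ x, f x ≤ x) {y z : L}
    (hz : IsGreatest {x | x ≤ y ∧ f x = x} z) : IsLimit f y z := by
  have anti : Antitone fun t => f^[t] y := antitone_nat_of_succ_le fun t => by
    rw [Function.iterate_succ_apply']; exact hd _
  obtain ⟨N, hN⟩ := WellFoundedLT.antitone_chain_condition anti
  have hN' : ∀ t, N ≤ t → f^[t] y = f^[N] y := fun t ht => (hN t ht).symm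
  have hfix : f (f^[N] y) = f^[N] y := by
    rw [← Function.iterate_succ_apply' f]; exact hN' _ (Nat.le_succ N)
  refine ⟨N, fun t ht => ?_⟩
  rw [hN' t ht]
  refine le_antisymm (hz.2 ⟨anti (Nat.zero_le N), hfix⟩) ?_
  have := hf.iterate N hz.1.1
  rwa [Function.iterate_fixed hz.1.2] at this

end FixEnum

namespace LTS

variable {S Λ : Type*} (A : LTS S Λ)

theorem monotone_bisimMap : Monotone A.bisimMap := by
  rintro R R' h x ⟨hx, h1, h2⟩
  refine ⟨h hx, fun a p' hp => ?_, fun a q' hq => ?_⟩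
  · obtain ⟨q', hq, hR⟩ := h1 a p' hp
    exact ⟨q', hq, h hR⟩
  · obtain ⟨p', hp, hR⟩ := h2 a q' hq
    exact ⟨p', hp, h hR⟩

theorem bisimMap_le (R : Set (S × S)) : A.bisimMap R ≤ R := fun _ hx => hx.1

theorem isFixedPt_bisimMap_iff (R : Set (S × S)) :
    Function.IsFixedPt A.bisimMap R ↔ A.IsBisimulation R := by
  constructor
  · intro h p q hpq
    rw [← h.eq] at hpq
    exact hpq.2
  · intro h
    exact (A.bisimMap_le R).antisymm fun x hx => ⟨hx, h x.1 x.2 hx⟩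

end LTS

/-! ### Bisimulations as closed sets of positions -/

namespace TransitionTable

variable (A : TransitionTable)

/-- A set of positions of pairs of states is closed if it satisfies the transfer conditions. -/
theorem closed_obligations_iff {Z : Finset ℕ} (hZ : Z ⊆ Finset.range (A.states * A.states)) :
    A.obligations.Closed Z ↔ ∀ t < A.trans, ∀ q < A.states,
      (A.src t * A.states + q ∈ Z → ∃ t' < A.trans, A.src t' = q ∧ A.lab t = A.lab t' ∧
        A.tgt t * A.states + A.tgt t' ∈ Z) ∧
      (q * A.states + A.src t ∈ Z → ∃ t' < A.trans, A.src t' = q ∧ A.lab t' = A.lab t ∧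
        A.tgt t' * A.states + A.tgt t ∈ Z) := by
  have digits : ∀ {t t' q q' : ℕ}, q < A.states → q' < A.states →
      t * A.states + q = t' * A.states + q' → t = t' ∧ q = q' := by
    intro t t' q q' hq hq' h
    have h1 := congrArg (· / A.states) h
    have h2 := congrArg (· % A.states) h
    have hn : 0 < A.states := by omega
    simp only [mul_comm _ A.states, Nat.mul_add_div hn, Nat.div_eq_of_lt hq,
      Nat.div_eq_of_lt hq', Nat.mul_add_mod, Nat.mod_eq_of_lt hq, Nat.mod_eq_of_lt hq'] at h1 h2
    exact ⟨by simpa using h1, h2⟩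
  have divmod : ∀ {t q d : ℕ}, q < d → (t * d + q) / d = t ∧ (t * d + q) % d = q := by
    intro t q d hq
    have hn : 0 < d := by omega
    rw [mul_comm, Nat.mul_add_div hn, Nat.div_eq_of_lt hq, Nat.mul_add_mod, Nat.mod_eq_of_lt hq]
    simp
  have keyZ : ∀ h, A.obligations.key h ∈ Z → A.lab (h / 2 / A.trans) = A.lab (h / 2 % A.trans) ∧
      A.tgt (h / 2 / A.trans) * A.states + A.tgt (h / 2 % A.trans) ∈ Z := by
    intro h hh
    simp only [TransitionTable.obligations] at hh
    split_ifs at hh with hl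
    · exact ⟨hl, hh⟩
    · exact absurd (Finset.mem_range.1 (hZ hh)) (lt_irrefl _)
  constructor
  · intro hc t ht q hq
    have hlt := mul_add_lt_mul_of_lt ht hq
    obtain ⟨d1, d2⟩ := divmod (t := t) hq
    refine ⟨fun hm => ?_, fun hm => ?_⟩
    · obtain ⟨h, hh, ho, hk⟩ := hc _ hm (t * A.states + q)
        (by show _ < 2 * (A.trans * A.states); omega)
        (by simp only [obligations]; rw [if_pos hlt, d1, d2])
      have hh' : h < 2 * (A.trans * A.trans) := hh
      obtain ⟨hl, hk⟩ := keyZ h hk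
      have hm0 : 0 < A.trans := by omega
      have h1 : h / 2 / A.trans < A.trans := (Nat.div_lt_iff_lt_mul hm0).2 (by omega)
      have h2 : h / 2 % A.trans < A.trans := Nat.mod_lt _ hm0
      simp only [obligations] at ho
      split_ifs at ho
      · obtain ⟨e1, e2⟩ := digits (A.src_lt _ h2) hq ho
        rw [e1] at hl hk
        exact ⟨_, h2, e2, hl, hk⟩
      · omega
    · obtain ⟨h, hh, ho, hk⟩ := hc _ hm (A.trans * A.states + (t * A.states + q))
        (by show _ < 2 * (A.trans * A.states); omega)
        (by simp only [obligations]; rw [if_neg (by omega), Nat.add_sub_cancel_left, d1, d2])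
      have hh' : h < 2 * (A.trans * A.trans) := hh
      obtain ⟨hl, hk⟩ := keyZ h hk
      have hm0 : 0 < A.trans := by omega
      have h1 : h / 2 / A.trans < A.trans := (Nat.div_lt_iff_lt_mul hm0).2 (by omega)
      have h2 : h / 2 % A.trans < A.trans := Nat.mod_lt _ hm0
      have h3 := mul_add_lt_mul_of_lt h1 (A.src_lt _ h2)
      simp only [obligations] at ho
      split_ifs at ho
      · omega
      · obtain ⟨e1, e2⟩ := digits (A.src_lt _ h1) hq (Nat.add_left_cancel ho)
        rw [e1] at hl hk
        exact ⟨_, h1, e2, hl, hk⟩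
  · intro H a ha o ho hn
    have ho' : o < 2 * (A.trans * A.states) := ho
    have hs0 : 0 < A.states := by
      rcases Nat.eq_zero_or_pos A.states with h | h
      · simp [h] at ho'
      · exact h
    have enc : ∀ t < A.trans, ∀ t' < A.trans, ∀ i < 2,
        2 * (t * A.trans + t') + i < 2 * (A.trans * A.trans) ∧
        (2 * (t * A.trans + t') + i) / 2 / A.trans = t ∧
        (2 * (t * A.trans + t') + i) / 2 % A.trans = t' := by
      intro t ht t' ht' i hi
      have h1 := mul_add_lt_mul_of_lt ht ht'
      have h2 : (2 * (t * A.trans + t') + i) / 2 = t * A.trans + t' := by omega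
      rw [h2]
      exact ⟨by omega, divmod ht'⟩
    have hq := Nat.mod_lt o hs0
    simp only [obligations] at hn
    split_ifs at hn with hlt
    · have ht : o / A.states < A.trans := (Nat.div_lt_iff_lt_mul hs0).2 hlt
      obtain ⟨t', ht', e1, e2, e3⟩ := (H _ ht _ hq).1 (hn ▸ ha)
      obtain ⟨f1, f2, f3⟩ := enc _ ht _ ht' 0 (by omega)
      refine ⟨_, f1, ?_, ?_⟩
      · simp only [obligations]
        rw [if_pos (by omega), f2, f3, e1, mul_comm, Nat.div_add_mod]
      · simp only [obligations]
        rw [f2, f3, if_pos e2]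
        exact e3
    · have ht : (o - A.trans * A.states) / A.states < A.trans :=
        (Nat.div_lt_iff_lt_mul hs0).2 (by omega)
      have hq' := Nat.mod_lt (o - A.trans * A.states) hs0
      obtain ⟨t', ht', e1, e2, e3⟩ := (H _ ht _ hq').2 (hn ▸ ha)
      obtain ⟨f1, f2, f3⟩ := enc _ ht' _ ht 1 (by omega)
      refine ⟨_, f1, ?_, ?_⟩
      · simp only [obligations]
        rw [if_neg (by omega), f2, f3, e1, mul_comm _ A.states, mul_comm _ A.states,
          Nat.div_add_mod, mul_comm A.states]
        omega
      · simp only [obligations]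
        rw [f2, f3, if_pos e2]
        exact e3

end TransitionTable

namespace LTS.Presentation

variable {S Λ : Type*} {A : LTS S Λ} {n : ℕ} (E : A.Presentation n)

theorem getD_flatMap_triple {α : Type*} (l : List α) (f g h : α → ℕ) (t : ℕ) (ht : t < l.length) :
    (l.flatMap fun x => [f x, g x, h x]).getD (3 * t) 0 = f l[t] ∧
    (l.flatMap fun x => [f x, g x, h x]).getD (3 * t + 1) 0 = g l[t] ∧
    (l.flatMap fun x => [f x, g x, h x]).getD (3 * t + 2) 0 = h l[t] := by
  induction l generalizing t with
  | nil => simp at ht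
  | cons x l ih =>
    cases t with
    | zero => simp
    | succ t =>
      have := ih t (by simpa using ht)
      rw [show 3 * (t + 1) = 3 * t + 1 + 1 + 1 by ring]
      simpa using this

theorem length_inputWord : E.inputWord.length = 3 * E.list.length := by
  simp [inputWord, mul_comm]

theorem inputWord_getD (t : ℕ) (ht : t < E.list.length) :
    E.inputWord.getD (3 * t) 0 = E.num E.list[t].1 ∧
    E.inputWord.getD (3 * t + 1) 0 = E.lab E.list[t].2.1 ∧
    E.inputWord.getD (3 * t + 2) 0 = E.num E.list[t].2.2 :=
  getD_flatMap_triple E.list (fun t => (E.num t.1 : ℕ)) (fun t => E.lab t.2.1)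
    (fun t => (E.num t.2.2 : ℕ)) t ht

/-- The numbers in the input of the machine. -/
def table : TransitionTable where
  states := n
  trans := E.list.length
  src t := E.inputWord.getD (3 * t) 0
  lab t := E.inputWord.getD (3 * t + 1) 0
  tgt t := E.inputWord.getD (3 * t + 2) 0
  src_lt t ht := by rw [(E.inputWord_getD t ht).1]; exact Fin.is_lt _
  tgt_lt t ht := by rw [(E.inputWord_getD t ht).2.2]; exact Fin.is_lt _

/-- The position of a pair in the characteristic words of relations. -/
def pos (x : S × S) : ℕ := E.num x.1 * n + E.num x.2

theorem pos_lt (x : S × S) : E.pos x < n * n :=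
  mul_add_lt_mul_of_lt (Fin.is_lt _) (Fin.is_lt _)

theorem exists_pos_eq {a : ℕ} (ha : a < n * n) : ∃ x, E.pos x = a := by
  have hn : 0 < n := by
    rcases Nat.eq_zero_or_pos n with h | h
    · simp [h] at ha
    · exact h
  refine ⟨(E.num.symm ⟨a / n, (Nat.div_lt_iff_lt_mul hn).2 ha⟩,
    E.num.symm ⟨a % n, Nat.mod_lt _ hn⟩), ?_⟩
  simp only [pos, Equiv.apply_symm_apply]
  rw [mul_comm, Nat.div_add_mod]

theorem pos_injective : Function.Injective E.pos := by
  rintro ⟨p, q⟩ ⟨p', q'⟩ h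
  have hn : 0 < n := (E.num p).pos
  simp only [pos] at h
  have h1 := congrArg (· / n) h
  have h2 := congrArg (· % n) h
  simp only [mul_comm _ n, Nat.mul_add_div hn, Nat.div_eq_of_lt (Fin.is_lt _), Nat.mul_add_mod,
    Nat.mod_eq_of_lt (Fin.is_lt _), add_zero] at h1 h2
  rw [E.num.injective (Fin.ext h1), E.num.injective (Fin.ext h2)]

/-- The relation that consists of the pairs with positions in `Z`. -/
def toRel (Z : Finset ℕ) : Set (S × S) := {x | E.pos x ∈ Z}

@[simp] theorem mem_toRel {Z : Finset ℕ} {x : S × S} : x ∈ E.toRel Z ↔ E.pos x ∈ Z := Iff.rfl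

theorem toRel_subset_iff {Z Z' : Finset ℕ} (hZ : Z ⊆ Finset.range (n * n)) :
    E.toRel Z ≤ E.toRel Z' ↔ Z ⊆ Z' := by
  constructor
  · intro h a ha
    obtain ⟨x, rfl⟩ := E.exists_pos_eq (Finset.mem_range.1 (hZ ha))
    exact h ha
  · exact fun h x hx => h hx

theorem exists_toRel_eq (R : Set (S × S)) : ∃ Z ⊆ Finset.range (n * n), E.toRel Z = R := by
  classical
  refine ⟨(Finset.range (n * n)).filter fun a => ∃ x ∈ R, E.pos x = a, Finset.filter_subset _ _, ?_⟩
  ext x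
  simp only [mem_toRel, Finset.mem_filter, Finset.mem_range]
  constructor
  · rintro ⟨_, y, hy, h⟩
    rwa [← E.pos_injective h]
  · exact fun h => ⟨E.pos_lt x, x, h, rfl⟩

theorem toRel_range : E.toRel (Finset.range (n * n)) = ⊤ := by
  ext x; simp [E.pos_lt]

theorem relWord_toRel (Z : Finset ℕ) : relWord E.num (E.toRel Z) = indWord (n * n) Z := by
  classical
  have key : ∀ k (g : ℕ → ℕ), ((List.range k).flatMap fun i => (List.range n).map fun j =>
      g (i * n + j)) = (List.range (k * n)).map g := by
    intro k g
    induction k with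
    | zero => simp
    | succ k ih =>
      rw [List.range_succ, List.flatMap_append, ih, Nat.succ_mul, List.range_add]
      simp [Function.comp_def]
  rw [indWord, ← key, relWord, List.range_eq_range', ← List.range_eq_range',
    ← List.map_coe_finRange_eq_range, List.flatMap_map]
  congr 1
  funext i
  rw [List.map_map]
  refine List.map_congr_left fun j _ => ?_
  simp [ind, pos]

theorem closed_iff_isBisimulation {Z : Finset ℕ} (hZ : Z ⊆ Finset.range (n * n)) :
    E.table.obligations.Closed Z ↔ A.IsBisimulation (E.toRel Z) := by
  rw [E.table.closed_obligations_iff hZ]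
  have src : ∀ t (ht : t < E.list.length), E.table.src t = E.num E.list[t].1 :=
    fun t ht => (E.inputWord_getD t ht).1
  have lab : ∀ t (ht : t < E.list.length), E.table.lab t = E.lab E.list[t].2.1 :=
    fun t ht => (E.inputWord_getD t ht).2.1
  have tgt : ∀ t (ht : t < E.list.length), E.table.tgt t = E.num E.list[t].2.2 :=
    fun t ht => (E.inputWord_getD t ht).2.2
  have hlab : ∀ t (ht : t < E.list.length) t' (ht' : t' < E.list.length),
      E.table.lab t = E.table.lab t' → E.list[t].2.1 = E.list[t'].2.1 := by
    intro t ht t' ht' h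
    rw [lab t ht, lab t' ht'] at h
    exact E.lab_inj _ (List.getElem_mem ht) _ (List.getElem_mem ht') h
  have htr : ∀ t (ht : t < E.list.length),
      A.trans E.list[t].1 E.list[t].2.1 E.list[t].2.2 := fun t ht =>
    (E.mem_list _ _ _).1 (List.getElem_mem ht)
  constructor
  · intro H p q hpq
    refine ⟨fun a p' hp => ?_, fun a q' hq => ?_⟩
    · obtain ⟨t, ht, e⟩ := List.getElem_of_mem ((E.mem_list _ _ _).2 hp)
      obtain ⟨t', ht', e1, e2, e3⟩ := (H t ht (E.num q) (Fin.is_lt _)).1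
        (by rw [src t ht, e]; exact hpq)
      have h1 : E.list[t'].1 = q := E.num.injective (Fin.ext (by rw [← src t' ht', e1]))
      have h2 := hlab t ht t' ht' e2
      have h3 := htr t' ht'
      rw [h1, ← h2, e] at h3
      refine ⟨_, h3, ?_⟩
      rw [tgt t ht, tgt t' ht', e] at e3
      exact e3
    · obtain ⟨t, ht, e⟩ := List.getElem_of_mem ((E.mem_list _ _ _).2 hq)
      obtain ⟨t', ht', e1, e2, e3⟩ := (H t ht (E.num p) (Fin.is_lt _)).2
        (by rw [src t ht, e]; exact hpq)
      have h1 : E.list[t'].1 = p := E.num.injective (Fin.ext (by rw [← src t' ht', e1]))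
      have h2 := hlab t' ht' t ht e2
      have h3 := htr t' ht'
      rw [h1, h2, e] at h3
      refine ⟨_, h3, ?_⟩
      rw [tgt t ht, tgt t' ht', e] at e3
      exact e3
  · intro H t ht q hq
    obtain ⟨q, rfl⟩ : ∃ q', (E.num q' : ℕ) = q := ⟨E.num.symm ⟨q, hq⟩, by simp⟩
    refine ⟨fun hm => ?_, fun hm => ?_⟩
    · rw [src t ht] at hm
      obtain ⟨q', h1, h2⟩ := (H _ _ hm).1 _ _ (htr t ht)
      obtain ⟨t', ht', e⟩ := List.getElem_of_mem ((E.mem_list _ _ _).2 h1)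
      refine ⟨t', ht', by rw [src t' ht', e], by rw [lab t ht, lab t' ht', e], ?_⟩
      rw [tgt t ht, tgt t' ht', e]
      exact h2
    · rw [src t ht] at hm
      obtain ⟨p', h1, h2⟩ := (H _ _ hm).2 _ _ (htr t ht)
      obtain ⟨t', ht', e⟩ := List.getElem_of_mem ((E.mem_list _ _ _).2 h1)
      refine ⟨t', ht', by rw [src t' ht', e], by rw [lab t ht, lab t' ht', e], ?_⟩
      rw [tgt t ht, tgt t' ht', e]
      exact h2

theorem finite_states (E : A.Presentation n) : Finite S := Finite.of_equiv _ E.num.symm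

theorem isLimit_toRel {y Z : Finset ℕ} (hy : y ⊆ Finset.range (n * n))
    (hZ : IsGreatest {R | R ⊆ y ∧ E.table.obligations.Closed R} Z) :
    FixEnum.IsLimit A.bisimMap (E.toRel y) (E.toRel Z) := by
  have := E.finite_states
  refine FixEnum.isLimit_of_isGreatest A.monotone_bisimMap A.bisimMap_le ⟨⟨?_, ?_⟩, ?_⟩
  · exact (E.toRel_subset_iff (hZ.1.1.trans hy)).2 hZ.1.1
  · exact (A.isFixedPt_bisimMap_iff _).2
      ((E.closed_iff_isBisimulation (hZ.1.1.trans hy)).1 hZ.1.2)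
  · rintro R ⟨h1, h2⟩
    obtain ⟨R, hR, rfl⟩ := E.exists_toRel_eq R
    refine (E.toRel_subset_iff hR).2 (hZ.2 ⟨(E.toRel_subset_iff hR).1 h1, ?_⟩)
    exact (E.closed_iff_isBisimulation hR).2 ((A.isFixedPt_bisimMap_iff _).1 h2)

/-! ### Lower covers and the test of the algorithm -/

theorem covBy_toRel_iff {X : Finset ℕ} (hX : X ⊆ Finset.range (n * n)) (w : Set (S × S)) :
    w ⋖ E.toRel X ↔ ∃ a ∈ X, w = E.toRel (X.erase a) := by
  rw [Set.covBy_iff_exists_insert]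
  constructor
  · rintro ⟨x, hx, h⟩
    have hxX : x ∈ E.toRel X := h ▸ Set.mem_insert x w
    refine ⟨E.pos x, hxX, ?_⟩
    ext z
    rw [mem_toRel, Finset.mem_erase, ← mem_toRel, ← h, Set.mem_insert_iff]
    constructor
    · intro hz
      refine ⟨fun he => hx ?_, .inr hz⟩
      rwa [← E.pos_injective he]
    · rintro ⟨h1, rfl | h2⟩
      · exact absurd rfl h1
      · exact h2
  · rintro ⟨a, ha, rfl⟩
    obtain ⟨x, rfl⟩ := E.exists_pos_eq (Finset.mem_range.1 (hX ha))
    refine ⟨x, by simp, ?_⟩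
    ext z
    simp only [Set.mem_insert_iff, mem_toRel, Finset.mem_erase]
    constructor
    · rintro (rfl | h)
      · exact ha
      · exact h.2
    · intro h
      by_cases e : z = x
      · exact .inl e
      · exact .inr ⟨fun he => e (E.pos_injective he), h⟩

/-- The words agree before position `a`, where the first has a zero and the second a one. -/
theorem indWord_erase_lt {N a b : ℕ} {X : Finset ℕ} (ha : a ∈ X) (hX : X ⊆ Finset.range N)
    (hab : a < b) : indWord N (X.erase a) < indWord N (X.erase b) := by
  have haN := Finset.mem_range.1 (hX ha)
  obtain ⟨c, rfl⟩ : ∃ c, N = a + (c + 1) := ⟨N - a - 1, by omega⟩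
  have hpre : (List.range a).map (ind (X.erase a)) = (List.range a).map (ind (X.erase b)) := by
    refine List.map_congr_left fun i hi => ?_
    have := List.mem_range.1 hi
    simp [ind, show i ≠ a by omega, show i ≠ b by omega]
  rw [indWord, indWord, List.range_add, List.map_append, List.map_append, hpre]
  refine List.append_left_lt ?_
  rw [List.range_succ_eq_map]
  simp only [List.map_cons, add_zero]
  rw [ind_of_notMem (Finset.notMem_erase a X),
    ind_of_mem (Finset.mem_erase.2 ⟨hab.ne, ha⟩)]
  exact List.Lex.rel zero_lt_one

theorem lex_erase_iff {a b : ℕ} {X : Finset ℕ} (ha : a ∈ X) (hb : b ∈ X)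
    (hX : X ⊆ Finset.range (n * n)) :
    E.lex (E.toRel (X.erase a)) (E.toRel (X.erase b)) ↔ a ≤ b := by
  unfold lex
  rw [relWord_toRel, relWord_toRel]
  constructor
  · intro h
    by_contra hab
    exact absurd (indWord_erase_lt hb hX (not_le.1 hab)) (not_lt.2 h)
  · intro h
    rcases h.lt_or_eq with h | rfl
    · exact (indWord_erase_lt ha hX h).le
    · exact le_rfl

open FixEnum

theorem toRel_le_erase_iff {a : ℕ} {X Z : Finset ℕ} (hZ : Z ⊆ X)
    (hX : X ⊆ Finset.range (n * n)) : E.toRel Z ≤ E.toRel (X.erase a) ↔ a ∉ Z := by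
  rw [E.toRel_subset_iff (hZ.trans hX)]
  exact ⟨fun h ha => Finset.notMem_erase a X (h ha),
    fun h c hc => Finset.mem_erase.2 ⟨by rintro rfl; exact h hc, hZ hc⟩⟩

theorem unsearched_singleton_iff {b : ℕ} {X Z : Finset ℕ} (hb : b ∈ X) (hZ : Z ⊆ X)
    (hX : X ⊆ Finset.range (n * n)) :
    Unsearched E.lex {(E.toRel X, E.toRel (X.erase b))} (E.toRel Z) ↔
      ∀ a ∈ X, a < b + 1 → a ∈ Z := by
  constructor
  · intro h a ha hab
    have := h _ _ rfl (E.toRel (X.erase a)) ((E.covBy_toRel_iff hX _).2 ⟨a, ha, rfl⟩)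
      ((E.lex_erase_iff ha hb hX).2 (by omega))
    rw [E.toRel_le_erase_iff hZ hX] at this
    exact not_not.1 this
  · rintro h u v huv w hw hlex
    obtain ⟨rfl, rfl⟩ := Prod.mk.inj huv
    obtain ⟨a, ha, rfl⟩ := (E.covBy_toRel_iff hX _).1 hw
    rw [E.toRel_le_erase_iff hZ hX, not_not]
    exact h a ha (Nat.lt_succ_of_le ((E.lex_erase_iff ha hb hX).1 hlex))

theorem unsearched_union_iff {D D' : Set (Set (S × S) × Set (S × S))} {z : Set (S × S)} :
    Unsearched E.lex (D ∪ D') z ↔ Unsearched E.lex D z ∧ Unsearched E.lex D' z := by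
  constructor
  · exact fun h => ⟨fun u v huv => h u v (.inl huv), fun u v huv => h u v (.inr huv)⟩
  · rintro ⟨h, h'⟩ u v (huv | huv)
    · exact h u v huv
    · exact h' u v huv

open Classical in
/-- The lower covers of `X` that erase positions from `b` on, in lexicographic order. -/
noncomputable def covers (X : Finset ℕ) (b : ℕ) : List (Set (S × S)) :=
  ((List.range' b (n * n - b)).filter (· ∈ X)).map fun a => E.toRel (X.erase a)

theorem covers_eq_nil (X : Finset ℕ) : E.covers X (n * n) = [] := by
  simp [covers]

theorem covers_of_mem {X : Finset ℕ} {b : ℕ} (hb : b < n * n) (hX : b ∈ X) :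
    E.covers X b = E.toRel (X.erase b) :: E.covers X (b + 1) := by
  unfold covers
  rw [show n * n - b = (n * n - (b + 1)) + 1 by omega, List.range'_succ,
    List.filter_cons_of_pos (by simpa using hX), List.map_cons]

theorem covers_of_notMem {X : Finset ℕ} {b : ℕ} (hb : b < n * n) (hX : b ∉ X) :
    E.covers X b = E.covers X (b + 1) := by
  unfold covers
  rw [show n * n - b = (n * n - (b + 1)) + 1 by omega, List.range'_succ,
    List.filter_cons_of_neg (by simpa using hX)]

theorem listsLowerCovers_covers {X : Finset ℕ} (hX : X ⊆ Finset.range (n * n)) :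
    ListsLowerCovers E.lex (E.toRel X) (E.covers X 0) := by
  classical
  have hlt : (((List.range' 0 (n * n - 0)).filter (· ∈ X))).Pairwise (· < ·) :=
    List.Pairwise.filter _ List.pairwise_lt_range'
  have hmem : ∀ a ∈ (List.range' 0 (n * n - 0)).filter (· ∈ X), a ∈ X := fun a ha => by
    simpa using (List.mem_filter.1 ha).2
  refine ⟨?_, ?_, fun y => ?_⟩
  · refine List.Nodup.map_on (fun a ha b hb h => ?_) (hlt.imp fun h => h.ne)
    have h1 := (E.lex_erase_iff (hmem a ha) (hmem b hb) hX).1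
      (by rw [h]; exact le_refl (relWord E.num _))
    have h2 := (E.lex_erase_iff (hmem b hb) (hmem a ha) hX).1
      (by rw [h]; exact le_refl (relWord E.num _))
    exact le_antisymm h1 h2
  · refine List.pairwise_map.2 (hlt.imp_of_mem fun ha hb h => ?_)
    exact (E.lex_erase_iff (hmem _ ha) (hmem _ hb) hX).2 h.le
  · rw [E.covBy_toRel_iff hX]
    simp only [covers, List.mem_map, List.mem_filter, List.mem_range'_1, decide_eq_true_eq]
    constructor
    · rintro ⟨a, ⟨_, ha⟩, rfl⟩; exact ⟨a, ha, rfl⟩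
    · rintro ⟨a, ha, rfl⟩
      have := Finset.mem_range.1 (hX ha)
      exact ⟨a, ⟨by omega, ha⟩, rfl⟩

/-- The event for relations that corresponds to an event for sets of positions. -/
def event : Event (Finset ℕ) → Event (Set (S × S))
  | .query y z => .query (E.toRel y) (E.toRel z)
  | .output x => .output (E.toRel x)

theorem outputs_map_event (tr : List (Event (Finset ℕ))) :
    outputs (tr.map E.event) = (outputs tr).map E.toRel := by
  induction tr with
  | nil => rfl
  | cons e tr ih => cases e <;> simp [event, ih]

theorem encodeEvent_event (e : Event (Finset ℕ)) :
    E.encodeEvent (E.event e) = RAM.encode (n * n) e := by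
  cases e <;> simp [event, encodeEvent, RAM.encode, relWord_toRel]

/-- The enumeration with sets of positions is an execution of the algorithm. On subsets of the
current set `X`, the test for the regions that were searched before the call of the function is
that the subset agrees with `X` below `β`, and the test for the region that was searched in the
current for-loop is that it agrees with `X` below `b`. -/
theorem runs_of_trace {X : Finset ℕ} {β b : ℕ} {tr : List (Event (Finset ℕ))}
    (h : Trace (n * n) E.table.obligations.Closed X β b tr) : X ⊆ Finset.range (n * n) →
    ∀ (P : Set (Set (S × S))) (D Es : Set (Set (S × S) × Set (S × S))),
      (∀ Z ⊆ X, Unsearched E.lex D (E.toRel Z) ↔ ∀ a ∈ X, a < β → a ∈ Z) →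
      (∀ Z ⊆ X, Unsearched E.lex Es (E.toRel Z) ↔ ∀ a ∈ X, a < b → a ∈ Z) →
      Runs A.bisimMap E.lex (.forLoop (E.toRel X) P D Es (E.covers X b)) (tr.map E.event) := by
  classical
  -- an erased position below `β` is missing from the limit
  have fresh_iff : ∀ {X Z : Finset ℕ} {β b : ℕ}, b ∈ X → Z ⊆ X.erase b →
      (((∀ a ∈ X, a < β → a ∈ Z) ∧ ∀ a ∈ X, a < b → a ∈ Z) ↔ Fresh X Z β b) := by
    intro X Z β b hb hZ
    refine and_congr_left fun h => ⟨fun h' => ?_, fun h' a ha hab => h a ha (hab.trans_le h')⟩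
    by_contra hlt
    exact Finset.notMem_erase b X (hZ (h' b hb (not_le.1 hlt)))
  induction h with
  | done => intro _ P D Es _ _; rw [covers_eq_nil]; exact .done
  | @absent X β b tr hb hbX h ih =>
    intro hX P D Es hD hE
    rw [E.covers_of_notMem hb hbX]
    refine ih hX P D Es hD fun Z hZ => (hE Z hZ).trans (forall₂_congr fun a ha => ?_)
    have : a ≠ b := by rintro rfl; exact hbX ha
    rw [show a < b + 1 ↔ a < b by omega]
  | @skip X β b Z tr hb hbX hZ ht h ih =>
    intro hX P D Es hD hE
    have hZX : Z ⊆ X := hZ.1.1.trans (Finset.erase_subset _ _)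
    rw [E.covers_of_mem hb hbX]
    refine .skip (E.isLimit_toRel ((Finset.erase_subset _ _).trans hX) hZ) ?_
      (ih hX P D _ hD fun Z' hZ' => E.unsearched_singleton_iff hbX hZ' hX)
    rwa [unsearched_union_iff, hD Z hZX, hE Z hZX, fresh_iff hbX hZ.1.1]
  | @recurse X β b Z tr₁ tr₂ hb hbX hZ ht h₁ h₂ ih₁ ih₂ =>
    intro hX P D Es hD hE
    have hZX : Z ⊆ X := hZ.1.1.trans (Finset.erase_subset _ _)
    rw [E.covers_of_mem hb hbX]
    simp only [List.map_cons, List.map_append]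
    refine .recurse (tr₁ := E.event (.output Z) :: tr₁.map E.event)
      (E.isLimit_toRel ((Finset.erase_subset _ _).trans hX) hZ) ?_
      (.search (E.listsLowerCovers_covers (hZX.trans hX))
        (ih₁ (hZX.trans hX) _ _ _ (fun Z' hZ' => ?_) fun Z' hZ' => ?_))
      (ih₂ hX P D _ hD fun Z' hZ' => E.unsearched_singleton_iff hbX hZ' hX)
    · rwa [unsearched_union_iff, hD Z hZX, hE Z hZX, fresh_iff hbX hZ.1.1]
    · rw [unsearched_union_iff, hD Z' (hZ'.trans hZX), hE Z' (hZ'.trans hZX),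
        fresh_iff hbX (hZ'.trans hZ.1.1)]
      constructor
      · exact fun h a ha hab => h.2 a (hZX ha) hab
      · exact fun h => ⟨ht.1, fun a ha hab => h a (ht.2 a ha hab) hab⟩
    · simp [Unsearched]

end LTS.Presentation

/-! ### The program and its resources -/

namespace RAM

/-- The enumeration program: the arrays start behind the `3 * m` cells of the input. -/
def bisimulationProgram : Prog :=
  .seq (.const 2 3) (.seq (.arith .mul 2 2 1) enumerate)

end RAM

namespace LTS.Presentation

open FixEnum RAM

variable {S Λ : Type*} {A : LTS S Λ} {n : ℕ} (E : A.Presentation n)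

/-- The number of entries of each array is this multiple of `n ^ 4`, if there are at most
`K * n ^ 2` transitions. -/
def sizeFactor (K : ℕ) : ℕ := 9 + 2 * K + 2 * K ^ 2

/-- The constant of the resource bounds, if there are at most `K * n ^ 2` transitions. -/
def boundFactor (K : ℕ) : ℕ := 27000 * sizeFactor K + 3 * K

theorem length_le_pow_four (hn : 1 ≤ n) {m K : ℕ} (hm : m ≤ K * n ^ 2) : m ≤ K * n ^ 4 :=
  hm.trans (Nat.mul_le_mul_left _ (Nat.pow_le_pow_right hn (by norm_num)))

/-- The layout of the memory for a presented transition system with `n` states and at most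
`K * n ^ 2` transitions. -/
def layout (hn : 1 ≤ n) {K : ℕ} (hm : E.list.length ≤ K * n ^ 2) : Layout where
  bound := boundFactor K * n ^ 4
  base := 3 * E.list.length
  size := sizeFactor K * n ^ 4
  input i := E.inputWord.getD i 0
  fits := by
    have h1 := length_le_pow_four hn hm
    have h2 : boundFactor K * n ^ 4 = 27000 * (sizeFactor K * n ^ 4) + 3 * (K * n ^ 4) := by
      unfold boundFactor; ring
    omega
  size_pos := by unfold sizeFactor; positivity

theorem square_add_two_le (hn : 1 ≤ n) : (n * n + 2) * (n * n + 2) ≤ 9 * n ^ 4 := by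
  have : n * n + 2 ≤ 3 * (n * n) := by nlinarith
  calc (n * n + 2) * (n * n + 2) ≤ (3 * (n * n)) * (3 * (n * n)) := Nat.mul_le_mul this this
    _ = 9 * n ^ 4 := by ring

theorem resources_le (hn : 1 ≤ n) {m K : ℕ} (hm : m ≤ K * n ^ 2) :
    (n * n + 2) * (n * n + 2) ≤ sizeFactor K * n ^ 4 ∧ 2 * (m * n) ≤ sizeFactor K * n ^ 4 ∧
      2 * (m * m) ≤ sizeFactor K * n ^ 4 := by
  have e : sizeFactor K * n ^ 4 = 9 * n ^ 4 + 2 * (K * n ^ 4) + 2 * (K ^ 2 * n ^ 4) := by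
    unfold sizeFactor; ring
  have h1 := square_add_two_le hn
  have h2 : m * n ≤ K * n ^ 4 := calc
    m * n ≤ K * n ^ 2 * n ^ 2 := Nat.mul_le_mul hm (by nlinarith)
    _ = K * n ^ 4 := by ring
  have h3 : m * m ≤ K ^ 2 * n ^ 4 := calc
    m * m ≤ K * n ^ 2 * (K * n ^ 2) := Nat.mul_le_mul hm hm
    _ = K ^ 2 * n ^ 4 := by ring
  omega

theorem reads_table (hn : 1 ≤ n) {K : ℕ} (hm : E.list.length ≤ K * n ^ 2) :
    Reads (E.layout hn hm) E.table := by
  obtain ⟨h1, h2, h3⟩ := resources_le hn hm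
  have h4 : n * n ≤ (n * n + 2) * (n * n + 2) := by nlinarith
  exact ⟨rfl, fun _ _ => rfl, fun _ _ => rfl, fun _ _ => rfl, h4.trans h1, h2, h3⟩

theorem fits_table (hn : 1 ≤ n) {K : ℕ} (hm : E.list.length ≤ K * n ^ 2) :
    Fits (E.layout hn hm) E.table.obligations := by
  obtain ⟨h1, h2, h3⟩ := resources_le hn hm
  exact ⟨h1, h2, h3⟩

theorem inputWord_getD_le {b : ℕ} (hn : n ≤ b) (hm : E.list.length ≤ b) (i : ℕ) :
    E.inputWord.getD i 0 ≤ b := by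
  rw [List.getD_eq_getElem?_getD]
  by_cases hi : i < E.inputWord.length
  · rw [List.getElem?_eq_getElem hi, Option.getD_some]
    obtain ⟨t, ht, h⟩ := List.mem_flatMap.1 (List.getElem_mem hi)
    have h1 := (E.num t.1).is_lt
    have h2 := (E.num t.2.2).is_lt
    have h3 := E.lab_lt t ht
    simp only [List.mem_cons, List.not_mem_nil, or_false] at h
    omega
  · rw [List.getElem?_eq_none (by omega)]
    simp

theorem exec_bisimulationProgram (hn : 1 ≤ n) {K : ℕ} (hm : E.list.length ≤ K * n ^ 2)
    {Z : Finset ℕ} {tr : List (Event (Finset ℕ))}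
    (hZ : IsGreatest {R | R ⊆ Finset.range (n * n) ∧ E.table.obligations.Closed R} Z)
    (h : Trace (n * n) E.table.obligations.Closed Z 0 0 tr) :
    ∃ τ, Exec (boundFactor K * n ^ 4) (boundFactor K * n ^ 4) bisimulationProgram E.initState τ ∧
      entries τ.log =
        (Event.query (Finset.range (n * n)) Z :: .output Z :: tr).map (encode (n * n)) ∧
      DelayAtMost (boundFactor K * n ^ 8) τ := by
  set V := E.layout hn hm with hVdef
  have hbound : V.bound = boundFactor K * n ^ 4 := rfl
  have hfits := V.fits
  have hbase : V.base = 3 * E.list.length := rfl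
  have hpos := V.size_pos
  have hsize : n ≤ V.size := by
    have := (E.reads_table hn hm).size
    calc n ≤ n * n := by nlinarith
      _ ≤ V.size := this
  have hinput := E.inputWord_getD_le (b := V.bound) (by omega) (by omega)
  set σ₁ := E.initState.setReg 2 3 with e₁
  have h2 : Op.eval .mul (σ₁.reg 2) (σ₁.reg 1) = V.base := by
    simp [e₁, State.setReg, initState, Op.eval, hbase]
  set σ₂ := σ₁.setReg 2 V.base with e₂
  have rel : Rel V σ₂ ⟨σ₂.reg, fun _ _ => 0, 2, [], []⟩ := by
    refine ⟨⟨fun _ _ => rfl, fun a ha i hi => ?_, fun _ _ => rfl, ?_, fun x hx => ?_, hinput⟩,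
      rfl, rfl, rfl⟩
    · show E.inputWord.getD _ 0 = 0
      rw [List.getD_eq_getElem?_getD, List.getElem?_eq_none]
      · rfl
      · rw [length_inputWord]; omega
    · simp [e₂]
    · by_cases hx2 : x = 2
      · subst hx2; simp [e₂]; omega
      · simp only [e₂, e₁, State.setReg, Function.update_of_ne hx2, initState]
        split_ifs <;> omega
  obtain ⟨τ, s, hx, hr, hlog, hchain⟩ := wp_enumerate (E.reads_table hn hm) (E.fits_table hn hm)
    hZ h (s := ⟨σ₂.reg, fun _ _ => 0, 2, [], []⟩)
    (by simp [e₂, e₁, State.setReg, initState]; rfl)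
    (by simp [e₂, e₁, State.setReg, initState]; rfl) (fun _ _ => rfl) rfl rfl le_rfl σ₂ rel
  refine ⟨τ, .seq (.const (by omega)) (.seq (.arith (by rw [h2]; omega)) ?_), ?_, ?_⟩
  · rw [h2]; exact hx
  · rw [hr.log]; exact hlog
  · rw [DelayAtMost, hr.log, hr.time]
    refine hchain.imp fun t t' ht => ht.trans (Nat.add_le_add_left ?_ t)
    calc 3000 * V.size * ((n * n + 2) * (n * n + 2))
        ≤ 3000 * (sizeFactor K * n ^ 4) * (9 * n ^ 4) :=
          Nat.mul_le_mul_left _ (square_add_two_le hn)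
      _ = 27000 * sizeFactor K * n ^ 8 := by ring
      _ ≤ boundFactor K * n ^ 8 := Nat.mul_le_mul_right _ (by unfold boundFactor; omega)

end LTS.Presentation

theorem mainTheorem7 :
    -- the map whose fixed points are enumerated
    (∀ (S : Type u) (Λ : Type v) (A : LTS S Λ),
      Monotone A.bisimMap ∧ (∀ R, A.bisimMap R ≤ R) ∧
        ∀ R, Function.IsFixedPt A.bisimMap R ↔ A.IsBisimulation R) ∧
    -- one program for all inputs; the constant depends only on the constant `K` in `m ≤ K n ^ 2`
    ∃ prog : RAM.Prog, ∀ K : ℕ, ∃ C : ℕ,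
      ∀ (S : Type u) (Λ : Type v) [Nonempty S] (A : LTS S Λ) (n : ℕ) (E : A.Presentation n),
        E.list.length ≤ K * n ^ 2 →
        ∃ tr : List (FixEnum.Event (Set (S × S))),
          FixEnum.AlgorithmRuns A.bisimMap E.lex ⊤ tr ∧
          (FixEnum.outputs tr).Nodup ∧
          (∀ R, R ∈ FixEnum.outputs tr ↔ A.IsBisimulation R) ∧
          ∃ τ : RAM.State,
            RAM.Exec (C * n ^ 4) (C * n ^ 4) prog E.initState τ ∧
            E.Implements τ tr ∧
            RAM.DelayAtMost (C * n ^ 8) τ := by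
  refine ⟨fun S Λ A => ⟨A.monotone_bisimMap, A.bisimMap_le, A.isFixedPt_bisimMap_iff⟩,
    RAM.bisimulationProgram, fun K => ⟨LTS.Presentation.boundFactor K, ?_⟩⟩
  intro S Λ _ A n E hm
  have hn : 1 ≤ n := (E.num (Classical.arbitrary S)).pos
  obtain ⟨Z, hZ⟩ := E.table.obligations.exists_isGreatest_closed (Finset.range (n * n))
  obtain ⟨tr, htr⟩ := FixEnum.exists_trace (N := n * n)
    E.table.obligations.exists_isGreatest_closed _ Z rfl (n * n) 0 0 (by omega)
  have hZN : Z ⊆ Finset.range (n * n) := hZ.1.1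
  obtain ⟨hnodup, hmem⟩ := htr.outputs hZN
  have hsub : ∀ R ∈ Z :: FixEnum.outputs tr, R ⊆ Finset.range (n * n) := by
    intro R hR
    rcases List.mem_cons.1 hR with rfl | hR
    · exact hZN
    · exact ((hmem R).1 hR).2.1.trans hZN
  obtain ⟨τ, hx, hlog, hdelay⟩ := E.exec_bisimulationProgram hn hm hZ htr
  refine ⟨(.query (Finset.range (n * n)) Z :: .output Z :: tr).map E.event, ?_, ?_, ?_, τ, hx, ?_,
    hdelay⟩
  · have hlim := E.isLimit_toRel subset_rfl hZ
    rw [E.toRel_range] at hlim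
    simp only [List.map_cons, LTS.Presentation.event, E.toRel_range]
    exact .start hlim (.search (E.listsLowerCovers_covers hZN)
      (E.runs_of_trace htr hZN _ _ _ (by simp [FixEnum.Unsearched]) (by simp [FixEnum.Unsearched])))
  · rw [E.outputs_map_event]
    refine List.Nodup.map_on (fun R hR R' hR' h => ?_)
      (List.nodup_cons.2 ⟨fun h => ((hmem Z).1 h).2.2.1 rfl, hnodup⟩)
    exact ((E.toRel_subset_iff (hsub R hR)).1 h.le).antisymm
      ((E.toRel_subset_iff (hsub R' hR')).1 h.ge)
  · intro R
    rw [E.outputs_map_event]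
    constructor
    · intro h
      obtain ⟨R, hR, rfl⟩ := List.mem_map.1 h
      refine (E.closed_iff_isBisimulation (hsub R hR)).1 ?_
      rcases List.mem_cons.1 hR with rfl | hR
      · exact hZ.1.2
      · exact ((hmem R).1 hR).1
    · intro h
      obtain ⟨R, hR, rfl⟩ := E.exists_toRel_eq R
      have hc := (E.closed_iff_isBisimulation hR).2 h
      refine List.mem_map.2 ⟨R, ?_, rfl⟩
      by_cases e : R = Z
      · exact e ▸ List.mem_cons_self
      · exact List.mem_cons_of_mem _ ((hmem R).2 ⟨hc, hZ.2 ⟨hR, hc⟩, e, by simp⟩)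
  · unfold LTS.Presentation.Implements
    rw [List.map_map]
    refine hlog.trans (List.map_congr_left fun e _ => ?_)
    exact (E.encodeEvent_event e).symm
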